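/- Let $K$ be a non-archimedean local field with $\mathrm{char}(K)\neq 2$ and ring of integers $\mathcal{O}_K$, let $\mathfrak{A}$ be a quaternion division algebra over $K$, and let $\mathfrak{D}$ be its (unique) maximal $\mathcal{O}_K$-order. Let $\Delta\in\mathcal{O}_K^*$ be an unramified unit, that is, a unit such that $K(\sqrt{\Delta})/K$ is an unramified quadratic extension. Let $L/K$ be an algebraic extension with subextensions $E_1/K$ and $E_2/K$ such that $E_1$ contains $\sqrt{\Delta}$, while $E_2$ contains a quadratic extension of $K$ but does not contain $\sqrt{\Delta}$. For an algebraic extension $E/K$ let $\mathcal{O}_E$ be the integral closure of $\mathcal{O}_K$ in $E$. A representation $\mathfrak{D}\to\mathbb{M}_2(\mathcal{O}_E)$ is a homomorphism of $\mathcal{O}_K$-algebras, and two of them are conjugate if they differ by conjugation by an element of $\mathrm{GL}_2(\mathcal{O}_E)$. Let $e_1=e(E_1/K)$ be the ramification index, i.e. the index (possibly infinite) of the value group of $K$ in that of $E_1$. Then: (1) There is a representation $\rho:\mathfrak{D}\to\mathbb{M}_2(\mathcal{O}_{E_2})$, and all such representations are conjugate. (2) There are exactly $e_1+1$ conjugacy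 classes of representations $\psi:\mathfrak{D}\to\mathbb{M}_2(\mathcal{O}_{E_1})$ (infinitely many if $e_1=\infty$). (3) Assume that $e_1$ is finite. A representation $\rho$ as in (1) is defined over $E_1$, meaning that over $\mathcal{O}_L$ it is conjugate to the extension of scalars of a representation $\mathfrak{D}\to\mathbb{M}_2(\mathcal{O}_{E_1})$, if and only if $e_1$ is even. -/

import Mathlib

open ValuativeRel
open scoped Quaternion

noncomputable section

/-- `A` is a quaternion algebra over the field `K` of characteristic different from `2`: it is
isomorphic to `(a, b / K)`, generated by `i, j` with `i² = a`, `j² = b`, `ij = -ji`, for some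
nonzero `a` and `b`. -/
def IsQuaternionAlgebra (K A : Type*) [Field K] [Ring A] [Algebra K A] : Prop :=
  ∃ a b : K, a ≠ 0 ∧ b ≠ 0 ∧ Nonempty (A ≃ₐ[K] ℍ[K, a, b])

section Orders

variable {K A : Type*} [Field K] [ValuativeRel K] [Ring A] [Algebra K A]

/-- `D` is an order of the `K`-algebra `A`: a subring which is a finitely generated
`𝒪[K]`-submodule of `A` spanning `A` over `K`. -/
structure IsOrder (D : Subalgebra 𝒪[K] A) : Prop where
  fg : (Subalgebra.toSubmodule D).FG
  span_eq_top : Submodule.span K (D : Set A) = ⊤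

/-- `D` is a maximal order of `A`: an order not properly contained in another one. -/
structure IsMaximalOrder (D : Subalgebra 𝒪[K] A) : Prop where
  isOrder : IsOrder D
  eq_of_le : ∀ D' : Subalgebra 𝒪[K] A, IsOrder D' → D ≤ D' → D = D'

end Orders

/-- The ring of integers `𝒪_E` of an algebraic extension `E` of the local field `K`. -/
abbrev IntegerRing (K E : Type*) [Field K] [ValuativeRel K] [Field E] [Algebra K E] :
    Subalgebra 𝒪[K] E :=
  integralClosure 𝒪[K] E

/-- The ramification index `e(E/K)` of an algebraic extension `E` of the local field `K`: the index
of the value group `Kˣ / 𝒪_Kˣ` of `K` in the value group `Eˣ / 𝒪_Eˣ` of `E`, i.e. the cardinality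
of `Eˣ / Kˣ 𝒪_Eˣ` (it is `⊤` if the index is infinite). -/
def ramificationIndex (K E : Type*) [Field K] [ValuativeRel K] [Field E] [Algebra K E] : ℕ∞ :=
  ENat.card (Eˣ ⧸ ((Units.map (algebraMap K E : K →* E)).range ⊔
    (Units.map ((IntegerRing K E).val : IntegerRing K E →* E)).range))

open Polynomial in
/-- `Δ` is an unramified unit of `𝒪[K]`: a unit such that `K(√Δ)` is an unramified quadratic
extension of `K`. Since residue fields of local fields are finite, hence perfect, an extension
is unramified when its ramification index is `1`. -/
structure IsUnramifiedUnit {K : Type*} [Field K] [ValuativeRel K] (Δ : 𝒪[K]) : Prop where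
  isUnit : IsUnit Δ
  not_isSquare : ¬ IsSquare (Δ : K)
  unramified : ramificationIndex K (X ^ 2 - C (Δ : K) : K[X]).SplittingField = 1

section Representations

variable {K A : Type*} [Field K] [ValuativeRel K] [Ring A] [Algebra K A]

/-- The representations `D → M₂(𝒪_E)` of an order `D`. -/
abbrev IntegralRep (D : Subalgebra 𝒪[K] A) (E : Type*) [Field E] [Algebra K E] :=
  D →ₐ[𝒪[K]] Matrix (Fin 2) (Fin 2) (IntegerRing K E)

namespace IntegralRep

variable {D : Subalgebra 𝒪[K] A} {E : Type*} [Field E] [Algebra K E]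

/-- Two representations `D → M₂(𝒪_E)` are conjugate if they differ by conjugation by an element
of `GL₂(𝒪_E)`. -/
def IsConjugate (ρ ρ' : IntegralRep D E) : Prop :=
  ∃ g : GL (Fin 2) (IntegerRing K E), ∀ x : D, ρ' x =
    (g : Matrix (Fin 2) (Fin 2) (IntegerRing K E)) * ρ x *
      ((g⁻¹ : GL (Fin 2) (IntegerRing K E)) : Matrix (Fin 2) (Fin 2) (IntegerRing K E))

variable (D E) in
/-- Conjugacy as an equivalence relation. -/
def conjSetoid : Setoid (IntegralRep D E) where
  r := IsConjugate
  iseqv :=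
    { refl := fun ρ => ⟨1, fun x => by simp⟩
      symm := by
        rintro ρ ρ' ⟨g, hg⟩
        refine ⟨g⁻¹, fun x => ?_⟩
        rw [hg x, inv_inv]
        simp only [mul_assoc, Units.inv_mul, Units.inv_mul_cancel_left, mul_one]
      trans := by
        rintro ρ ρ' ρ'' ⟨g, hg⟩ ⟨h, hh⟩
        refine ⟨h * g, fun x => ?_⟩
        rw [hh x, hg x, mul_inv_rev, Units.val_mul, Units.val_mul]
        simp only [mul_assoc] }

variable (D E) in
/-- The set of conjugacy classes of representations `D → M₂(𝒪_E)`. -/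
def ConjClass : Type _ := Quotient (conjSetoid D E)

/-- Extension of scalars of a representation from `𝒪_E` to `𝒪_L`, for `L` an extension of `E`. -/
def extend (ρ : IntegralRep D E) (L : Type*) [Field L] [Algebra K L] [Algebra E L]
    [IsScalarTower K E L] : IntegralRep D L :=
  (AlgHom.mapMatrix
    ((IsScalarTower.toAlgHom K E L).restrictScalars 𝒪[K]).mapIntegralClosure).comp ρ

/-- The representation `ρ : D → M₂(𝒪_E)` is defined over `F`, where `E` and `F` are subfields of
`L`: over `𝒪_L` it becomes conjugate to a representation with coefficients in `𝒪_F`. -/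
def IsDefinedOver (ρ : IntegralRep D E) (F L : Type*) [Field F] [Algebra K F] [Field L]
    [Algebra K L] [Algebra E L] [IsScalarTower K E L] [Algebra F L] [IsScalarTower K F L] : Prop :=
  ∃ ψ : IntegralRep D F, IsConjugate (ψ.extend L) (ρ.extend L)

end IntegralRep

end Representations

end

/-! The order `D` is generated over `𝒪[K]` by `ω` and `j` with `ω² = tω - n`, `j² = ϖ`, `jω = (t -
ω)j`, where `ϖ` is a uniformizer and `X² - tX + n` has no root in the residue field
(`IsMaximalOrder.exists_quaternion_presentation`). A representation is therefore a pair of matrices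
`W`, `J` with these relations. Discriminants of residually irreducible quadratics agree up to
squares, so `X² - tX + n` has a root in `E` exactly when `√Δ` lies in `E`.

If there is a root `α`, the difference `2α - t` of the two roots is a unit. Over the local ring
`𝒪_E` the matrix `W` becomes `diag(α, t - α)`, and the relations force `J = antidiag(a, b)` with `ab
= ϖ`. Conjugation then changes `a` only by a unit, so the classes correspond to the absolute values
`|a|` in `[|ϖ|, 1]`. The half-open part `(|ϖ|, 1]` meets each coset of the value group of `K` once,
which gives `e₁` values, and the endpoint `|ϖ|` is one more (`card_conjClass_of_root`).

If there is no root, `W` has an irreducible quadratic relation over the residue field. Two pairs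
have a nonzero intertwiner over `E`; scaled to be primitive, it stays nonzero modulo the maximal
ideal, its kernel there is stable under `W`, and so it is invertible (`isConjugate_of_no_root`). For
existence, the quadratic subextension has to be ramified, and it contains `P` with `|P|² = |ϖ|`. The
unit `ϖ / P²` has its residue in that of `K`, hence is a value of the norm form `x² + txy + ny²`; so
`ϖ` is one too, and the companion matrix of `X² - tX + n` completes to a pair.

For descent, a representation over `E₂` becomes antidiagonal over `L`. Conjugation over `E₂`
exchanges the two eigenvalues of `W`, which forces `|a| = |b|` and `|a|² = |ϖ|`
(`HasDiagonalForm.absVal_sq_eq`). Descent to `E₁` thus asks for an element of `E₁` with this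
absolute value, i.e. for an element of order two in the quotient of value groups, a group of order
`e₁` (`even_ramificationIndex_iff`). -/

noncomputable section

/-! ### Extension of the absolute value to algebraic extensions; uniformizers. -/

section AbsoluteValues

open IsNonarchimedeanLocalField Polynomial

/-- An absolute value on an algebraic extension of a local field, extending the valuation. -/
theorem exists_absoluteValue_extension (K Ω : Type*) [Field K] [ValuativeRel K]
    [TopologicalSpace K] [IsNonarchimedeanLocalField K] [Field Ω] [Algebra K Ω]
    [Algebra.IsAlgebraic K Ω] :
    ∃ v : AbsoluteValue Ω ℝ, IsNonarchimedean v ∧ (∀ x, v x ≤ 1 ↔ IsIntegral 𝒪[K] x) ∧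
      ∀ x y, minpoly K x = minpoly K y → v x = v y := by
  let := IsTopologicalAddGroup.rightUniformSpace K
  have := isUniformAddGroup_of_addCommGroup (G := K)
  -- An embedding of the value group in the reals makes `K` a complete normed field; the extension
  -- to `Ω` is the spectral norm, multiplicative by completeness and a function of the minimal
  -- polynomial alone.
  let : (Valued.v (R := K) (Γ₀ := ValueGroupWithZero K)).RankOne :=
  { hom' := IsRankLeOne.nonempty.some.emb (R := K).comp MonoidWithZeroHom.ValueGroup₀.embedding
    strictMono' := IsRankLeOne.nonempty.some.strictMono.comp
        MonoidWithZeroHom.ValueGroup₀.embedding_strictMono }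
  let : NontriviallyNormedField K := Valued.toNontriviallyNormedField K (ValueGroupWithZero K)
  have : IsUltrametricDist K := by
    exact Valued.instIsUltrametricDist K (ValueGroupWithZero K)
  have : CompleteSpace K := IsNonarchimedeanLocalField.instCompleteSpace K
  have hnorm : ∀ x : K, ‖x‖ ≤ 1 ↔ x ∈ 𝒪[K] := fun x => by
    rw [Valuation.mem_integer_iff]
    exact Valued.toNormedField.norm_le_one_iff (Γ₀ := ValueGroupWithZero K)
  refine ⟨⟨⟨fun x => spectralNorm K Ω x, fun x y => ?_⟩, fun x => ?_, fun x => ?_, fun x y => ?_⟩,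
    ?_, fun x => ?_, fun x y h => ?_⟩
  · exact spectralAlgNorm_mul x y
  · exact spectralNorm_nonneg x
  · refine ⟨fun h => ?_, fun h => ?_⟩
    · exact eq_zero_of_map_spectralNorm_eq_zero h (Algebra.IsAlgebraic.isAlgebraic x)
    · subst h; exact spectralNorm_zero
  · exact map_add_le_add (spectralAlgNorm K Ω) x y
  · exact isNonarchimedean_spectralNorm
  · change spectralValue (minpoly K x) ≤ 1 ↔ _
    -- Spectral value at most `1` means that the minimal polynomial has coefficients in `𝒪[K]`; for
    -- integral `x` this holds because `𝒪[K]` is integrally closed.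
    rw [spectralValue_le_one_iff (minpoly.monic (Algebra.IsAlgebraic.isAlgebraic x).isIntegral)]
    refine ⟨fun h => ?_, fun h n => ?_⟩
    · have hl : minpoly K x ∈ Polynomial.lifts (algebraMap 𝒪[K] K) := by
        rw [Polynomial.lifts_iff_coeff_lifts]
        intro n
        exact ⟨⟨_, (hnorm _).1 (h n)⟩, rfl⟩
      obtain ⟨p, hp, -, hpm⟩ := Polynomial.lifts_and_degree_eq_and_monic hl
        (minpoly.monic (Algebra.IsAlgebraic.isAlgebraic x).isIntegral)
      refine ⟨p, hpm, ?_⟩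
      rw [IsScalarTower.algebraMap_eq 𝒪[K] K Ω, ← Polynomial.eval₂_map, hp]
      exact minpoly.aeval K x
    · rw [minpoly.isIntegrallyClosed_eq_field_fractions' K h, Polynomial.coeff_map, hnorm]
      exact Subtype.property _
  · change spectralValue _ = spectralValue _
    rw [h]

variable (K : Type*) [Field K] [ValuativeRel K]
    [TopologicalSpace K] [IsNonarchimedeanLocalField K]

/-- A chosen absolute value on the algebraic closure of `K` extending the valuation. -/
def absClosure : AbsoluteValue (AlgebraicClosure K) ℝ :=
  (exists_absoluteValue_extension K (AlgebraicClosure K)).choose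

variable (E : Type*) [Field E] [Algebra K E] [Algebra.IsAlgebraic K E]

/-- The absolute value on an algebraic extension `E` of `K` extending the valuation. -/
def absVal : AbsoluteValue E ℝ :=
  (absClosure K).comp (f := (IsAlgClosed.lift (M := AlgebraicClosure K) (R := K) (S := E) :
    E →ₐ[K] _).toRingHom) (RingHom.injective _)

variable {K E}

/-- Embeddings in the algebraic closure preserve minimal polynomials. Hence `absVal` does not depend
on the chosen embedding, is compatible with towers and is invariant under conjugation. -/
theorem absVal_eq_of_minpoly_eq {E' : Type*} [Field E'] [Algebra K E'] [Algebra.IsAlgebraic K E']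
    {x : E} {y : E'} (h : minpoly K x = minpoly K y) : absVal K E x = absVal K E' y := by
  refine (exists_absoluteValue_extension K (AlgebraicClosure K)).choose_spec.2.2 _ _ ?_
  exact (minpoly.algHom_eq (IsAlgClosed.lift : E →ₐ[K] AlgebraicClosure K)
    (RingHom.injective _) x).trans (h.trans (minpoly.algHom_eq
      (IsAlgClosed.lift : E' →ₐ[K] AlgebraicClosure K) (RingHom.injective _) y).symm)

theorem absVal_algebraMap {L : Type*} [Field L] [Algebra K L] [Algebra.IsAlgebraic K L]
    [Algebra E L] [IsScalarTower K E L] (x : E) :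
    absVal K L (algebraMap E L x) = absVal K E x :=
  absVal_eq_of_minpoly_eq
    (minpoly.algebraMap_eq (algebraMap E L).injective x)

theorem absVal_add_le (x y : E) : absVal K E (x + y) ≤ max (absVal K E x) (absVal K E y) := by
  have h := (exists_absoluteValue_extension K (AlgebraicClosure K)).choose_spec.1
  have := h ((IsAlgClosed.lift : E →ₐ[K] AlgebraicClosure K) x)
    ((IsAlgClosed.lift : E →ₐ[K] AlgebraicClosure K) y)
  rw [← map_add] at this
  exact this

theorem absVal_le_one_iff {x : E} : absVal K E x ≤ 1 ↔ IsIntegral 𝒪[K] x := by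
  have h := (exists_absoluteValue_extension K (AlgebraicClosure K)).choose_spec.2.1
    ((IsAlgClosed.lift : E →ₐ[K] AlgebraicClosure K) x)
  refine Iff.trans h ?_
  exact isIntegral_algHom_iff
    ((IsAlgClosed.lift : E →ₐ[K] AlgebraicClosure K).restrictScalars 𝒪[K]) (RingHom.injective _)

theorem absVal_self_le_one_iff {x : K} : absVal K K x ≤ 1 ↔ x ∈ 𝒪[K] := by
  rw [absVal_le_one_iff]
  refine ⟨fun h => ?_, fun h => ?_⟩
  · obtain ⟨y, rfl⟩ := IsIntegrallyClosed.isIntegral_iff.1 h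
    exact y.2
  · exact isIntegral_algebraMap (x := (⟨x, h⟩ : 𝒪[K]))

theorem absVal_sub_le (x y : E) : absVal K E (x - y) ≤ max (absVal K E x) (absVal K E y) := by
  simpa [sub_eq_add_neg] using absVal_add_le (K := K) x (-y)

theorem absVal_add_eq_right {x y : E} (h : absVal K E x < absVal K E y) :
    absVal K E (x + y) = absVal K E y := by
  refine le_antisymm ((absVal_add_le x y).trans (max_le h.le le_rfl)) ?_
  have := absVal_sub_le (K := K) (x + y) x
  rw [add_sub_cancel_left] at this
  rcases le_max_iff.1 this with h' | h'
  · exact h'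
  · exact absurd h' (not_le.2 h)

theorem absVal_add_eq_max {x y : E} (h : absVal K E x ≠ absVal K E y) :
    absVal K E (x + y) = max (absVal K E x) (absVal K E y) := by
  rcases lt_or_gt_of_ne h with h | h
  · rw [absVal_add_eq_right h, max_eq_right h.le]
  · rw [add_comm, absVal_add_eq_right h, max_eq_left h.le]

/-- An element of `K` is a uniformizer when its absolute value generates the value group. -/
def IsUniformizer (ϖ : K) : Prop :=
  0 < absVal K K ϖ ∧ absVal K K ϖ < 1 ∧ ∀ x : K, x ≠ 0 → ∃ k : ℤ, absVal K K x = absVal K K ϖ ^ k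

theorem absVal_eq_one_of_isUnit {x : 𝒪[K]} (h : IsUnit x) : absVal K K (x : K) = 1 := by
  obtain ⟨y, hy⟩ := h.exists_right_inv
  have h1 : absVal K K (x : K) * absVal K K (y : K) = 1 := by
    rw [← map_mul, ← map_one (absVal K K)]
    exact congrArg _ (congrArg Subtype.val hy)
  have hx := absVal_self_le_one_iff.2 x.2
  have hy := absVal_self_le_one_iff.2 y.2
  nlinarith [(absVal K K).nonneg (x : K), (absVal K K).nonneg (y : K)]

theorem isUnit_of_absVal_eq_one {x : 𝒪[K]} (h : absVal K K (x : K) = 1) : IsUnit x := by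
  have hx : (x : K) ≠ 0 := by
    rintro h0
    simp [h0] at h
  refine IsUnit.of_mul_eq_one ⟨(x : K)⁻¹, ?_⟩ ?_
  · rw [← absVal_self_le_one_iff, map_inv₀, h, inv_one]
  · exact Subtype.ext (mul_inv_cancel₀ hx)

variable (K) in
theorem exists_isUniformizer : ∃ ϖ : K, IsUniformizer ϖ := by
  obtain ⟨p, hp⟩ := IsDiscreteValuationRing.exists_irreducible 𝒪[K]
  have hp0 : (p : K) ≠ 0 := fun h => hp.ne_zero (Subtype.ext h)
  have hp1 : absVal K K (p : K) < 1 := by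
    refine lt_of_le_of_ne (absVal_self_le_one_iff.2 p.2) fun h => hp.not_isUnit ?_
    exact isUnit_of_absVal_eq_one h
  have key : ∀ x : 𝒪[K], x ≠ 0 → ∃ k : ℤ, absVal K K (x : K) = absVal K K (p : K) ^ k := by
    intro x hx
    obtain ⟨n, u, hu⟩ := IsDiscreteValuationRing.eq_unit_mul_pow_irreducible hx hp
    refine ⟨n, ?_⟩
    rw [hu]
    push_cast
    rw [map_mul, map_pow, absVal_eq_one_of_isUnit u.isUnit, one_mul, zpow_natCast]
  refine ⟨p, (absVal K K).pos hp0, hp1, fun x hx => ?_⟩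
  rcases le_total (absVal K K x) 1 with h | h
  · exact key ⟨x, absVal_self_le_one_iff.1 h⟩ (fun h => hx (congrArg Subtype.val h))
  · have h' : absVal K K x⁻¹ ≤ 1 := by
      rw [map_inv₀]; exact inv_le_one_of_one_le₀ h
    obtain ⟨k, hk⟩ := key ⟨x⁻¹, absVal_self_le_one_iff.1 h'⟩
      (fun h => inv_ne_zero hx (congrArg Subtype.val h))
    refine ⟨-k, ?_⟩
    rw [zpow_neg, ← hk, map_inv₀, inv_inv]

namespace IsUniformizer

variable {ϖ : K} (h : IsUniformizer ϖ)
include h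

theorem ne_zero : ϖ ≠ 0 := (absVal K K).pos_iff.1 h.1

theorem le_of_lt_one {x : K} (hx : absVal K K x < 1) : absVal K K x ≤ absVal K K ϖ := by
  rcases eq_or_ne x 0 with rfl | hx0
  · simp
  obtain ⟨k, hk⟩ := h.2.2 x hx0
  rw [hk] at hx ⊢
  have hk1 : 0 < k := (zpow_lt_one_iff_right_of_lt_one₀ h.1 h.2.1).1 hx
  simpa using zpow_le_zpow_right_of_le_one₀ h.1 h.2.1.le (show (1 : ℤ) ≤ k from hk1)

theorem zpow_inj {k l : ℤ} : absVal K K ϖ ^ k = absVal K K ϖ ^ l ↔ k = l :=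
  zpow_right_inj₀ h.1 h.2.1.ne

/-- Powers of a uniformizer scale any nonzero element into the annulus `|ϖ| < |x| ≤ 1`. -/
theorem exists_zpow_mul_mem {x : E} (hx : x ≠ 0) : ∃ k : ℤ,
    absVal K K ϖ < absVal K E (x * algebraMap K E (ϖ ^ k)) ∧
      absVal K E (x * algebraMap K E (ϖ ^ k)) ≤ 1 := by
  obtain ⟨k, hk1, hk2⟩ := exists_mem_Ioc_zpow ((absVal K E).pos hx)
    ((one_lt_inv₀ h.1).2 h.2.1)
  refine ⟨k + 1, ?_⟩
  rw [map_mul, absVal_algebraMap, map_zpow₀]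
  have h1 : 0 < absVal K K ϖ ^ k := zpow_pos h.1 _
  rw [inv_zpow] at hk1 hk2
  rw [zpow_add_one₀ h.1.ne'] at hk2 ⊢
  constructor
  · have := mul_lt_mul_of_pos_right hk1 (mul_pos h1 h.1)
    rw [← mul_assoc, inv_mul_cancel₀ h1.ne', one_mul] at this
    exact this
  · have := mul_le_mul_of_nonneg_right hk2 (mul_pos h1 h.1).le
    rwa [inv_mul_cancel₀ (mul_pos h1 h.1).ne'] at this

end IsUniformizer

end AbsoluteValues

/-! ### Hensel's lemma for quadratics, over arbitrary algebraic extensions. -/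

section QuadraticHensel

open Polynomial

variable {K : Type*} [Field K] [ValuativeRel K] [TopologicalSpace K] [IsNonarchimedeanLocalField K]
  {E L : Type*} [Field E] [Algebra K E] [Algebra.IsAlgebraic K E]
  [Field L] [Algebra K L] [Algebra.IsAlgebraic K L] [Algebra E L] [IsScalarTower K E L]

omit [Algebra.IsAlgebraic K E] in
/-- The two roots of an irreducible quadratic polynomial have the same absolute value. -/
theorem absVal_eq_of_conjugate {T N : E} (h : ∀ r : E, r ^ 2 - T * r + N ≠ 0) {α β : L}
    (hs : α + β = algebraMap E L T) (hp : α * β = algebraMap E L N) :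
    absVal K L α = absVal K L β := by
  have hdeg : (X ^ 2 - C T * X + C N : E[X]).natDegree = 2 := by compute_degree!
  have hmon : (X ^ 2 - C T * X + C N : E[X]).Monic := by monicity!
  have hirr : Irreducible (X ^ 2 - C T * X + C N : E[X]) := by
    refine (hmon.irreducible_iff_roots_eq_zero_of_degree_le_three (by omega) (by omega)).2 ?_
    refine Multiset.eq_zero_of_forall_notMem fun r hr => h r ?_
    simpa using (mem_roots'.1 hr).2
  have hα : minpoly E α = X ^ 2 - C T * X + C N := by
    refine (minpoly.eq_of_irreducible_of_monic hirr ?_ hmon).symm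
    simp only [map_add, map_sub, map_mul, map_pow, aeval_X, aeval_C, ← hs, ← hp]
    ring
  have hβ : minpoly E β = X ^ 2 - C T * X + C N := by
    refine (minpoly.eq_of_irreducible_of_monic hirr ?_ hmon).symm
    simp only [map_add, map_sub, map_mul, map_pow, aeval_X, aeval_C, ← hs, ← hp]
    ring
  refine absVal_eq_of_minpoly_eq ?_
  refine minpoly.eq_of_irreducible_of_monic (minpoly.irreducible
    (Algebra.IsAlgebraic.isAlgebraic α).isIntegral) ?_ (minpoly.monic
    (Algebra.IsAlgebraic.isAlgebraic α).isIntegral)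
  -- Both elements have the same minimal polynomial over `E`, so `β` is a root of the minimal
  -- polynomial of `α` over `K`.
  have h1 : minpoly E β ∣ (minpoly K α).map (algebraMap K E) := by
    rw [hβ, ← hα]; exact minpoly.dvd_map_of_isScalarTower K E α
  have h2 := aeval_eq_zero_of_dvd_aeval_eq_zero h1 (minpoly.aeval E β)
  simpa using h2

/-- If a quadratic polynomial over `E` has no root, its coefficients satisfy `|T|² ≤ |N|`. -/
theorem absVal_sq_le_of_no_root {T N : E} (h : ∀ r : E, r ^ 2 - T * r + N ≠ 0) :
    absVal K E T ^ 2 ≤ absVal K E N := by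
  obtain ⟨α, hα⟩ : ∃ α : AlgebraicClosure E, α ^ 2 - algebraMap E _ T * α + algebraMap E _ N = 0 := by
    have hd : (X ^ 2 - C T * X + C N : E[X]).degree = 2 := by compute_degree!
    obtain ⟨α, hα⟩ := IsAlgClosed.exists_aeval_eq_zero (AlgebraicClosure E)
      (X ^ 2 - C T * X + C N : E[X]) (by rw [hd]; decide)
    exact ⟨α, by simpa using hα⟩
  have : Algebra.IsAlgebraic K (AlgebraicClosure E) := Algebra.IsAlgebraic.trans K E _
  -- The roots `α` and `T - α` have equal absolute value, so `|T| ≤ |α|` while `|N| = |α|²`.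
  have hs : α + (algebraMap E _ T - α) = algebraMap E _ T := by ring
  have hp : α * (algebraMap E _ T - α) = algebraMap E _ N := by linear_combination -hα
  have hc := absVal_eq_of_conjugate (K := K) h hs hp
  have h1 := absVal_add_le (K := K) α (algebraMap E _ T - α)
  rw [hs, ← hc, max_self, absVal_algebraMap] at h1
  have h2 : absVal K E N = absVal K _ α * absVal K _ α := by
    rw [← absVal_algebraMap (L := AlgebraicClosure E) N, ← hp, map_mul, ← hc]
  rw [h2, sq]
  exact mul_self_le_mul_self ((absVal K E).nonneg _) h1

/-- Hensel's lemma for quadratic polynomials. -/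
theorem exists_root_of_approx {T N a : E} (ha : absVal K E (a ^ 2 - T * a + N) < 1)
    (hd : absVal K E (2 * a - T) = 1) : ∃ r : E, r ^ 2 - T * r + N = 0 := by
  by_contra! h
  -- Translating by `a` gives a polynomial without roots whose linear coefficient is a unit and
  -- whose constant term is not, against `absVal_sq_le_of_no_root`. No completeness of `E` is
  -- needed.
  have h' : ∀ r : E, r ^ 2 - (T - 2 * a) * r + (a ^ 2 - T * a + N) ≠ 0 := fun r hr =>
    h (r + a) (by linear_combination hr)
  have := absVal_sq_le_of_no_root (K := K) h'
  rw [← neg_sub, (absVal K E).map_neg, hd] at this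
  linarith

end QuadraticHensel

/-! ### Quadratic polynomials over finite fields, in every characteristic. -/

section FiniteFields

open Polynomial

variable {k : Type*} [Field k] [Finite k]

-- The polynomial `X^q - X` already splits over `k`, so it has no further roots in `L`.
omit [Finite k] in
theorem FiniteField.exists_algebraMap_eq_of_frobenius_fixed [Fintype k] {L : Type*} [Field L]
    [Algebra k L] {x : L} (h : x ^ Fintype.card k = x) : ∃ a : k, algebraMap k L a = x := by
  have hcard : 1 < Fintype.card k := Fintype.one_lt_card
  have hm : (X ^ Fintype.card k - X : k[X]).Monic := by
    refine monic_X_pow_sub ?_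
    rw [degree_X]; exact_mod_cast hcard
  have hp := prod_multiset_X_sub_C_of_monic_of_roots_card_eq hm (by
    rw [FiniteField.roots_X_pow_card_sub_X, FiniteField.X_pow_card_sub_X_natDegree_eq k hcard]
    rfl)
  rw [FiniteField.roots_X_pow_card_sub_X] at hp
  have h0 : aeval x (X ^ Fintype.card k - X : k[X]) = 0 := by simp [h]
  rw [← hp, map_multiset_prod, Multiset.prod_eq_zero_iff, Multiset.map_map, Multiset.mem_map] at h0
  obtain ⟨a, -, ha⟩ := h0
  refine ⟨a, (sub_eq_zero.1 ?_).symm⟩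
  simpa using ha

omit [Finite k] in
/-- Frobenius exchanges the two roots of a quadratic polynomial without rational roots. -/
theorem FiniteField.frobenius_root [Fintype k] {t n : k} (h : ∀ r : k, r ^ 2 - t * r + n ≠ 0)
    {L : Type*} [Field L] [Algebra k L] {α : L}
    (hα : α ^ 2 - algebraMap k L t * α + algebraMap k L n = 0) :
    FiniteField.frobeniusAlgHom k L α = algebraMap k L t - α ∧
      FiniteField.frobeniusAlgHom k L α ≠ α := by
  have hne : FiniteField.frobeniusAlgHom k L α ≠ α := by
    intro h'
    obtain ⟨a, ha⟩ := FiniteField.exists_algebraMap_eq_of_frobenius_fixed h'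
    refine h a ((algebraMap k L).injective ?_)
    rw [map_zero, ← hα, ← ha]
    simp
  refine ⟨?_, hne⟩
  have h1 := congrArg (FiniteField.frobeniusAlgHom k L) hα
  rw [map_add, map_sub, map_pow, map_mul, AlgHom.commutes, AlgHom.commutes, map_zero] at h1
  have h2 : (FiniteField.frobeniusAlgHom k L α - α) *
      (FiniteField.frobeniusAlgHom k L α - (algebraMap k L t - α)) = 0 := by
    linear_combination h1 - hα
  rcases mul_eq_zero.1 h2 with h3 | h3
  · exact absurd (sub_eq_zero.1 h3) hne
  · exact sub_eq_zero.1 h3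

omit [Finite k] in
theorem exists_root_algebraicClosure (t n : k) : ∃ α : AlgebraicClosure k,
    α ^ 2 - algebraMap k _ t * α + algebraMap k _ n = 0 := by
  have hd : (X ^ 2 - C t * X + C n : k[X]).degree = 2 := by compute_degree!
  obtain ⟨α, hα⟩ := IsAlgClosed.exists_aeval_eq_zero (AlgebraicClosure k)
    (X ^ 2 - C t * X + C n : k[X]) (by rw [hd]; decide)
  exact ⟨α, by simpa using hα⟩

/-- A zero discriminant would make the two roots equal, but Frobenius moves one to the other. The
argument includes characteristic two. -/
theorem FiniteField.disc_ne_zero {t n : k} (h : ∀ r : k, r ^ 2 - t * r + n ≠ 0) :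
    t ^ 2 - 4 * n ≠ 0 := by
  have := Fintype.ofFinite k
  obtain ⟨α, hα⟩ := exists_root_algebraicClosure t n
  obtain ⟨h1, h2⟩ := FiniteField.frobenius_root h hα
  intro h0
  have h0' := congrArg (algebraMap k (AlgebraicClosure k)) h0
  simp only [map_sub, map_pow, map_mul, map_ofNat, map_zero] at h0'
  have h3 : (2 * α - algebraMap k _ t) ^ 2 = 0 := by linear_combination 4 * hα + h0'
  have h4 := pow_eq_zero_iff (two_ne_zero) |>.1 h3
  exact h2 (h1.trans (by linear_combination -h4))

/-- The quadratic polynomial whose discriminant is the product of the discriminants of two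
quadratic polynomials without roots has a root. -/
theorem FiniteField.exists_root_disc_mul {t n t' n' : k} (h : ∀ r : k, r ^ 2 - t * r + n ≠ 0)
    (h' : ∀ r : k, r ^ 2 - t' * r + n' ≠ 0) :
    ∃ r : k, r ^ 2 - t * t' * r + (t ^ 2 * n' + t' ^ 2 * n - 4 * n * n') = 0 := by
  have := Fintype.ofFinite k
  obtain ⟨α, hα⟩ := exists_root_algebraicClosure t n
  obtain ⟨β, hβ⟩ := exists_root_algebraicClosure t' n'
  obtain ⟨h1, -⟩ := FiniteField.frobenius_root h hα
  obtain ⟨h2, -⟩ := FiniteField.frobenius_root h' hβ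
  set T := algebraMap k (AlgebraicClosure k) t
  set T' := algebraMap k (AlgebraicClosure k) t'
  set N := algebraMap k (AlgebraicClosure k) n
  set N' := algebraMap k (AlgebraicClosure k) n'
  -- Frobenius exchanges both pairs of roots at once, so `αβ + α'β'` is fixed; its companion root is
  -- `αβ' + α'β`. Comparing discriminants modulo squares would not suffice in characteristic two.
  have h3 : FiniteField.frobeniusAlgHom k (AlgebraicClosure k)
      (α * β + (T - α) * (T' - β)) = α * β + (T - α) * (T' - β) := by
    simp only [map_add, map_mul, map_sub, T, T', AlgHom.commutes, h1, h2]
    ring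
  obtain ⟨r, hr⟩ := FiniteField.exists_algebraMap_eq_of_frobenius_fixed h3
  refine ⟨r, (algebraMap k (AlgebraicClosure k)).injective ?_⟩
  simp only [map_add, map_mul, map_sub, map_pow, hr, map_ofNat, map_zero]
  change _ ^ 2 - T * T' * _ + (T ^ 2 * N' + T' ^ 2 * N - 4 * N * N') = 0
  have hN : N = α * (T - α) := by linear_combination hα
  have hN' : N' = β * (T' - β) := by linear_combination hβ
  rw [hN, hN']
  ring

/-- A binary quadratic form `x² + txy + ny²` of nonzero discriminant is universal. -/
theorem FiniteField.exists_normForm_eq {t n : k} (h : t ^ 2 - 4 * n ≠ 0) (u : k) :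
    ∃ x y : k, x ^ 2 + t * x * y + n * y ^ 2 = u := by
  have := Fintype.ofFinite k
  by_cases h2 : ringChar k = 2
  · obtain ⟨x, hx⟩ := FiniteField.isSquare_of_char_two h2 u
    exact ⟨x, 0, by rw [hx]; ring⟩
  · have h2' : (2 : k) ≠ 0 := Ring.two_ne_zero h2
    obtain ⟨c, rfl⟩ : ∃ c, t = 2 * c := ⟨t / 2, by field_simp⟩
    -- With `t = 2c` the form is `(x + cy)² + (n - c²)y²`, nondegenerate and diagonal.
    have h4 : n - c ^ 2 ≠ 0 := fun h0 => h (by linear_combination -4 * h0)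
    have hd2 : degree (C (n - c ^ 2) * X ^ 2 - C u : k[X]) = 2 := by
      compute_degree!
    obtain ⟨a, b, hab⟩ := FiniteField.exists_root_sum_quadratic (degree_X_pow 2) hd2
      (FiniteField.odd_card_of_char_ne_two h2)
    simp only [eval_pow, eval_X, eval_sub, eval_mul, eval_C] at hab
    exact ⟨a - c * b, b, by linear_combination hab⟩

end FiniteFields

/-! ### Quadratics irreducible over the residue field and their norm forms. -/

section ResidualIrreducibility

variable {K : Type*} [Field K] [ValuativeRel K] [TopologicalSpace K] [IsNonarchimedeanLocalField K]
  {E : Type*} [Field E] [Algebra K E] [Algebra.IsAlgebraic K E]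

variable (K) in
/-- The polynomial `X² - tX + n` is integral, without roots modulo the maximal ideal. -/
structure IsResiduallyIrreducible (t n : E) : Prop where
  trace_le : absVal K E t ≤ 1
  norm_le : absVal K E n ≤ 1
  absVal_eval : ∀ a, absVal K E a ≤ 1 → absVal K E (a ^ 2 - t * a + n) = 1

theorem residue_eq_zero_iff_absVal_lt_one {x : 𝒪[K]} :
    IsLocalRing.residue 𝒪[K] x = 0 ↔ absVal K K (x : K) < 1 := by
  rw [IsLocalRing.residue_eq_zero_iff, IsLocalRing.mem_maximalIdeal, mem_nonunits_iff,
    lt_iff_le_and_ne]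
  refine ⟨fun h => ⟨absVal_self_le_one_iff.2 x.2, fun h' => h (isUnit_of_absVal_eq_one h')⟩,
    fun h h' => h.2 (absVal_eq_one_of_isUnit h')⟩

theorem absVal_add_lt {x y : E} {r : ℝ} (hx : absVal K E x < r) (hy : absVal K E y < r) :
    absVal K E (x + y) < r := (absVal_add_le x y).trans_lt (max_lt hx hy)

theorem absVal_add_le_of_le {x y : E} {r : ℝ} (hx : absVal K E x ≤ r) (hy : absVal K E y ≤ r) :
    absVal K E (x + y) ≤ r := (absVal_add_le x y).trans (max_le hx hy)

theorem absVal_sub_le_of_le {x y : E} {r : ℝ} (hx : absVal K E x ≤ r) (hy : absVal K E y ≤ r) :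
    absVal K E (x - y) ≤ r := (absVal_sub_le x y).trans (max_le hx hy)

theorem absVal_mul_le_one {x y : E} (hx : absVal K E x ≤ 1) (hy : absVal K E y ≤ 1) :
    absVal K E (x * y) ≤ 1 := by
  rw [map_mul]; exact mul_le_one₀ hx ((absVal K E).nonneg _) hy

theorem absVal_natCast_le_one (m : ℕ) : absVal K E (m : E) ≤ 1 := by
  induction m with
  | zero => simp
  | succ m ih => rw [Nat.cast_succ]; exact absVal_add_le_of_le ih (map_one _).le

theorem absVal_ofNat_le_one (m : ℕ) [m.AtLeastTwo] : absVal K E (OfNat.ofNat m : E) ≤ 1 :=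
  absVal_natCast_le_one m

theorem absVal_four_mul_lt {x : E} (hx : absVal K E x < 1) : absVal K E (4 * x) < 1 := by
  rw [map_mul]
  exact (mul_le_of_le_one_left ((absVal K E).nonneg _) (absVal_ofNat_le_one 4)).trans_lt hx

theorem absVal_eq_one_of_sq {x : E} (h : absVal K E (x ^ 2) = 1) : absVal K E x = 1 := by
  rw [map_pow] at h
  exact (pow_eq_one_iff_of_nonneg ((absVal K E).nonneg _) two_ne_zero).1 h

namespace IsResiduallyIrreducible

theorem residue_ne_zero {t n : 𝒪[K]} (h : IsResiduallyIrreducible K (t : K) (n : K))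
    (r : IsLocalRing.ResidueField 𝒪[K]) :
    r ^ 2 - IsLocalRing.residue _ t * r + IsLocalRing.residue _ n ≠ 0 := by
  obtain ⟨a, rfl⟩ := IsLocalRing.residue_surjective r
  rw [← map_pow, ← map_mul, ← map_sub, ← map_add, Ne, residue_eq_zero_iff_absVal_lt_one]
  have := h.absVal_eval a (absVal_self_le_one_iff.2 a.2)
  push_cast
  exact this.not_lt

theorem absVal_disc {t n : K} (h : IsResiduallyIrreducible K t n) :
    absVal K K (t ^ 2 - 4 * n) = 1 := by
  lift t to 𝒪[K] using absVal_self_le_one_iff.1 h.trace_le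
  lift n to 𝒪[K] using absVal_self_le_one_iff.1 h.norm_le
  have h1 := FiniteField.disc_ne_zero h.residue_ne_zero
  rw [show (4 : IsLocalRing.ResidueField 𝒪[K]) = IsLocalRing.residue _ 4 from (map_ofNat _ 4).symm,
    ← map_pow, ← map_mul, ← map_sub, Ne, residue_eq_zero_iff_absVal_lt_one, not_lt] at h1
  exact le_antisymm (absVal_self_le_one_iff.2 (t ^ 2 - 4 * n).2) h1

/-- The discriminants of two residually irreducible quadratic polynomials agree up to squares. -/
theorem exists_sq_eq_disc_mul {t n t' n' : K} (h : IsResiduallyIrreducible K t n)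
    (h' : IsResiduallyIrreducible K t' n') :
    ∃ s : K, (t ^ 2 - 4 * n) * (t' ^ 2 - 4 * n') = s ^ 2 := by
  have hd := h.absVal_disc
  have hd' := h'.absVal_disc
  lift t to 𝒪[K] using absVal_self_le_one_iff.1 h.trace_le
  lift n to 𝒪[K] using absVal_self_le_one_iff.1 h.norm_le
  lift t' to 𝒪[K] using absVal_self_le_one_iff.1 h'.trace_le
  lift n' to 𝒪[K] using absVal_self_le_one_iff.1 h'.norm_le
  obtain ⟨r, hr⟩ := FiniteField.exists_root_disc_mul h.residue_ne_zero h'.residue_ne_zero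
  obtain ⟨a, rfl⟩ := IsLocalRing.residue_surjective r
  rw [show (4 : IsLocalRing.ResidueField 𝒪[K]) = IsLocalRing.residue _ 4 from (map_ofNat _ 4).symm]
    at hr
  simp only [← map_pow, ← map_mul, ← map_sub, ← map_add] at hr
  rw [residue_eq_zero_iff_absVal_lt_one] at hr
  have hr' : absVal K K ((a : K) ^ 2 - (t * t') * a +
      ((t : K) ^ 2 * n' + (t' : K) ^ 2 * n - 4 * n * n')) < 1 := hr
  obtain ⟨b, hb⟩ := exists_root_of_approx hr' (by
    apply absVal_eq_one_of_sq
    -- The square of the derivative at `a` is four times the value at `a` plus a product of unit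
    -- discriminants, so it is a unit and the residual root lifts.
    have e : (2 * (a : K) - t * t') ^ 2 = 4 * ((a : K) ^ 2 - (t * t') * a +
      ((t : K) ^ 2 * n' + (t' : K) ^ 2 * n - 4 * n * n')) +
        ((t : K) ^ 2 - 4 * n) * ((t' : K) ^ 2 - 4 * n') := by ring
    rw [e, absVal_add_eq_right, map_mul, hd, hd', one_mul]
    rw [map_mul _ (_ - _), hd, hd', one_mul]
    exact absVal_four_mul_lt hr')
  exact ⟨2 * b - t * t', by linear_combination -4 * hb⟩

theorem absVal_norm_eq_one {t n : E} (h : IsResiduallyIrreducible K t n) : absVal K E n = 1 := by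
  simpa using h.absVal_eval 0 (by simp)

/-- The norm form of an unramified quadratic extension represents every unit which is residually
defined over `K`. -/
theorem exists_normForm_eq {t n : K} (h : IsResiduallyIrreducible K t n) {u : E} {c : K}
    (hu : absVal K E u = 1) (hc : absVal K E (u - algebraMap K E c) < 1) :
    ∃ x y : E, x ^ 2 + algebraMap K E t * x * y + algebraMap K E n * y ^ 2 = u := by
  have hd := h.absVal_disc
  have hn1 := h.absVal_norm_eq_one
  have hn0 : algebraMap K E n ≠ 0 := by
    rw [Ne, map_eq_zero]; rintro rfl; simp at hn1
  have hc1 : absVal K K c = 1 := by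
    have e : algebraMap K E c = -(u - algebraMap K E c) + u := by ring
    rw [← absVal_algebraMap (E := K) (L := E), e, absVal_add_eq_right, hu]
    rwa [(absVal K E).map_neg, hu]
  lift t to 𝒪[K] using absVal_self_le_one_iff.1 h.trace_le
  lift n to 𝒪[K] using absVal_self_le_one_iff.1 h.norm_le
  lift c to 𝒪[K] using absVal_self_le_one_iff.1 hc1.le
  obtain ⟨x, y, hxy⟩ := FiniteField.exists_normForm_eq
    (FiniteField.disc_ne_zero h.residue_ne_zero) (IsLocalRing.residue _ c)
  obtain ⟨x, rfl⟩ := IsLocalRing.residue_surjective x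
  obtain ⟨y, rfl⟩ := IsLocalRing.residue_surjective y
  rw [← sub_eq_zero] at hxy
  simp only [← map_pow, ← map_mul, ← map_sub, ← map_add] at hxy
  rw [residue_eq_zero_iff_absVal_lt_one] at hxy
  push_cast at hxy
  set φ := algebraMap K E
  have hval : ∀ z : K, absVal K E (φ z) = absVal K K z := fun z => absVal_algebraMap z
  have hxyE : absVal K E (φ x ^ 2 + φ t * φ x * φ y + φ n * φ y ^ 2 - u) < 1 := by
    have e : φ x ^ 2 + φ t * φ x * φ y + φ n * φ y ^ 2 - u =
      φ ((x : K) ^ 2 + t * x * y + n * (y : K) ^ 2 - c) + -(u - φ c) := by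
      simp only [map_sub, map_add, map_mul, map_pow]; ring
    rw [e]
    refine absVal_add_lt ?_ ?_
    · rwa [hval]
    · rwa [(absVal K E).map_neg]
  have hx1 := absVal_self_le_one_iff.2 x.2
  have hy1 := absVal_self_le_one_iff.2 y.2
  -- The residual solution is lifted in `x` when `2x + ty` is a unit, and in `y` when `tx + 2ny` is
  -- a unit.
  by_cases h1 : absVal K K (2 * x + t * y) = 1
  · obtain ⟨r, hr⟩ := exists_root_of_approx (K := K) (a := φ x) (T := -(φ t * φ y))
      (N := φ n * φ y ^ 2 - u) (by convert hxyE using 2; ring) (by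
        rw [← hval] at h1; convert h1 using 2
        simp only [map_add, map_mul, map_ofNat]; ring)
    exact ⟨r, φ y, by linear_combination hr⟩
  by_cases h2 : absVal K K (t * x + 2 * n * y) = 1
  · obtain ⟨r, hr⟩ := exists_root_of_approx (K := K) (a := φ y) (T := -(φ t * φ x / φ n))
      (N := (φ x ^ 2 - u) / φ n) (by
        have e : φ y ^ 2 - -(φ t * φ x / φ n) * φ y + (φ x ^ 2 - u) / φ n =
          (φ x ^ 2 + φ t * φ x * φ y + φ n * φ y ^ 2 - u) / φ n := by field_simp; ring
        rw [e, map_div₀, hval, hn1, div_one]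
        exact hxyE) (by
        have e : 2 * φ y - -(φ t * φ x / φ n) = φ (t * x + 2 * n * y) / φ n := by
          simp only [map_add, map_mul, map_ofNat]; field_simp; ring
        rw [e, map_div₀, hval, hval, hn1, div_one, h2])
    refine ⟨φ x, r, ?_⟩
    field_simp at hr
    linear_combination hr
  -- If both partial derivatives are nonunits, inverting their linear system, whose determinant is
  -- the unit discriminant up to sign, puts `x` and `y` in the maximal ideal. Then `c` is there as
  -- well, although `|c| = 1`.
  exfalso
  have ht := h.trace_le
  have hn := h.norm_le
  have h1' : absVal K K (2 * x + t * y) < 1 := lt_of_le_of_ne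
    (absVal_add_le_of_le (absVal_mul_le_one (absVal_ofNat_le_one 2) hx1)
      (absVal_mul_le_one ht hy1)) h1
  have h2' : absVal K K (t * x + 2 * n * y) < 1 := lt_of_le_of_ne
    (absVal_add_le_of_le (absVal_mul_le_one ht hx1)
      (absVal_mul_le_one (absVal_mul_le_one (absVal_ofNat_le_one 2) hn) hy1)) h2
  have hmul : ∀ a b : K, absVal K K a ≤ 1 → absVal K K b < 1 → absVal K K (a * b) < 1 := by
    intro a b ha hb
    rw [map_mul]
    exact (mul_le_of_le_one_left ((absVal K K).nonneg _) ha).trans_lt hb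
  have hxlt : absVal K K x < 1 := by
    have e : ((t : K) ^ 2 - 4 * n) * x = (t * (t * x + 2 * n * y)) +
      (-(2 * n)) * (2 * x + t * y) := by ring
    have := absVal_add_lt (hmul t _ ht h2') (hmul (-(2 * n)) _ (by
      rw [(absVal K K).map_neg]; exact absVal_mul_le_one (absVal_ofNat_le_one 2) hn) h1')
    rwa [← e, map_mul, hd, one_mul] at this
  have hylt : absVal K K y < 1 := by
    have e : ((t : K) ^ 2 - 4 * n) * y = (t * (2 * x + t * y)) +
      (-2) * (t * x + 2 * n * y) := by ring
    have := absVal_add_lt (hmul t _ ht h1') (hmul (-2) _ (by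
      rw [(absVal K K).map_neg]; exact absVal_ofNat_le_one 2) h2')
    rwa [← e, map_mul, hd, one_mul] at this
  have e : (c : K) = ((x : K) * x + (t * x) * y + (n * y) * y) +
      (-1) * ((x : K) ^ 2 + t * x * y + n * (y : K) ^ 2 - c) := by ring
  have := absVal_add_lt (absVal_add_lt (absVal_add_lt (hmul x x hx1 hxlt)
    (hmul _ y (absVal_mul_le_one ht hx1) hylt)) (hmul _ y (absVal_mul_le_one hn hy1) hylt))
    (hmul (-1) _ (by simp) hxy)
  rw [← e, hc1] at this
  exact lt_irrefl _ this

/-- The norm form of a residually irreducible polynomial is anisotropic modulo the maximal ideal. -/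
theorem absVal_normForm {t n : E} (h : IsResiduallyIrreducible K t n) (x y : E) :
    absVal K E (x ^ 2 + t * x * y + n * y ^ 2) = max (absVal K E x) (absVal K E y) ^ 2 := by
  rcases le_or_gt (absVal K E x) (absVal K E y) with hxy | hxy
  · rw [max_eq_right hxy]
    rcases eq_or_ne y 0 with rfl | hy
    · have hx : x = 0 := by
        rw [map_zero] at hxy
        exact (absVal K E).eq_zero.1 (le_antisymm hxy ((absVal K E).nonneg _))
      simp [hx]
    · have hy' := (absVal K E).pos hy
      have := h.absVal_eval (-(x / y)) (by
        rw [(absVal K E).map_neg, map_div₀]; exact div_le_one_of_le₀ hxy hy'.le)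
      have e : x ^ 2 + t * x * y + n * y ^ 2 = ((-(x / y)) ^ 2 - t * (-(x / y)) + n) * y ^ 2 := by
        field_simp
        ring
      rw [e, map_mul, this, one_mul, map_pow]
  · rw [max_eq_left hxy.le]
    have hx' : 0 < absVal K E x := ((absVal K E).nonneg _).trans_lt hxy
    have h1 : absVal K E (t * x * y + n * y ^ 2) < absVal K E (x ^ 2) := by
      have hy0 := (absVal K E).nonneg y
      rw [map_pow]
      refine absVal_add_lt ?_ ?_
      · rw [map_mul, map_mul]
        calc _ ≤ absVal K E x * absVal K E y := by
              gcongr; exact mul_le_of_le_one_left hx'.le h.trace_le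
          _ < _ := by nlinarith
      · rw [map_mul, map_pow]
        calc _ ≤ absVal K E y ^ 2 := mul_le_of_le_one_left (by positivity) h.norm_le
          _ < _ := by nlinarith
    rw [add_assoc, add_comm, absVal_add_eq_right h1, map_pow]

/-- A residually irreducible polynomial over `K` stays so over an extension without roots. -/
theorem of_no_root {t n : K} (h : IsResiduallyIrreducible K t n)
    (hE : ∀ r : E, r ^ 2 - algebraMap K E t * r + algebraMap K E n ≠ 0) :
    IsResiduallyIrreducible K (algebraMap K E t) (algebraMap K E n) where
  trace_le := by rw [absVal_algebraMap]; exact h.trace_le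
  norm_le := by rw [absVal_algebraMap]; exact h.norm_le
  absVal_eval a ha := by
    refine le_antisymm ?_ (not_lt.1 fun hlt => ?_)
    · refine absVal_add_le_of_le (absVal_sub_le_of_le ?_ (absVal_mul_le_one ?_ ha)) ?_
      · rw [sq]; exact absVal_mul_le_one ha ha
      · rw [absVal_algebraMap]; exact h.trace_le
      · rw [absVal_algebraMap]; exact h.norm_le
    -- `(2a - t)²` is four times the value at `a` plus the unit discriminant: a residual root would
    -- be simple and would lift.
    · obtain ⟨r, hr⟩ := exists_root_of_approx hlt (by
        apply absVal_eq_one_of_sq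
        have e : (2 * a - algebraMap K E t) ^ 2 =
          4 * (a ^ 2 - algebraMap K E t * a + algebraMap K E n) +
            algebraMap K E (t ^ 2 - 4 * n) := by
          simp only [map_sub, map_mul, map_pow, map_ofNat]; ring
        rw [e, absVal_add_eq_right, absVal_algebraMap, h.absVal_disc]
        rw [absVal_algebraMap, h.absVal_disc]
        exact absVal_four_mul_lt hlt)
      exact hE r hr

end IsResiduallyIrreducible

end ResidualIrreducibility

/-! ### Unramified and ramified quadratic extensions. -/

section QuadraticExtensions

variable {K : Type*} [Field K] [ValuativeRel K] [TopologicalSpace K] [IsNonarchimedeanLocalField K]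
  {E : Type*} [Field E] [Algebra K E] [Algebra.IsAlgebraic K E]

/-- For `q ≠ 0` these are the two roots of `X² - 2pX + p² - q²m`, irreducible because `m` is not a
square. -/
theorem absVal_add_mul_conj {m : K} (hm : ¬ IsSquare m) {θ : E} (hθ : θ ^ 2 = algebraMap K E m)
    (p q : K) : absVal K E (algebraMap K E p + algebraMap K E q * θ) =
      absVal K E (algebraMap K E p - algebraMap K E q * θ) := by
  rcases eq_or_ne q 0 with rfl | hq
  · simp
  refine absVal_eq_of_conjugate (K := K) (E := K) (T := 2 * p) (N := p ^ 2 - q ^ 2 * m)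
    (fun r hr => hm ⟨(r - p) / q, ?_⟩) ?_ ?_
  · field_simp
    linear_combination -hr
  · rw [map_mul, map_ofNat]; ring
  · simp only [map_sub, map_mul, map_pow, ← hθ]; ring

/-- The exponents of `ϖ` on the two sides have opposite parity. This excludes cancellation in sums
of a square-valued and an odd term. -/
theorem IsUniformizer.sq_mul_ne {ϖ : K} (h : IsUniformizer ϖ) {a b : K} (ha : a ≠ 0) :
    absVal K K a ^ 2 * absVal K K ϖ ≠ absVal K K b ^ 2 := by
  intro he
  have hb : b ≠ 0 := by
    rintro rfl
    have := mul_pos (pow_pos ((absVal K K).pos ha) 2) h.1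
    rw [he] at this
    simp at this
  obtain ⟨k, hk⟩ := h.2.2 a ha
  obtain ⟨l, hl⟩ := h.2.2 b hb
  rw [hk, hl, ← zpow_natCast, ← zpow_natCast, ← zpow_mul, ← zpow_mul, ← zpow_add_one₀ h.1.ne',
    h.zpow_inj] at he
  push_cast at he
  omega

/-- A quadratic extension with the same value group is generated by a root of a residually
irreducible polynomial. -/
theorem exists_isResiduallyIrreducible_of_unramified (h2 : (2 : K) ≠ 0) {m : K}
    (hm : ¬ IsSquare m) {θ : E} (hθ : θ ^ 2 = algebraMap K E m)
    (hval : ∀ p q : K, ∃ k : K,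
      absVal K E (algebraMap K E p + algebraMap K E q * θ) = absVal K K k) :
    ∃ t n s : K, IsResiduallyIrreducible K t n ∧ t ^ 2 - 4 * n = m * s ^ 2 := by
  -- Otherwise `K(θ)` has the residue field and the value group of `K`. Then `θ` is a limit of
  -- elements of `K`, its conjugate `-θ` is approximated equally well, and `2θ` is arbitrarily
  -- small.
  by_contra! hcon
  have key : ∀ p q : K, absVal K E (algebraMap K E p + algebraMap K E q * θ) ≤ 1 →
      ∃ a : K, absVal K E (algebraMap K E (p - a) + algebraMap K E q * θ) < 1 := by
    intro p q hpq
    by_contra! hno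
    -- An integral `p + qθ` congruent to no element of `K` has a residually irreducible
    -- characteristic polynomial, of discriminant `m(2q)²`.
    refine hcon (2 * p) (p ^ 2 - q ^ 2 * m) (2 * q) ⟨?_, ?_, fun a ha => ?_⟩ (by ring)
    · rw [← absVal_algebraMap (E := K) (L := E)]
      have e : algebraMap K E (2 * p) = (algebraMap K E p + algebraMap K E q * θ) +
        (algebraMap K E p - algebraMap K E q * θ) := by rw [map_mul, map_ofNat]; ring
      rw [e]
      exact absVal_add_le_of_le hpq ((absVal_add_mul_conj hm hθ p q) ▸ hpq)
    · rw [← absVal_algebraMap (E := K) (L := E)]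
      have e : algebraMap K E (p ^ 2 - q ^ 2 * m) = (algebraMap K E p + algebraMap K E q * θ) *
        (algebraMap K E p - algebraMap K E q * θ) := by
        simp only [map_sub, map_mul, map_pow, ← hθ]; ring
      rw [e]
      exact absVal_mul_le_one hpq ((absVal_add_mul_conj hm hθ p q) ▸ hpq)
    · rw [← absVal_algebraMap (E := K) (L := E)]
      have e : algebraMap K E (a ^ 2 - 2 * p * a + (p ^ 2 - q ^ 2 * m)) =
        (algebraMap K E (p - a) + algebraMap K E q * θ) *
        (algebraMap K E (p - a) - algebraMap K E q * θ) := by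
        simp only [map_sub, map_mul, map_add, map_ofNat, map_pow, ← hθ]; ring
      have h1 : absVal K E (algebraMap K E (p - a) + algebraMap K E q * θ) = 1 := by
        refine le_antisymm ?_ (hno a)
        have e : algebraMap K E (p - a) + algebraMap K E q * θ =
          (algebraMap K E p + algebraMap K E q * θ) - algebraMap K E a := by rw [map_sub]; ring
        rw [e]
        exact absVal_sub_le_of_le hpq (by rwa [absVal_algebraMap])
      rw [e, map_mul, ← absVal_add_mul_conj hm hθ, h1, one_mul]
  obtain ⟨ϖ, hϖ⟩ := exists_isUniformizer K
  have hθ0 : ∀ a : K, algebraMap K E a + θ ≠ 0 := by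
    intro a h0
    refine hm ⟨a, (algebraMap K E).injective ?_⟩
    rw [← hθ, map_mul]
    linear_combination (θ - algebraMap K E a) * h0
  have approx : ∀ j : ℕ, ∃ a : K,
      absVal K E (algebraMap K E a + θ) ≤ absVal K K ϖ ^ j * absVal K E θ := by
    intro j
    induction j with
    | zero => exact ⟨0, by simp⟩
    | succ j ih =>
      obtain ⟨a, ha⟩ := ih
      obtain ⟨k, hk⟩ := hval a 1
      rw [map_one, one_mul] at hk
      have hk0 : k ≠ 0 := by
        rintro rfl
        rw [map_zero] at hk
        exact hθ0 a ((absVal K E).eq_zero.1 hk)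
      have hkE : algebraMap K E k ≠ 0 := by simpa using hk0
      have hk1 : absVal K E (algebraMap K E (a / k) + algebraMap K E k⁻¹ * θ) = 1 := by
        -- Dividing the error `a + θ` by some `k` of the same absolute value gives a unit;
        -- subtracting its residue `b` and multiplying back gains a factor `|ϖ|`, since the new
        -- error also has its absolute value in that of `K`.
        have e : algebraMap K E (a / k) + algebraMap K E k⁻¹ * θ =
          (algebraMap K E a + θ) / algebraMap K E k := by
          rw [map_div₀, map_inv₀]; field_simp
        rw [e, map_div₀, hk, absVal_algebraMap, div_self ((absVal K K).pos hk0).ne']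
      obtain ⟨b, hb⟩ := key _ _ hk1.le
      obtain ⟨l, hl⟩ := hval (a / k - b) k⁻¹
      rw [hl] at hb
      have hb' := hϖ.le_of_lt_one hb
      refine ⟨a - k * b, ?_⟩
      have e : algebraMap K E (a - k * b) + θ =
          algebraMap K E k * (algebraMap K E (a / k - b) + algebraMap K E k⁻¹ * θ) := by
        simp only [map_sub, map_mul, map_div₀, map_inv₀]; field_simp
      rw [e, map_mul, hl, absVal_algebraMap, ← hk, pow_succ, mul_assoc, mul_comm (absVal K K ϖ),
        ← mul_assoc]
      gcongr
  have h2E : 0 < absVal K E (2 * θ) := by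
    refine (absVal K E).pos (mul_ne_zero ?_ ?_)
    · rw [← map_ofNat (algebraMap K E) 2]; simpa using h2
    · simpa using hθ0 0
  have hbound : ∀ j : ℕ, absVal K E (2 * θ) ≤ absVal K K ϖ ^ j * absVal K E θ := by
    intro j
    obtain ⟨a, ha⟩ := approx j
    have hc := absVal_add_mul_conj hm hθ a 1
    rw [map_one, one_mul] at hc
    have e : 2 * θ = (algebraMap K E a + θ) - (algebraMap K E a - θ) := by ring
    rw [e]
    exact absVal_sub_le_of_le ha (hc ▸ ha)
  have hlim := (tendsto_pow_atTop_nhds_zero_of_lt_one hϖ.1.le hϖ.2.1).mul_const (absVal K E θ)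
  rw [zero_mul] at hlim
  exact absurd (ge_of_tendsto' hlim hbound) (not_le.2 h2E)

/-- In a ramified quadratic extension, a uniformizer of `K` is represented by the norm form of the
unramified quadratic extension. -/
theorem exists_normForm_eq_uniformizer {m : K} (hm : ¬ IsSquare m) {θ : E}
    (hθ : θ ^ 2 = algebraMap K E m) {p q : K}
    (hram : ∀ k : K, absVal K E (algebraMap K E p + algebraMap K E q * θ) ≠ absVal K K k)
    {t n ϖ : K} (hϖ : IsUniformizer ϖ) (h : IsResiduallyIrreducible K t n) :
    ∃ a b : E, a ^ 2 + algebraMap K E t * a * b + algebraMap K E n * b ^ 2 =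
      algebraMap K E ϖ := by
  have hval : ∀ z : K, absVal K E (algebraMap K E z) = absVal K K z := fun z => absVal_algebraMap z
  have hx2 : absVal K E (algebraMap K E p + algebraMap K E q * θ) ^ 2 =
      absVal K K (p ^ 2 - q ^ 2 * m) := by
    rw [← hval, sq]
    nth_rewrite 2 [absVal_add_mul_conj hm hθ]
    rw [← map_mul]
    congr 1
    simp only [map_sub, map_mul, map_pow, ← hθ]; ring
  have hN0 : p ^ 2 - q ^ 2 * m ≠ 0 := by
    intro h0
    rw [h0, map_zero, sq_eq_zero_iff] at hx2
    exact hram 0 (by rw [hx2, map_zero])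
  obtain ⟨k, hk⟩ := hϖ.2.2 _ hN0
  -- An even exponent would put the absolute value of `p + qθ` in the value group of `K`. An odd one
  -- allows scaling to `P` with `|P|² = |ϖ|`.
  obtain ⟨l, rfl | rfl⟩ := Int.even_or_odd' k
  · refine absurd ?_ (hram (ϖ ^ l))
    rw [map_zpow₀]
    refine (pow_left_inj₀ ((absVal K E).nonneg _) (zpow_nonneg hϖ.1.le _) two_ne_zero).1 ?_
    rw [hx2, hk, ← zpow_natCast, ← zpow_mul, mul_comm]
    rfl
  obtain ⟨p', q', P, hP, hP2⟩ : ∃ (p' q' : K) (P : E),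
      P = algebraMap K E p' + algebraMap K E q' * θ ∧ absVal K E P ^ 2 = absVal K K ϖ := by
    refine ⟨p * ϖ ^ (-l), q * ϖ ^ (-l), _, rfl, ?_⟩
    have e : algebraMap K E (p * ϖ ^ (-l)) + algebraMap K E (q * ϖ ^ (-l)) * θ =
      (algebraMap K E p + algebraMap K E q * θ) * algebraMap K E (ϖ ^ (-l)) := by
      simp only [map_mul]; ring
    rw [e, map_mul, mul_pow, hx2, hk, hval, map_zpow₀, ← zpow_natCast, ← zpow_mul,
      ← zpow_add₀ hϖ.1.ne']
    convert zpow_one _ using 2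
    push_cast; ring
  have hP0 : P ≠ 0 := by
    rintro rfl
    rw [map_zero, zero_pow two_ne_zero] at hP2
    exact hϖ.1.ne hP2
  set T : K := 2 * p' with hT
  set N : K := p' ^ 2 - q' ^ 2 * m with hN
  have hPeq : P * (algebraMap K E T - P) = algebraMap K E N := by
    rw [hP, hT, hN]
    simp only [map_sub, map_mul, map_pow, map_ofNat, ← hθ]
    ring
  have hNE : algebraMap K E N ≠ 0 := by
    rw [← hPeq]
    refine mul_ne_zero hP0 fun h0 => ?_
    have hc := absVal_add_mul_conj hm hθ p' q'
    have e : algebraMap K E p' - algebraMap K E q' * θ = algebraMap K E T - P := by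
      rw [hP, hT, map_mul, map_ofNat]; ring
    rw [e, h0, ← hP, map_zero] at hc
    exact hP0 ((absVal K E).eq_zero.1 hc)
  -- Coordinates of `ϖ / P²`: since `1 / P = (T - P) / N`, one has `1 / P² = (T² - N - TP) / N²`.
  set A : K := (T ^ 2 - N) * ϖ / N ^ 2 with hA
  set B : K := -T * ϖ / N ^ 2 with hB
  have hu : algebraMap K E ϖ / P ^ 2 = algebraMap K E A + algebraMap K E B * P := by
    rw [hA, hB, div_eq_iff (pow_ne_zero 2 hP0)]
    simp only [map_sub, map_mul, map_pow, map_div₀, map_neg]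
    field_simp
    rw [← hPeq]
    ring
  have hu1 : absVal K E (algebraMap K E ϖ / P ^ 2) = 1 := by
    rw [map_div₀, map_pow, hP2, hval, div_self hϖ.1.ne']
  -- By parity `|bP|` is never in the value group of `K` for `b ≠ 0`. Nothing cancels in `A + BP`,
  -- so `|BP| < 1` and the unit `ϖ / P²` is congruent to `A`.
  have hsq : ∀ b c : K, absVal K K c = absVal K E (algebraMap K E b * P) → b = 0 := by
    intro b c hbc
    by_contra hb
    refine hϖ.sq_mul_ne (b := c) hb ?_
    rw [hbc, map_mul, mul_pow, hP2, hval]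
  have hBP : absVal K E (algebraMap K E B * P) < 1 := by
    rcases eq_or_ne B 0 with hB0 | hB0
    · simp [hB0]
    · refine lt_of_le_of_ne ?_ fun h1 => hB0 (hsq B 1 (by rw [h1, map_one]))
      have := hu1
      rw [hu, absVal_add_eq_max] at this
      · rw [← this]; exact le_max_right _ _
      · rw [hval]
        exact fun h' => hB0 (hsq B A h')
  obtain ⟨x, y, hxy⟩ := h.exists_normForm_eq hu1 (c := A) (by
    rw [hu, add_sub_cancel_left]; exact hBP)
  refine ⟨x * P, y * P, ?_⟩
  rw [eq_div_iff (pow_ne_zero 2 hP0)] at hxy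
  linear_combination hxy

end QuadraticExtensions

/-! ### Reduced norm, and the valuation it defines on the division algebra. -/

section ReducedNorms

/-- Reduced trace and norm on a (noncommutative) quadratic division algebra over `K`. -/
structure ReducedNorm (K A : Type*) [Field K] [Ring A] [Algebra K A] where
  trd : A → K
  nrd : A → K
  mul_self : ∀ x, x * x = trd x • x - nrd x • (1 : A)
  nrd_mul : ∀ x y, nrd (x * y) = nrd x * nrd y
  nrd_add_smul_one : ∀ x c, nrd (x + c • (1 : A)) = nrd x + c * trd x + c ^ 2
  nrd_smul : ∀ c x, nrd (c • x) = c ^ 2 * nrd x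
  trd_smul_one : ∀ c, trd (c • (1 : A)) = 2 * c
  eq_zero_of_nrd : ∀ x, nrd x = 0 → x = 0
  exists_not_commute : ∃ x y : A, x * y ≠ y * x
  mem_center : ∀ x : A, (∀ z, x * z = z * x) → ∃ c : K, x = c • (1 : A)

theorem QuaternionAlgebra.exists_smul_one_of_central {K : Type*} [Field K] (h2 : (2 : K) ≠ 0)
    {a b : K} (ha : a ≠ 0) (x : ℍ[K, a, b]) (hx : ∀ z, x * z = z * x) :
    ∃ c : K, x = c • (1 : ℍ[K, a, b]) := by
  have hi := hx ⟨0, 1, 0, 0⟩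
  have hj := hx ⟨0, 0, 1, 0⟩
  obtain ⟨x0, x1, x2, x3⟩ := x
  simp only [QuaternionAlgebra.ext_iff, QuaternionAlgebra.mk_mul_mk] at hi hj
  obtain ⟨-, -, hi3, hi4⟩ := hi
  obtain ⟨-, hj2, -, hj4⟩ := hj
  have h3 : x3 = 0 := by
    have : (2 * a) * x3 = 0 := by linear_combination -hi3
    simpa [h2, ha] using this
  have h2' : x2 = 0 := by
    have : 2 * x2 = 0 := by linear_combination -hi4
    simpa [h2] using this
  have h1 : x1 = 0 := by
    have : 2 * x1 = 0 := by linear_combination hj4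
    simpa [h2] using this
  exact ⟨x0, by subst h1 h2' h3; ext <;> simp⟩

/-- The reduced norm of a quaternion division algebra. -/
theorem IsQuaternionAlgebra.nonempty_reducedNorm {K A : Type*} [Field K] (h2 : (2 : K) ≠ 0)
    [DivisionRing A] [Algebra K A] (hA : IsQuaternionAlgebra K A) :
    Nonempty (ReducedNorm K A) := by
  obtain ⟨a, b, ha, -, ⟨e⟩⟩ := hA
  have hst : ∀ x : ℍ[K, a, b], x * star x =
      (x.re ^ 2 - a * x.imI ^ 2 - b * x.imJ ^ 2 + a * b * x.imK ^ 2) • (1 : ℍ[K, a, b]) := by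
    intro x
    ext <;> simp <;> ring
  refine ⟨⟨fun x => 2 * (e x).re, fun x => (e x).re ^ 2 - a * (e x).imI ^ 2 - b * (e x).imJ ^ 2 +
    a * b * (e x).imK ^ 2, fun x => e.injective ?_, fun x y => ?_, fun x c => ?_, fun c x => ?_,
    fun c => ?_, fun x hx => ?_, ?_, fun x hx => ?_⟩⟩
  · rw [map_mul, map_sub, map_smul, map_smul, map_one]
    ext <;> simp <;> ring
  · rw [map_mul]
    simp
    ring
  · simp only [map_add, map_smul, map_one]
    simp
    ring
  · simp only [map_smul]
    simp
    ring
  · simp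
  · have h0 := hst (e x)
    rw [hx, zero_smul] at h0
    have h1 : x * e.symm (star (e x)) = 0 := e.injective (by simpa using h0)
    rcases mul_eq_zero.1 h1 with h | h
    · exact h
    · have : star (e x) = 0 := by simpa using h
      simpa using this
  · refine ⟨e.symm ⟨0, 1, 0, 0⟩, e.symm ⟨0, 0, 1, 0⟩, fun h => ?_⟩
    rw [← map_mul, ← map_mul] at h
    have := congrArg QuaternionAlgebra.imK (e.symm.injective h)
    simp only [QuaternionAlgebra.mk_mul_mk] at this
    apply h2
    linear_combination this
  · obtain ⟨c, hc⟩ := QuaternionAlgebra.exists_smul_one_of_central h2 ha (e x) fun z => by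
      have := congrArg e (hx (e.symm z))
      simpa using this
    exact ⟨c, e.injective (by rw [hc, map_smul, map_one])⟩

namespace ReducedNorm

variable {K A : Type*} [Field K] [DivisionRing A] [Algebra K A] (ν : ReducedNorm K A)

-- A root `r` factors the quadratic equation of `x` as `(x - r)(x - (trd x - r)) = 0` in a division
-- ring.
include ν in
theorem eq_smul_one_or_no_root (x : A) :
    (∃ c : K, x = c • (1 : A)) ∨ ∀ r : K, r ^ 2 - ν.trd x * r + ν.nrd x ≠ 0 := by
  by_contra! h
  obtain ⟨h1, r, hr⟩ := h
  have h2 : (x - r • (1 : A)) * (x - (ν.trd x - r) • (1 : A)) = 0 := by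
    rw [sub_mul, mul_sub, mul_sub, ν.mul_self]
    simp only [mul_smul_comm, smul_mul_assoc, mul_one, one_mul]
    have : ν.nrd x = -(r ^ 2 - ν.trd x * r) := by linear_combination hr
    rw [this]
    module
  rcases mul_eq_zero.1 h2 with h3 | h3
  · exact h1 r (sub_eq_zero.1 h3)
  · exact h1 _ (sub_eq_zero.1 h3)

theorem nrd_smul_one (c : K) : ν.nrd (c • (1 : A)) = c ^ 2 := by
  have h0 := ν.nrd_smul 0 1
  have := ν.nrd_add_smul_one 0 c
  have ht := ν.trd_smul_one 0
  rw [zero_smul] at h0 ht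
  rw [zero_add, h0, ht] at this
  rw [this]
  ring

theorem nrd_zero : ν.nrd 0 = 0 := by simpa using ν.nrd_smul 0 0

theorem nrd_one : ν.nrd 1 = 1 := by simpa using ν.nrd_smul_one 1

theorem nrd_neg (x : A) : ν.nrd (-x) = ν.nrd x := by simpa using ν.nrd_smul (-1) x

variable [ValuativeRel K] [TopologicalSpace K] [IsNonarchimedeanLocalField K]

/-- The (squared) absolute value on a division algebra given by its reduced norm. -/
def val (x : A) : ℝ := absVal K K (ν.nrd x)

theorem val_nonneg (x : A) : 0 ≤ ν.val x := (absVal K K).nonneg _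

theorem val_mul (x y : A) : ν.val (x * y) = ν.val x * ν.val y := by
  rw [val, nrd_mul, map_mul, val, val]

theorem val_one : ν.val 1 = 1 := by rw [val, nrd_one, map_one]

theorem val_zero : ν.val 0 = 0 := by rw [val, nrd_zero, map_zero]

theorem val_neg (x : A) : ν.val (-x) = ν.val x := by rw [val, nrd_neg, val]

theorem val_pow (x : A) (m : ℕ) : ν.val (x ^ m) = ν.val x ^ m := by
  induction m with
  | zero => simp [val_one]
  | succ m ih => rw [pow_succ, val_mul, ih, pow_succ]

theorem val_smul (c : K) (x : A) : ν.val (c • x) = absVal K K c ^ 2 * ν.val x := by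
  rw [val, nrd_smul, map_mul, map_pow, val]

theorem val_eq_zero {x : A} : ν.val x = 0 ↔ x = 0 := by
  refine ⟨fun h => ν.eq_zero_of_nrd x ((absVal K K).eq_zero.1 h), ?_⟩
  rintro rfl
  exact ν.val_zero

theorem val_pos {x : A} (hx : x ≠ 0) : 0 < ν.val x :=
  lt_of_le_of_ne (ν.val_nonneg x) fun h => hx (ν.val_eq_zero.1 h.symm)

/-- For `x` outside `K` the characteristic polynomial has no root, and `absVal_sq_le_of_no_root`
bounds the trace by the norm. This yields the ultrametric inequality through `nrd (x + 1) = nrd x +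
trd x + 1`. -/
theorem absVal_trd_le_one {x : A} (hx : ν.val x ≤ 1) : absVal K K (ν.trd x) ≤ 1 := by
  rcases ν.eq_smul_one_or_no_root x with ⟨c, rfl⟩ | h
  · rw [val, nrd_smul_one, map_pow] at hx
    rw [ν.trd_smul_one]
    exact absVal_mul_le_one (absVal_ofNat_le_one 2)
      ((pow_le_one_iff_of_nonneg ((absVal K K).nonneg _) two_ne_zero).1 hx)
  · have := absVal_sq_le_of_no_root (K := K) h
    exact (pow_le_one_iff_of_nonneg ((absVal K K).nonneg _) two_ne_zero).1 (this.trans hx)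

theorem val_add_one_le {x : A} (hx : ν.val x ≤ 1) : ν.val (x + 1) ≤ 1 := by
  have := ν.nrd_add_smul_one x 1
  rw [one_smul] at this
  rw [val, this, one_mul, one_pow]
  exact absVal_add_le_of_le (absVal_add_le_of_le hx (ν.absVal_trd_le_one hx)) (map_one _).le

theorem val_add_le (x y : A) : ν.val (x + y) ≤ max (ν.val x) (ν.val y) := by
  have key : ∀ x y : A, ν.val x ≤ ν.val y → ν.val (x + y) ≤ ν.val y := by
    intro x y hxy
    rcases eq_or_ne y 0 with rfl | hy
    · rwa [add_zero]
    have hp := ν.val_pos hy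
    have e : x + y = (x * y⁻¹ + 1) * y := by
      rw [add_mul, mul_assoc, inv_mul_cancel₀ hy, mul_one, one_mul]
    have h1 : ν.val (x * y⁻¹) ≤ 1 := by
      have : ν.val (x * y⁻¹) * ν.val y = ν.val x := by
        rw [← val_mul, mul_assoc, inv_mul_cancel₀ hy, mul_one]
      nlinarith
    rw [e, val_mul]
    exact mul_le_of_le_one_left hp.le (ν.val_add_one_le h1)
  rcases le_total (ν.val x) (ν.val y) with h | h
  · exact (key x y h).trans (le_max_right _ _)
  · rw [add_comm]; exact (key y x h).trans (le_max_left _ _)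

theorem val_add_le_of_le {x y : A} {r : ℝ} (hx : ν.val x ≤ r) (hy : ν.val y ≤ r) :
    ν.val (x + y) ≤ r := (ν.val_add_le x y).trans (max_le hx hy)

theorem val_sub_le_of_le {x y : A} {r : ℝ} (hx : ν.val x ≤ r) (hy : ν.val y ≤ r) :
    ν.val (x - y) ≤ r := by
  rw [sub_eq_add_neg]; exact ν.val_add_le_of_le hx (by rwa [val_neg])

theorem val_add_eq_right {x y : A} (h : ν.val x < ν.val y) : ν.val (x + y) = ν.val y := by
  refine le_antisymm (ν.val_add_le_of_le h.le le_rfl) (not_lt.1 fun h' => ?_)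
  have := ν.val_add_le (x + y) (-x)
  rw [val_neg, add_neg_cancel_comm] at this
  exact absurd this (not_le.2 (max_lt h' h))

theorem val_add_eq_max {x y : A} (h : ν.val x ≠ ν.val y) :
    ν.val (x + y) = max (ν.val x) (ν.val y) := by
  rcases lt_or_gt_of_ne h with h | h
  · rw [ν.val_add_eq_right h, max_eq_right h.le]
  · rw [add_comm, ν.val_add_eq_right h, max_eq_left h.le]

/-- If `val x > 1`, the leading term of a monic integral equation strictly dominates all the others.
-/
theorem val_le_one_of_isIntegral {x : A} (hx : IsIntegral 𝒪[K] x) : ν.val x ≤ 1 := by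
  obtain ⟨p, hp, hpx⟩ := hx
  by_contra! hlt
  change Polynomial.aeval x p = 0 at hpx
  rw [Polynomial.aeval_eq_sum_range, Finset.sum_range_succ, hp.coeff_natDegree, one_smul] at hpx
  have hsum : ∀ m ≤ p.natDegree, ν.val (∑ i ∈ Finset.range m, p.coeff i • x ^ i) <
      ν.val x ^ p.natDegree := by
    intro m hm
    induction m with
    | zero => simpa [val_zero] using pow_pos (one_pos.trans hlt) _
    | succ m ih =>
      rw [Finset.sum_range_succ]
      refine (ν.val_add_le _ _).trans_lt (max_lt (ih (by omega)) ?_)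
      have e : p.coeff m • x ^ m = (p.coeff m : K) • x ^ m := rfl
      rw [e, val_smul, val_pow]
      refine lt_of_le_of_lt (mul_le_of_le_one_left (pow_nonneg (ν.val_nonneg x) m) ?_)
        (pow_lt_pow_right₀ hlt (by omega))
      exact pow_le_one₀ ((absVal K K).nonneg _) (absVal_self_le_one_iff.2 (p.coeff m).2)
  have h1 := hsum _ le_rfl
  rw [← val_pow, eq_neg_of_add_eq_zero_left hpx, val_neg] at h1
  exact lt_irrefl _ h1

/-- A quaternion division algebra contains an unramified quadratic extension of its center. -/
theorem exists_isResiduallyIrreducible :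
    ∃ ω : A, IsResiduallyIrreducible K (ν.trd ω) (ν.nrd ω) := by
  -- Otherwise every integral element is congruent to an element of `K`. Expanding in powers of an
  -- element `j` of largest value below `1` approximates all elements by the commutative algebra
  -- `K[j]`, so `A` would be commutative.
  by_contra! hcon
  have hres : ∀ x : A, ν.val x ≤ 1 → ∃ a : K, absVal K K a ≤ 1 ∧ ν.val (x - a • (1 : A)) < 1 := by
    intro x hx
    by_contra! hno
    refine hcon x ⟨ν.absVal_trd_le_one hx, hx, fun a ha => ?_⟩
    have e : a ^ 2 - ν.trd x * a + ν.nrd x = ν.nrd (x - a • (1 : A)) := by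
      rw [sub_eq_add_neg x, ← neg_smul, ν.nrd_add_smul_one]; ring
    rw [e]
    refine le_antisymm (ν.val_sub_le_of_le hx ?_) (hno a ha)
    rw [val_smul, val_one, mul_one]
    exact pow_le_one₀ ((absVal K K).nonneg _) ha
  obtain ⟨ϖ, hϖ⟩ := exists_isUniformizer K
  obtain ⟨j, hj0, hj1, hj⟩ : ∃ j : A, j ≠ 0 ∧ ν.val j < 1 ∧
      ∀ x, ν.val x < 1 → ν.val x ≤ ν.val j := by
    -- Values are powers of `|ϖ|`. If `|ϖ|` itself is not attained, the largest value below `1` is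
    -- `|ϖ|²`, that of the scalar `ϖ`.
    by_cases h : ∃ j : A, ν.val j = absVal K K ϖ
    · obtain ⟨j, hj⟩ := h
      refine ⟨j, fun h0 => hϖ.1.ne ?_, hj ▸ hϖ.2.1, fun x hx => hj ▸ hϖ.le_of_lt_one hx⟩
      rw [← hj, h0, val_zero]
    · have hv : ν.val (ϖ • (1 : A)) = absVal K K ϖ ^ 2 := by rw [val_smul, val_one, mul_one]
      refine ⟨ϖ • (1 : A), smul_ne_zero hϖ.ne_zero one_ne_zero, ?_, fun x hx => ?_⟩
      · rw [hv]; exact pow_lt_one₀ hϖ.1.le hϖ.2.1 two_ne_zero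
      · rcases eq_or_ne x 0 with rfl | hx0
        · rw [val_zero]; exact ν.val_nonneg _
        obtain ⟨k, hk⟩ := hϖ.2.2 (ν.nrd x) fun h0 => hx0 (ν.eq_zero_of_nrd x h0)
        change ν.val x = _ at hk
        have hk1 : k ≠ 1 := by
          rintro rfl
          exact h ⟨x, by rw [hk, zpow_one]⟩
        have hk0 : 0 < k := by
          rw [hk] at hx
          exact (zpow_lt_one_iff_right_of_lt_one₀ hϖ.1 hϖ.2.1).1 hx
        rw [hk, hv, ← zpow_natCast]
        exact zpow_le_zpow_right_of_le_one₀ hϖ.1 hϖ.2.1.le (by push_cast; omega)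
  have hexp : ∀ (m : ℕ) (x : A), ν.val x ≤ 1 → ∃ p y : A, p ∈ Algebra.adjoin K {j} ∧
      ν.val y ≤ 1 ∧ x = p + j ^ m * y := by
    intro m
    induction m with
    | zero => exact fun x hx => ⟨0, x, zero_mem _, hx, by simp⟩
    | succ m ih =>
      intro x hx
      obtain ⟨p, y, hp, hy, rfl⟩ := ih x hx
      obtain ⟨a, -, ha'⟩ := hres y hy
      refine ⟨p + a • j ^ m, j⁻¹ * (y - a • (1 : A)), add_mem hp (Subalgebra.smul_mem _
        (pow_mem (Algebra.self_mem_adjoin_singleton K j) m) a), ?_, ?_⟩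
      · have h1 := hj _ ha'
        have h2 : ν.val j * ν.val (j⁻¹ * (y - a • (1 : A))) = ν.val (y - a • (1 : A)) := by
          rw [← val_mul, ← mul_assoc, mul_inv_cancel₀ hj0, one_mul]
        have h3 := ν.val_pos hj0
        nlinarith
      · rw [pow_succ, mul_assoc (j ^ m), ← mul_assoc j, mul_inv_cancel₀ hj0, one_mul, mul_sub,
          mul_smul_comm, mul_one]
        abel
  have hcomm : ∀ x y : A, ν.val x ≤ 1 → ν.val y ≤ 1 → x * y = y * x := by
    intro x x' hx hx'
    have hb : ∀ m : ℕ, ν.val (x * x' - x' * x) ≤ ν.val j ^ m := by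
      intro m
      obtain ⟨p, y, hp, hy, hxe⟩ := hexp m x hx
      obtain ⟨p', y', hp', hy', hxe'⟩ := hexp m x' hx'
      have hpp : p * p' = p' * p := by
        have := Algebra.isMulCommutative_adjoin K (s := {j}) (by simp)
        exact congrArg Subtype.val
          (mul_comm' (⟨p, hp⟩ : Algebra.adjoin K {j}) ⟨p', hp'⟩)
      have hu : ν.val (j ^ m * y) ≤ ν.val j ^ m := by
        rw [val_mul, val_pow]; exact mul_le_of_le_one_right (pow_nonneg (ν.val_nonneg _) _) hy
      have hu' : ν.val (j ^ m * y') ≤ ν.val j ^ m := by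
        rw [val_mul, val_pow]; exact mul_le_of_le_one_right (pow_nonneg (ν.val_nonneg _) _) hy'
      have hp1 : ν.val p ≤ 1 := by
        rw [eq_sub_of_add_eq hxe.symm]
        exact ν.val_sub_le_of_le hx (hu.trans (pow_le_one₀ (ν.val_nonneg _) hj1.le))
      -- As `p` and `p'` commute, each term of the commutator contains one of the remainders `j^m
      -- y`, `j^m y'`.
      have e : x * x' - x' * x = (p * (j ^ m * y') - (j ^ m * y') * p) +
          ((j ^ m * y) * x' - x' * (j ^ m * y)) := by
        have h1 : p * x' - x' * p = p * (j ^ m * y') - (j ^ m * y') * p := by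
          rw [hxe', mul_add, add_mul, hpp]; abel
        rw [← h1]
        nth_rewrite 1 2 [hxe]
        rw [add_mul, mul_add]
        abel
      have hm : ∀ a b : A, ν.val a ≤ 1 → ν.val b ≤ ν.val j ^ m →
          ν.val (a * b) ≤ ν.val j ^ m ∧ ν.val (b * a) ≤ ν.val j ^ m := by
        intro a b ha hb
        rw [val_mul, val_mul]
        exact ⟨(mul_le_of_le_one_left (ν.val_nonneg _) ha).trans hb,
          (mul_le_of_le_one_right (ν.val_nonneg _) ha).trans hb⟩
      rw [e]
      exact ν.val_add_le_of_le (ν.val_sub_le_of_le (hm _ _ hp1 hu').1 (hm _ _ hp1 hu').2)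
        (ν.val_sub_le_of_le (hm _ _ hx' hu).2 (hm _ _ hx' hu).1)
    have hl := ge_of_tendsto' (tendsto_pow_atTop_nhds_zero_of_lt_one (ν.val_nonneg j) hj1) hb
    exact sub_eq_zero.1 (ν.val_eq_zero.1 (le_antisymm hl (ν.val_nonneg _)))
  have hscale : ∀ x : A, ∃ c : K, c ≠ 0 ∧ ν.val (c • x) ≤ 1 := by
    intro x
    rcases eq_or_ne x 0 with rfl | hx0
    · exact ⟨1, one_ne_zero, by simp [val_zero]⟩
    rcases le_total (ν.val x) 1 with h | h
    · exact ⟨1, one_ne_zero, by simpa using h⟩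
    · have hn : ν.nrd x ≠ 0 := fun h0 => hx0 (ν.eq_zero_of_nrd x h0)
      refine ⟨(ν.nrd x)⁻¹, inv_ne_zero hn, ?_⟩
      have : ν.val ((ν.nrd x)⁻¹ • x) = (ν.val x)⁻¹ := by
        rw [val_smul, map_inv₀]
        change (ν.val x)⁻¹ ^ 2 * ν.val x = _
        have := (ν.val_pos hx0).ne'
        field_simp
      rw [this]
      exact inv_le_one_of_one_le₀ h
  obtain ⟨x, y, hxy⟩ := ν.exists_not_commute
  obtain ⟨c, hc, hcx⟩ := hscale x
  obtain ⟨d, hd, hdy⟩ := hscale y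
  have := hcomm _ _ hcx hdy
  rw [smul_mul_smul_comm, smul_mul_smul_comm, mul_comm d c] at this
  exact hxy (smul_right_injective A (mul_ne_zero hc hd) this)

end ReducedNorm

end ReducedNorms

/-! ### The maximal order as a cyclic algebra. -/

section MaximalOrders

variable {K A : Type*} [Field K] [DivisionRing A] [Algebra K A] [ValuativeRel K]
  [TopologicalSpace K] [IsNonarchimedeanLocalField K]

namespace ReducedNorm

variable (ν : ReducedNorm K A)

/-- The unramified quadratic subfield `K(ω)` is normalized by a square root of a uniformizer. -/
theorem exists_sq_eq_uniformizer (h2 : (2 : K) ≠ 0) {ω : A}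
    (hω : IsResiduallyIrreducible K (ν.trd ω) (ν.nrd ω)) :
    ∃ (j : A) (ϖ : K), IsUniformizer ϖ ∧ j * j = ϖ • (1 : A) ∧ j * ω = ν.trd ω • j - ω * j := by
  set t := ν.trd ω with ht
  set n := ν.nrd ω with hn
  have hωω : ω * ω = t • ω - n • (1 : A) := ν.mul_self ω
  have hωK : ∀ c : K, ω ≠ c • (1 : A) := by
    rintro c rfl
    have h0 := hω.absVal_eval c ?_
    · rw [hn, nrd_smul_one, ht, trd_smul_one] at h0
      have e : c ^ 2 - 2 * c * c + c ^ 2 = 0 := by ring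
      rw [e, map_zero] at h0
      exact zero_ne_one h0
    · have h0 := hω.norm_le
      rw [hn, nrd_smul_one, map_pow] at h0
      exact (pow_le_one_iff_of_nonneg ((absVal K K).nonneg _) two_ne_zero).1 h0
  -- The two relations give `2ωx = tx`, so `ω = t/2` would be a scalar if `x ≠ 0`.
  have hcomm : ∀ x : A, x * ω = t • x - ω * x → x * ω = ω * x → x = 0 := by
    intro x h h'
    by_contra hx
    refine hωK (t / 2) (mul_right_cancel₀ hx ?_)
    rw [smul_mul_assoc, one_mul]
    refine smul_right_injective A h2 ?_
    change (2 : K) • (ω * x) = (2 : K) • (t / 2) • x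
    rw [smul_smul, mul_div_cancel₀ _ h2]
    rw [h'] at h
    rw [two_smul]
    nth_rewrite 1 [h]
    abel
  obtain ⟨z, hz⟩ : ∃ z, ω * z ≠ z * ω := by
    by_contra! h
    obtain ⟨c, hc⟩ := ν.mem_center ω h
    exact hωK c hc
  obtain ⟨j₀, hj₀, hj₀ω⟩ : ∃ j₀ : A, j₀ ≠ 0 ∧ j₀ * ω = t • j₀ - ω * j₀ := by
    -- Any commutator with `ω` intertwines `ω` with its conjugate `t - ω`.
    refine ⟨ω * z - z * ω, sub_ne_zero.2 hz, ?_⟩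
    rw [sub_mul, mul_sub, mul_assoc z, ← mul_assoc ω ω, hωω]
    simp only [mul_sub, sub_mul, mul_smul_comm, smul_mul_assoc, mul_one, one_mul, smul_sub,
      mul_assoc]
    abel
  have hj₀sq : j₀ * j₀ = (-ν.nrd j₀) • (1 : A) := by
    have h1 : (j₀ * j₀) * ω = ω * (j₀ * j₀) := by
      rw [mul_assoc, hj₀ω, mul_sub, mul_smul_comm, ← mul_assoc, hj₀ω, sub_mul, smul_mul_assoc,
        mul_assoc]
      abel
    have h2 : ν.trd j₀ = 0 := by
      by_contra h0
      -- Since `j₀²` commutes with `ω`, a nonzero trace would make `j₀`, a combination of `j₀²` and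
      -- `1`, commute with `ω` too.
      refine hj₀ (hcomm j₀ hj₀ω (smul_right_injective A h0 ?_))
      have e : ν.trd j₀ • j₀ = j₀ * j₀ + ν.nrd j₀ • (1 : A) := by rw [ν.mul_self]; abel
      change ν.trd j₀ • (j₀ * ω) = ν.trd j₀ • (ω * j₀)
      rw [← smul_mul_assoc, ← mul_smul_comm, e, add_mul, mul_add, h1]
      simp
    rw [ν.mul_self, h2]
    module
  have hN0 : ν.nrd j₀ ≠ 0 := fun h => hj₀ (ν.eq_zero_of_nrd _ h)
  obtain ⟨ϖ, hϖ⟩ := exists_isUniformizer K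
  obtain ⟨k, hk⟩ := hϖ.2.2 _ hN0
  have hsc : ∀ c : K, (c • j₀) * ω = t • (c • j₀) - ω * (c • j₀) := by
    intro c
    rw [smul_mul_assoc, hj₀ω, smul_sub, mul_smul_comm, smul_comm]
  have hsq : ∀ c : K, (c • j₀) * (c • j₀) = (-(c ^ 2 * ν.nrd j₀)) • (1 : A) := by
    intro c
    rw [smul_mul_smul_comm, hj₀sq, smul_smul]
    congr 1
    ring
  obtain ⟨l, rfl | rfl⟩ := Int.even_or_odd' k
  -- If `nrd j₀` has even valuation, rescaling gives `j² = u` a unit. Some `g = x + yω` has norm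
  -- `u⁻¹`, so `(gj)² = 1` and `gj = ±1` commutes with `ω`, contrary to `hcomm`.
  · exfalso
    set u : K := -((ϖ ^ (-l)) ^ 2 * ν.nrd j₀) with hu
    set j := ϖ ^ (-l) • j₀ with hj
    have hu1 : absVal K K u = 1 := by
      rw [hu, (absVal K K).map_neg, map_mul, hk, map_pow, map_zpow₀, ← zpow_natCast, ← zpow_mul,
        ← zpow_add₀ hϖ.1.ne', ← zpow_zero (absVal K K ϖ)]
      congr 1
      push_cast; ring
    have hu0 : u ≠ 0 := (absVal K K).pos_iff.1 (hu1 ▸ one_pos)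
    have hui : absVal K K u⁻¹ = 1 := by rw [map_inv₀, hu1, inv_one]
    obtain ⟨x, y, hxy⟩ := hω.exists_normForm_eq (E := K) hui (c := u⁻¹) (by simp)
    simp only [Algebra.algebraMap_self, RingHom.id_apply] at hxy
    have hjω : j * ω = t • j - ω * j := hsc _
    have hjj : j * j = u • (1 : A) := hsq _
    set g : A := x • (1 : A) + y • ω with hg
    have hgω : g * ω = ω * g := by
      rw [hg, add_mul, mul_add]; simp
    have hjg : j * g = (x • (1 : A) + y • (t • (1 : A) - ω)) * j := by
      rw [hg, mul_add, mul_smul_comm, mul_smul_comm, hjω]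
      simp only [add_mul, sub_mul, smul_mul_assoc, one_mul, mul_one]
    have hgg : g * (x • (1 : A) + y • (t • (1 : A) - ω)) = u⁻¹ • (1 : A) := by
      rw [← hxy, hg]
      simp only [add_mul, mul_add, mul_sub, smul_mul_assoc, mul_smul_comm, one_mul,
        mul_one, smul_sub, hωω]
      module
    have h1 : (g * j) * (g * j) = 1 := by
      rw [mul_assoc, ← mul_assoc j, hjg, mul_assoc, hjj, ← mul_assoc, hgg, smul_mul_smul_comm,
        inv_mul_cancel₀ hu0, one_mul, one_smul]
    have h2 : (g * j) * ω = t • (g * j) - ω * (g * j) := by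
      rw [mul_assoc, hjω, mul_sub, mul_smul_comm, ← mul_assoc, hgω, mul_assoc]
    have h3 : g * j ≠ 0 := by
      intro h0
      rw [h0, mul_zero] at h1
      exact zero_ne_one h1
    refine h3 (hcomm _ h2 ?_)
    rcases mul_self_eq_one_iff.1 h1 with h | h <;> rw [h] <;> simp
  · have hv : absVal K K (-((ϖ ^ (-l)) ^ 2 * ν.nrd j₀)) = absVal K K ϖ := by
      rw [(absVal K K).map_neg, map_mul, hk, map_pow, map_zpow₀, ← zpow_natCast, ← zpow_mul,
        ← zpow_add₀ hϖ.1.ne']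
      convert zpow_one _ using 2
      push_cast; ring
    refine ⟨ϖ ^ (-l) • j₀, _, ?_, hsq _, hsc _⟩
    rw [IsUniformizer, hv]
    exact hϖ

/-- The reduced norm of `x + yω` is the norm form `x² + txy + ny²`, anisotropic modulo the maximal
ideal. -/
theorem val_linear {ω : A} (hω : IsResiduallyIrreducible K (ν.trd ω) (ν.nrd ω)) (x y : K) :
    ν.val (x • (1 : A) + y • ω) = max (absVal K K x) (absVal K K y) ^ 2 := by
  rw [← hω.absVal_normForm, val]
  congr 1
  rcases eq_or_ne y 0 with rfl | hy
  · simp [nrd_smul_one]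
  · have e : x • (1 : A) + y • ω = y • (ω + (x / y) • (1 : A)) := by
      rw [smul_add, smul_smul, mul_div_cancel₀ _ hy, add_comm]
    rw [e, nrd_smul, nrd_add_smul_one]
    field_simp
    ring

end ReducedNorm

open Module in
/-- The maximal order of a quaternion division algebra over a local field is the cyclic algebra
generated by the ring of integers of the unramified quadratic extension and a square root of a
uniformizer. -/
theorem IsMaximalOrder.exists_quaternion_presentation (h2 : (2 : K) ≠ 0)
    (hA : IsQuaternionAlgebra K A) {D : Subalgebra 𝒪[K] A} (hD : IsMaximalOrder D) :
    ∃ t n ϖ : 𝒪[K], IsResiduallyIrreducible K (t : K) (n : K) ∧ IsUniformizer (ϖ : K) ∧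
      Nonempty (ℍ[𝒪[K], -n, t, ϖ] ≃ₐ[𝒪[K]] D) := by
  obtain ⟨ν⟩ := hA.nonempty_reducedNorm h2
  obtain ⟨ω, hω⟩ := ν.exists_isResiduallyIrreducible
  obtain ⟨j, ϖ, hϖ, hjj, hjω⟩ := ν.exists_sq_eq_uniformizer h2 hω
  have hωω := ν.mul_self ω
  have hval1 := ν.val_linear hω
  set t := ν.trd ω
  set n := ν.nrd ω
  have hϖ1 := hϖ.2.1.le
  lift t to 𝒪[K] using absVal_self_le_one_iff.1 hω.trace_le with t ht
  lift n to 𝒪[K] using absVal_self_le_one_iff.1 hω.norm_le with n hn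
  lift ϖ to 𝒪[K] using absVal_self_le_one_iff.1 hϖ1
  refine ⟨t, n, ϖ, hω, hϖ, ?_⟩
  have hvj : ν.val j = absVal K K ϖ := by
    have h1 : ν.val j ^ 2 = absVal K K ϖ ^ 2 := by
      rw [sq, ← ν.val_mul, hjj, ν.val_smul, ν.val_one, mul_one]
    exact (pow_left_inj₀ (ν.val_nonneg j) hϖ.1.le two_ne_zero).1 h1
  let B : QuaternionAlgebra.Basis A (-n) t ϖ :=
    { i := ω
      j := j
      k := ω * j
      i_mul_i := by
        rw [hωω]
        change (t : K) • ω - (n : K) • (1 : A) = (-n : 𝒪[K]) • (1 : A) + (t : K) • ω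
        rw [neg_smul]
        change (t : K) • ω - (n : K) • (1 : A) = -((n : K) • (1 : A)) + (t : K) • ω
        abel
      j_mul_j := hjj
      i_mul_j := rfl
      j_mul_i := hjω }
  let BK : QuaternionAlgebra.Basis A (-(n : K)) (t : K) (ϖ : K) :=
    { i := ω
      j := j
      k := ω * j
      i_mul_i := by rw [hωω]; module
      j_mul_j := hjj
      i_mul_j := rfl
      j_mul_i := hjω }
  have hlift : ∀ q : ℍ[K, -(n : K), (t : K), (ϖ : K)], BK.liftHom q =
      (q.re • (1 : A) + q.imI • ω) + (q.imJ • (1 : A) + q.imK • ω) * j := by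
    intro q
    change algebraMap K A q.re + q.imI • ω + q.imJ • j + q.imK • (ω * j) = _
    rw [Algebra.algebraMap_eq_smul_one, add_mul, smul_mul_assoc, smul_mul_assoc, one_mul]
    abel
  -- The summands in `K(ω)` and `K(ω)j` have values of opposite parity and cannot cancel. The
  -- formula gives injectivity of `BK.liftHom` and reads integrality off the coordinates.
  have hvalq : ∀ q : ℍ[K, -(n : K), (t : K), (ϖ : K)], ν.val (BK.liftHom q) =
      max (max (absVal K K q.re) (absVal K K q.imI) ^ 2)
        (max (absVal K K q.imJ) (absVal K K q.imK) ^ 2 * absVal K K (ϖ : K)) := by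
    intro q
    obtain ⟨c, hc⟩ : ∃ c : K, max (absVal K K q.re) (absVal K K q.imI) = absVal K K c := by
      rcases max_choice (absVal K K q.re) (absVal K K q.imI) with h | h <;> exact ⟨_, h⟩
    obtain ⟨d, hd⟩ : ∃ d : K, max (absVal K K q.imJ) (absVal K K q.imK) = absVal K K d := by
      rcases max_choice (absVal K K q.imJ) (absVal K K q.imK) with h | h <;> exact ⟨_, h⟩
    rw [hlift]
    rcases eq_or_ne d 0 with rfl | hd0
    · have hz : q.imJ = 0 ∧ q.imK = 0 := by
        rw [map_zero] at hd
        have h1 := (le_max_left _ _).trans hd.le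
        have h2 := (le_max_right _ _).trans hd.le
        exact ⟨(absVal K K).eq_zero.1 (h1.antisymm ((absVal K K).nonneg _)),
          (absVal K K).eq_zero.1 (h2.antisymm ((absVal K K).nonneg _))⟩
      rw [hz.1, hz.2]
      simp only [zero_smul, add_zero, zero_mul, map_zero, max_self, ne_eq, OfNat.ofNat_ne_zero,
        not_false_eq_true, zero_pow, hval1]
      exact (max_eq_left (by positivity)).symm
    · rw [ν.val_add_eq_max, ν.val_mul, hval1, hval1, hvj]
      rw [ν.val_mul, hval1, hval1, hvj, hc, hd]
      exact (hϖ.sq_mul_ne hd0).symm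
  have hinj : Function.Injective BK.liftHom := by
    refine (injective_iff_map_eq_zero _).2 fun q hq => ?_
    have h0 := hvalq q
    rw [hq, ν.val_zero] at h0
    have h1 := (le_max_left _ _).trans h0.ge
    have h2 := (le_max_right _ _).trans h0.ge
    have h1' := ((sq_nonpos_iff _).1 h1).le
    have h2' := ((sq_nonpos_iff _).1 (nonpos_of_mul_nonpos_left h2 hϖ.1)).le
    have hz : ∀ c : K, absVal K K c ≤ 0 → c = 0 := fun c hc =>
      (absVal K K).eq_zero.1 (hc.antisymm ((absVal K K).nonneg _))
    ext
    · exact hz _ ((le_max_left _ _).trans h1')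
    · exact hz _ ((le_max_right _ _).trans h1')
    · exact hz _ ((le_max_left _ _).trans h2')
    · exact hz _ ((le_max_right _ _).trans h2')
  have hsurj : Function.Surjective BK.liftHom := by
    obtain ⟨a, b, -, -, ⟨e⟩⟩ := hA
    have hfin : finrank K A = 4 := by
      rw [e.toLinearEquiv.finrank_eq, QuaternionAlgebra.finrank_eq_four]
    have : FiniteDimensional K A := FiniteDimensional.of_finrank_pos (by omega)
    have h := LinearMap.injective_iff_surjective_of_finrank_eq_finrank
      (f := BK.liftHom.toLinearMap) (by rw [hfin, QuaternionAlgebra.finrank_eq_four])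
    exact h.1 hinj
  have hBBK : ∀ q : ℍ[𝒪[K], -n, t, ϖ],
      B.liftHom q = BK.liftHom ⟨(q.re : K), (q.imI : K), (q.imJ : K), (q.imK : K)⟩ :=
    fun q => rfl
  have hBinj : Function.Injective B.liftHom := by
    intro q q' h
    rw [hBBK, hBBK] at h
    have h' := hinj h
    simp only [QuaternionAlgebra.mk.injEq, Subtype.ext_iff.symm] at h'
    exact QuaternionAlgebra.ext h'.1 h'.2.1 h'.2.2.1 h'.2.2.2
  have hle : D ≤ B.liftHom.range := by
    intro x hx
    have hv := ν.val_le_one_of_isIntegral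
      (IsIntegral.of_mem_of_fg D hD.isOrder.fg x hx)
    obtain ⟨q, rfl⟩ := hsurj x
    rw [hvalq] at hv
    have h1 := (pow_le_one_iff_of_nonneg (((absVal K K).nonneg _).trans (le_max_left _ _))
      two_ne_zero).1 ((le_max_left _ _).trans hv)
    -- From `|d|²|ϖ| ≤ 1` discreteness gives `|d| ≤ 1`, because `|d| > 1` means `|d| ≥ |ϖ|⁻¹`.
    have h2 : max (absVal K K q.imJ) (absVal K K q.imK) ≤ 1 := by
      obtain ⟨d, hd⟩ : ∃ d : K, max (absVal K K q.imJ) (absVal K K q.imK) = absVal K K d := by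
        rcases max_choice (absVal K K q.imJ) (absVal K K q.imK) with h | h <;> exact ⟨_, h⟩
      have h3 := (le_max_right _ _).trans hv
      rw [hd] at h3 ⊢
      by_contra! hlt
      have hd0 : 0 < absVal K K d := one_pos.trans hlt
      have h4 := hϖ.le_of_lt_one (x := d⁻¹) (by rw [map_inv₀]; exact inv_lt_one_of_one_lt₀ hlt)
      rw [map_inv₀] at h4
      have h5 : 1 ≤ absVal K K (ϖ : K) * absVal K K d := by
        rwa [inv_le_iff_one_le_mul₀ hd0] at h4
      nlinarith
    have hm : ∀ c : K, absVal K K c ≤ 1 → c ∈ 𝒪[K] := fun c hc => absVal_self_le_one_iff.1 hc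
    exact ⟨⟨⟨_, hm _ ((le_max_left _ _).trans h1)⟩, ⟨_, hm _ ((le_max_right _ _).trans h1)⟩,
      ⟨_, hm _ ((le_max_left _ _).trans h2)⟩, ⟨_, hm _ ((le_max_right _ _).trans h2)⟩⟩,
      hBBK _⟩
  have hord : IsOrder B.liftHom.range := by
    constructor
    · have : Subalgebra.toSubmodule B.liftHom.range =
          LinearMap.range B.liftHom.toLinearMap := rfl
      rw [this, LinearMap.range_eq_map]
      exact (Module.Finite.fg_top).map _
    · rw [eq_top_iff, ← hD.isOrder.span_eq_top]
      exact Submodule.span_mono hle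
  have hDeq := hD.eq_of_le _ hord hle
  exact ⟨(AlgEquiv.ofInjective B.liftHom hBinj).trans (Subalgebra.equivOfEq _ _ hDeq.symm)⟩

end MaximalOrders

/-! ### Matrix pairs satisfying the relations of the order. -/

section QuaternionPairs

/-- `W` and `J` satisfy the defining relations of the quaternion algebra `ℍ[R, -n, t, ϖ]`. -/
structure IsQuaternionPair {R B : Type*} [CommRing R] [Ring B] [Algebra R B] (t n ϖ : R)
    (W J : B) : Prop where
  left : W * W = t • W - n • (1 : B)
  right : J * J = ϖ • (1 : B)
  mul : J * W = t • J - W * J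

/-- Two quaternionic pairs in an algebra over a field have a nonzero intertwiner. -/
theorem IsQuaternionPair.exists_intertwiner {F B : Type*} [Field F] [Ring B] [Nontrivial B]
    [Algebra F B] {t n ϖ : F} (h2 : (2 : F) ≠ 0) (hd : t ^ 2 - 4 * n ≠ 0) (hϖ : ϖ ≠ 0) {W J W' J' : B}
    (h : IsQuaternionPair t n ϖ W J) (h' : IsQuaternionPair t n ϖ W' J') :
    ∃ x : B, x ≠ 0 ∧ x * W = W' * x ∧ x * J = J' * x := by
  have hsq : ((2 : F) • W' - t • (1 : B)) * ((2 : F) • W' - t • (1 : B)) =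
      (t ^ 2 - 4 * n) • (1 : B) := by
    simp only [sub_mul, mul_sub, smul_mul_assoc, mul_smul_comm, h'.left, mul_one, one_mul]
    module
  obtain ⟨T, hT0, hTW⟩ : ∃ T : B, T ≠ 0 ∧ T * W = W' * T := by
    by_contra! hcon
    -- `W'Y + YW - tY` intertwines `W` and `W'` for every `Y`. If it always vanished, `Y = 1` and
    -- then `Y = J'` would give `(2W' - t)J' = 0`, a product of invertible elements.
    have hY : ∀ Y : B, W' * Y + Y * W - t • Y = 0 := by
      intro Y
      by_contra h0
      refine hcon _ h0 ?_
      simp only [sub_mul, add_mul, mul_sub, mul_add, mul_assoc, h.left, smul_mul_assoc,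
        mul_smul_comm, mul_one]
      rw [← mul_assoc W' W', h'.left]
      simp only [sub_mul, smul_mul_assoc, one_mul]
      module
    have h1 : W = t • (1 : B) - W' := by
      have := hY 1
      rw [mul_one, one_mul] at this
      rw [← sub_eq_zero, ← this]
      abel
    have hJ := hY J'
    rw [h1, mul_sub, mul_smul_comm, mul_one, h'.mul] at hJ
    have h3 : ((2 : F) • W' - t • (1 : B)) * J' = 0 := by
      rw [sub_mul, smul_mul_assoc, smul_mul_assoc, one_mul, ← hJ]
      module
    have h4 : (ϖ * (t ^ 2 - 4 * n)) • (1 : B) = 0 := by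
      have := congrArg (fun z => ((2 : F) • W' - t • (1 : B)) * (z * J')) h3
      simp only [zero_mul, mul_zero] at this
      rw [mul_assoc _ J' J', h'.right, mul_smul_comm, mul_one, mul_smul_comm, hsq,
        smul_smul] at this
      exact this
    exact (smul_ne_zero (mul_ne_zero hϖ hd) one_ne_zero) h4
  -- Averaging over `J`: adding `ϖ⁻¹J'SJ` makes an intertwiner of `W`, `W'` respect `J`, `J'` as
  -- well.
  have key : ∀ S : B, S * W = W' * S →
      (S + ϖ⁻¹ • (J' * S * J)) * W = W' * (S + ϖ⁻¹ • (J' * S * J)) ∧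
      (S + ϖ⁻¹ • (J' * S * J)) * J = J' * (S + ϖ⁻¹ • (J' * S * J)) := by
    intro S hS
    constructor
    · have e1 : J' * S * J * W = t • (J' * S * J) - J' * S * W * J := by
        rw [mul_assoc (J' * S) J W, h.mul, mul_sub, mul_smul_comm, ← mul_assoc]
      have e2 : J' * S * W * J = t • (J' * S * J) - W' * (J' * S * J) := by
        rw [mul_assoc J' S W, hS, ← mul_assoc J', h'.mul, sub_mul, sub_mul, smul_mul_assoc,
          smul_mul_assoc]
        simp only [mul_assoc]
      rw [add_mul, mul_add, hS, smul_mul_assoc, mul_smul_comm, e1, e2]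
      congr 2
      abel
    · have e3 : J' * (J' * S * J) = ϖ • (S * J) := by
        rw [mul_assoc J' S, ← mul_assoc J' J', h'.right, smul_mul_assoc, one_mul]
      have e4 : J' * S * J * J = ϖ • (J' * S) := by
        rw [mul_assoc (J' * S), h.right, mul_smul_comm, mul_one]
      rw [add_mul, mul_add, smul_mul_assoc, mul_smul_comm, e3, e4, smul_smul, smul_smul,
        inv_mul_cancel₀ hϖ, one_smul, one_smul, add_comm]
  by_cases h0 : T + ϖ⁻¹ • (J' * T * J) = 0
  -- When the average of `T` vanishes, `T` is replaced by `(2W' - t)T`. As `J'` anticommutes with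
  -- `2W' - t`, the sign flips and the average becomes `2(2W' - t)T ≠ 0`.
  · have hS : ((2 : F) • W' - t • (1 : B)) * T * W = W' * (((2 : F) • W' - t • (1 : B)) * T) := by
      rw [mul_assoc, hTW, ← mul_assoc, ← mul_assoc]
      congr 1
      simp only [sub_mul, mul_sub, smul_mul_assoc, mul_smul_comm, mul_one, one_mul]
    refine ⟨_, ?_, key _ hS⟩
    have e : J' * (((2 : F) • W' - t • (1 : B)) * T) * J =
        -(((2 : F) • W' - t • (1 : B)) * (J' * T * J)) := by
      have : J' * ((2 : F) • W' - t • (1 : B)) = -(((2 : F) • W' - t • (1 : B)) * J') := by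
        rw [mul_sub, sub_mul, mul_smul_comm, mul_smul_comm, h'.mul, smul_mul_assoc, smul_mul_assoc,
          one_mul, mul_one]
        module
      rw [← mul_assoc, this]
      simp only [neg_mul, mul_assoc]
    have e' : ϖ⁻¹ • (J' * T * J) = -T := eq_neg_of_add_eq_zero_right h0
    rw [e, smul_neg, ← mul_smul_comm, e', mul_neg, neg_neg, ← add_mul]
    intro hz
    have hz' : ((2 : F) • W' - t • (1 : B)) * T + ((2 : F) • W' - t • (1 : B)) * T = 0 := by
      rw [← add_mul]; exact hz
    rw [← two_smul F, smul_eq_zero_iff_right h2] at hz'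
    have := congrArg (fun z => ((2 : F) • W' - t • (1 : B)) * z) hz'
    simp only [mul_zero] at this
    rw [← mul_assoc, hsq, smul_mul_assoc, one_mul, smul_eq_zero_iff_right hd] at this
    exact hT0 this
  · exact ⟨_, h0, key T hTW⟩


namespace IsQuaternionPair

open Matrix

theorem map {R B C S : Type*} [CommRing R] [CommRing S] [Algebra R S] [Ring B] [Algebra R B]
    [Ring C] [Algebra R C] [Algebra S C] [IsScalarTower R S C] {t n ϖ : R} {W J : B}
    (h : IsQuaternionPair t n ϖ W J) (f : B →ₐ[R] C) :
    IsQuaternionPair (algebraMap R S t) (algebraMap R S n) (algebraMap R S ϖ) (f W) (f J) where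
  left := by simp only [algebraMap_smul, ← map_mul, h.left, map_sub, map_smul, map_one]
  right := by simp only [algebraMap_smul, ← map_mul, h.right, map_smul, map_one]
  mul := by simp only [algebraMap_smul, ← map_mul, h.mul, map_sub, map_smul]

/-- The pair with `W` the companion matrix of `X² - tX + n` attached to an element of norm `ϖ`. -/
theorem companion {R : Type*} [CommRing R] {t n ϖ a b : R}
    (h : a ^ 2 + t * a * b + n * b ^ 2 = ϖ) :
    IsQuaternionPair t n ϖ !![0, -n; 1, t] !![a, t * a + n * b; b, -a] where
  left := by
    rw [Matrix.mul_fin_two, Matrix.one_fin_two]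
    ext i j
    fin_cases i <;> fin_cases j <;> simp <;> ring
  right := by
    rw [Matrix.mul_fin_two, Matrix.one_fin_two, ← h]
    ext i j
    fin_cases i <;> fin_cases j <;> simp <;> ring
  mul := by
    rw [Matrix.mul_fin_two, Matrix.mul_fin_two]
    ext i j
    fin_cases i <;> fin_cases j <;> simp <;> ring

/-- The pair with diagonal `W` attached to a factorization of `ϖ`. -/
theorem diagonal {R : Type*} [CommRing R] {t n ϖ α a b : R} (hα : α ^ 2 - t * α + n = 0)
    (h : a * b = ϖ) :
    IsQuaternionPair t n ϖ !![α, 0; 0, t - α] !![0, a; b, 0] where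
  left := by
    rw [Matrix.mul_fin_two, Matrix.one_fin_two]
    ext i j
    fin_cases i <;> fin_cases j <;> simp <;> linear_combination hα
  right := by
    rw [Matrix.mul_fin_two, Matrix.one_fin_two, ← h]
    ext i j
    fin_cases i <;> fin_cases j <;> simp [mul_comm]
  mul := by
    rw [Matrix.mul_fin_two, Matrix.mul_fin_two]
    ext i j
    fin_cases i <;> fin_cases j <;> simp <;> ring

variable {R : Type*} [CommRing R] [IsDomain R] {t n ϖ : R} {W J : Matrix (Fin 2) (Fin 2) R}

/-- The trace of `J²W` is `ϖ tr W` directly and `2ϖt - ϖ tr W` after moving `J` past `W`. So `W`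
cannot be a scalar root of the polynomial. -/
theorem trace_eq (h2 : (2 : R) ≠ 0) (hϖ : ϖ ≠ 0) (h : IsQuaternionPair t n ϖ W J) :
    W.trace = t := by
  have h1 : (J * (J * W)).trace = 2 * ϖ * t - ϖ * W.trace := by
    rw [h.mul, mul_sub, mul_smul_comm, h.right, trace_sub, ← mul_assoc, trace_mul_comm,
      ← mul_assoc, h.right]
    simp [trace_smul]
    ring
  rw [← mul_assoc, h.right, smul_mul_assoc, one_mul, trace_smul, smul_eq_mul] at h1
  have : (2 * ϖ) * (W.trace - t) = 0 := by linear_combination h1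
  rcases mul_eq_zero.1 this with h3 | h3
  · exact absurd h3 (mul_ne_zero h2 hϖ)
  · exact sub_eq_zero.1 h3

theorem det_eq (h2 : (2 : R) ≠ 0) (hϖ : ϖ ≠ 0) (h : IsQuaternionPair t n ϖ W J) :
    W.det = n := by
  have ht := h.trace_eq h2 hϖ
  have h1 := congrFun (congrFun h.left 0) 0
  rw [Matrix.trace_fin_two] at ht
  simp only [Matrix.mul_apply, Fin.sum_univ_two, Matrix.sub_apply, Matrix.smul_apply, smul_eq_mul,
    Matrix.one_apply_eq, mul_one] at h1
  rw [Matrix.det_fin_two]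
  linear_combination -h1 + W 0 0 * ht

/-- Over a local domain in which `X² - tX + n` splits with distinct residual roots, every pair is
conjugate to a diagonal one. -/
theorem exists_conj_diagonal [IsLocalRing R] (h2 : (2 : R) ≠ 0) (hϖ : ϖ ≠ 0)
    (h : IsQuaternionPair t n ϖ W J) {α : R} (hα : α ^ 2 - t * α + n = 0)
    (hδ : IsUnit (2 * α - t)) :
    ∃ (g : GL (Fin 2) R) (a b : R), a * b = ϖ ∧
      (g : Matrix (Fin 2) (Fin 2) R) * W = !![α, 0; 0, t - α] * g ∧
      (g : Matrix (Fin 2) (Fin 2) R) * J = !![0, a; b, 0] * g := by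
  have ht := h.trace_eq h2 hϖ
  have hn := h.det_eq h2 hϖ
  rw [Matrix.trace_fin_two] at ht
  rw [Matrix.det_fin_two] at hn
  set p := W 0 0
  set q := W 0 1
  set r := W 1 0
  set s := W 1 1
  have hW : W = !![p, q; r, s] := Matrix.eta_fin_two W
  obtain ⟨M, hM, hWM⟩ : ∃ M : Matrix (Fin 2) (Fin 2) R, IsUnit M.det ∧
      W * M = M * !![α, 0; 0, t - α] := by
    -- Columns of `W - (t - α)` are eigenvectors for `α`. Its two diagonal entries add up to the
    -- unit `2α - t`, so one of them is a unit and yields an invertible eigenbasis.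
    have hsum : IsUnit ((p - (t - α)) + (s - (t - α))) := by
      convert hδ using 1; linear_combination ht
    rcases IsLocalRing.isUnit_or_isUnit_of_isUnit_add hsum with hp | hs
    · refine ⟨!![p - (t - α), -q; r, p - (t - α)], ?_, ?_⟩
      · have e : !![p - (t - α), -q; r, p - (t - α)].det = (p - (t - α)) * (2 * α - t) := by
          rw [Matrix.det_fin_two_of]
          grind
        rw [e]
        exact hp.mul hδ
      · rw [hW, Matrix.mul_fin_two, Matrix.mul_fin_two]
        ext i j
        fin_cases i <;> fin_cases j <;> simp <;> grind
    · refine ⟨!![q, s - (t - α); s - (t - α), -r], ?_, ?_⟩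
      · have e : !![q, s - (t - α); s - (t - α), -r].det = -((s - (t - α)) * (2 * α - t)) := by
          rw [Matrix.det_fin_two_of]
          grind
        rw [e]
        exact (hs.mul hδ).neg
      · rw [hW, Matrix.mul_fin_two, Matrix.mul_fin_two]
        ext i j
        fin_cases i <;> fin_cases j <;> simp <;> grind
  set X := M⁻¹ * J * M with hX
  have hMM : M⁻¹ * M = 1 := Matrix.nonsing_inv_mul M hM
  have hMM' : M * M⁻¹ = 1 := Matrix.mul_nonsing_inv M hM
  have hdiag : M⁻¹ * W * M = !![α, 0; 0, t - α] := by
    rw [mul_assoc, hWM, ← mul_assoc, hMM, one_mul]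
  have hconj : ∀ Y Z : Matrix (Fin 2) (Fin 2) R, M⁻¹ * (Y * Z) * M = M⁻¹ * Y * M * (M⁻¹ * Z * M) := by
    intro Y Z
    rw [mul_assoc (M⁻¹ * Y), ← mul_assoc M, ← mul_assoc M, hMM', one_mul]
    simp only [mul_assoc]
  have hXD : X * !![α, 0; 0, t - α] = t • X - !![α, 0; 0, t - α] * X := by
    rw [hX, ← hdiag, ← hconj, ← hconj, h.mul]
    simp [mul_sub, sub_mul]
  have hXX : X * X = ϖ • (1 : Matrix (Fin 2) (Fin 2) R) := by
    rw [hX, ← hconj, h.right]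
    simp [hMM]
  have hXe : X = !![0, X 0 1; X 1 0, 0] := by
    have h00 := congrFun (congrFun hXD 0) 0
    have h11 := congrFun (congrFun hXD 1) 1
    simp [Matrix.mul_apply, Matrix.vecMul, dotProduct, Fin.sum_univ_two] at h00 h11
    have e00 : X 0 0 * (2 * α - t) = 0 := by linear_combination h00
    have e11 : X 1 1 * (2 * α - t) = 0 := by linear_combination -h11
    have z00 : X 0 0 = 0 := by simpa [hδ.ne_zero] using e00
    have z11 : X 1 1 = 0 := by simpa [hδ.ne_zero] using e11
    rw [Matrix.eta_fin_two X, z00, z11]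
    rfl
  refine ⟨(Matrix.GeneralLinearGroup.mk'' M hM)⁻¹, X 0 1, X 1 0, ?_, ?_, ?_⟩
  · have := congrFun (congrFun hXX 0) 0
    rw [hXe] at this
    simpa [Matrix.mul_apply, Fin.sum_univ_two] using this
  · have e : (((Matrix.GeneralLinearGroup.mk'' M hM)⁻¹ : GL (Fin 2) R) :
        Matrix (Fin 2) (Fin 2) R) = M⁻¹ := by
      rw [Matrix.coe_units_inv]; rfl
    rw [e, ← hdiag, mul_assoc _ M, hMM', mul_one]
  · have e : (((Matrix.GeneralLinearGroup.mk'' M hM)⁻¹ : GL (Fin 2) R) :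
        Matrix (Fin 2) (Fin 2) R) = M⁻¹ := by
      rw [Matrix.coe_units_inv]; rfl
    rw [e, ← hXe, hX, mul_assoc _ M, hMM', mul_one]

end IsQuaternionPair

open Matrix in
/-- A nonzero intertwiner of matrices annihilated by a quadratic polynomial without roots is
invertible. -/
theorem Matrix.det_ne_zero_of_intertwines {F : Type*} [Field F] {t n : F}
    (hroot : ∀ r : F, r ^ 2 - t * r + n ≠ 0) {W W' x : Matrix (Fin 2) (Fin 2) F}
    (hW : W * W = t • W - n • (1 : Matrix (Fin 2) (Fin 2) F)) (hx : x * W = W' * x) (hx0 : x ≠ 0) :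
    x.det ≠ 0 := by
  intro hdet
  obtain ⟨v, hv0, hv⟩ := Matrix.exists_mulVec_eq_zero_iff.2 hdet
  -- The kernel of `x` is stable under `W`. Either `v` and `Wv` span and `x = 0`, or `v` is an
  -- eigenvector and its eigenvalue is a root.
  have hv' : x *ᵥ (W *ᵥ v) = 0 := by
    rw [mulVec_mulVec, hx, ← mulVec_mulVec, hv, mulVec_zero]
  set w := W *ᵥ v with hw
  have hM : x * !![v 0, w 0; v 1, w 1] = 0 := by
    have a0 := congrFun hv 0
    have a1 := congrFun hv 1
    have b0 := congrFun hv' 0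
    have b1 := congrFun hv' 1
    simp only [mulVec, dotProduct, Fin.sum_univ_two, Pi.zero_apply] at a0 a1 b0 b1
    ext i j
    fin_cases i <;> fin_cases j <;> simpa [mul_apply, Fin.sum_univ_two]
  have hMdet : (!![v 0, w 0; v 1, w 1] : Matrix (Fin 2) (Fin 2) F).det = 0 := by
    by_contra h0
    refine hx0 ?_
    have := congrArg (· * (!![v 0, w 0; v 1, w 1] : Matrix (Fin 2) (Fin 2) F)⁻¹) hM
    simpa only [mul_assoc, Matrix.mul_nonsing_inv _ (isUnit_iff_ne_zero.2 h0), mul_one,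
      zero_mul] using this
  obtain ⟨c, hc0, hc⟩ := Matrix.exists_mulVec_eq_zero_iff.2 hMdet
  have hc' : c 0 • v + c 1 • w = 0 := by
    have a0 := congrFun hc 0
    have a1 := congrFun hc 1
    simp only [mulVec, dotProduct, Fin.sum_univ_two, Pi.zero_apply] at a0 a1
    ext i
    fin_cases i
    · simpa [mul_comm] using a0
    · simpa [mul_comm] using a1
  have hc1 : c 1 ≠ 0 := by
    intro h1
    rw [h1, zero_smul, add_zero] at hc'
    rcases smul_eq_zero.1 hc' with h0 | h0
    · exact hc0 (by ext i; fin_cases i <;> simp [h0, h1])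
    · exact hv0 h0
  have hlam : w = (-(c 0 / c 1)) • v := by
    have : c 1 • w = c 1 • (-(c 0 / c 1)) • v := by
      rw [smul_smul, show c 1 * -(c 0 / c 1) = - c 0 by field_simp, neg_smul]
      exact eq_neg_of_add_eq_zero_right hc'
    exact smul_right_injective _ hc1 this
  set l := -(c 0 / c 1)
  have h1 : W *ᵥ w = (l * l) • v := by rw [hlam, mulVec_smul, ← hw, hlam, smul_smul]
  have h2 : W *ᵥ w = t • w - n • v := by
    rw [hw, mulVec_mulVec, hW, sub_mulVec, smul_mulVec, smul_mulVec, one_mulVec]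
  rw [h1, hlam] at h2
  have h3 : (l ^ 2 - t * l + n) • v = 0 := by
    have := sub_eq_zero.2 h2
    rw [← this]
    module
  exact hv0 ((smul_eq_zero.1 h3).resolve_left (hroot l))

end QuaternionPairs

/-! ### The ring of integers as a valuation ring, and the value group. -/

section IntegerRings

variable {K : Type*} [Field K] [ValuativeRel K] [TopologicalSpace K] [IsNonarchimedeanLocalField K]
  {E : Type*} [Field E] [Algebra K E] [Algebra.IsAlgebraic K E]

namespace IntegerRing

theorem absVal_le_one (x : IntegerRing K E) : absVal K E (x : E) ≤ 1 :=
  absVal_le_one_iff.2 x.2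

theorem mem_of_absVal_le_one {x : E} (h : absVal K E x ≤ 1) : x ∈ IntegerRing K E :=
  absVal_le_one_iff.1 h

theorem dvd_of_absVal_le {x y : IntegerRing K E} (h : absVal K E (y : E) ≤ absVal K E (x : E)) :
    x ∣ y := by
  rcases eq_or_ne (x : E) 0 with hx | hx
  · rw [hx, map_zero] at h
    have : y = 0 := Subtype.ext ((absVal K E).eq_zero.1 (h.antisymm ((absVal K E).nonneg _)))
    rw [this]
    exact dvd_zero _
  · refine ⟨⟨y / x, mem_of_absVal_le_one ?_⟩, Subtype.ext (mul_div_cancel₀ _ hx).symm⟩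
    rw [map_div₀]
    exact div_le_one_of_le₀ h ((absVal K E).nonneg _)

theorem isUnit_iff {x : IntegerRing K E} : IsUnit x ↔ absVal K E (x : E) = 1 := by
  refine ⟨fun h => ?_, fun h => ?_⟩
  · obtain ⟨y, hy⟩ := h.exists_right_inv
    have h1 : absVal K E (x : E) * absVal K E (y : E) = 1 := by
      rw [← map_mul, ← map_one (absVal K E)]
      exact congrArg _ (congrArg Subtype.val hy)
    have hx := absVal_le_one x
    have hy := absVal_le_one y
    nlinarith [(absVal K E).nonneg (x : E), (absVal K E).nonneg (y : E)]
  · refine isUnit_of_dvd_one (dvd_of_absVal_le ?_)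
    rw [h]
    exact (map_one (absVal K E)).le

instance : IsLocalRing (IntegerRing K E) := by
  refine IsLocalRing.of_nonunits_add fun a b ha hb => ?_
  rw [mem_nonunits_iff, isUnit_iff] at ha hb ⊢
  exact (absVal_add_lt (lt_of_le_of_ne (absVal_le_one a) ha)
    (lt_of_le_of_ne (absVal_le_one b) hb)).ne

theorem residue_eq_zero_iff {x : IntegerRing K E} :
    IsLocalRing.residue (IntegerRing K E) x = 0 ↔ absVal K E (x : E) < 1 := by
  rw [IsLocalRing.residue_eq_zero_iff, IsLocalRing.mem_maximalIdeal, mem_nonunits_iff, isUnit_iff,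
    lt_iff_le_and_ne]
  exact ⟨fun h => ⟨absVal_le_one x, h⟩, fun h => h.2⟩

theorem associated_iff {x y : IntegerRing K E} :
    Associated x y ↔ absVal K E (x : E) = absVal K E (y : E) := by
  refine ⟨?_, fun h => ?_⟩
  · rintro ⟨u, rfl⟩
    have := isUnit_iff.1 u.isUnit
    push_cast
    rw [map_mul, this, mul_one]
  · exact associated_of_dvd_dvd (dvd_of_absVal_le h.ge) (dvd_of_absVal_le h.le)

end IntegerRing

/-- The subgroup `Kˣ 𝒪_Eˣ` consists of the elements whose absolute value is attained on `K`. -/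
theorem mem_sup_range_iff {x : Eˣ} :
    x ∈ (Units.map (algebraMap K E : K →* E)).range ⊔
      (Units.map ((IntegerRing K E).val : IntegerRing K E →* E)).range ↔
    ∃ k : K, absVal K E (x : E) = absVal K K k := by
  rw [Subgroup.mem_sup]
  refine ⟨?_, ?_⟩
  · rintro ⟨_, ⟨c, rfl⟩, _, ⟨u, rfl⟩, rfl⟩
    refine ⟨c, ?_⟩
    have hu := IntegerRing.isUnit_iff.1 u.isUnit
    change absVal K E (algebraMap K E (c : K) * ((u : IntegerRing K E) : E)) = _
    rw [map_mul, hu, mul_one, absVal_algebraMap]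
  · rintro ⟨k, hk⟩
    have hk0 : k ≠ 0 := by
      rintro rfl
      rw [map_zero] at hk
      exact x.ne_zero ((absVal K E).eq_zero.1 hk)
    have hkE : algebraMap K E k ≠ 0 := by simpa using hk0
    have h1 : absVal K E ((x : E) / algebraMap K E k) = 1 := by
      rw [map_div₀, absVal_algebraMap, hk, div_self ((absVal K K).pos hk0).ne']
    have hu : IsUnit (⟨(x : E) / algebraMap K E k, IntegerRing.mem_of_absVal_le_one h1.le⟩ :
      IntegerRing K E) := IntegerRing.isUnit_iff.2 h1
    refine ⟨_, ⟨Units.mk0 k hk0, rfl⟩, _, ⟨hu.unit, rfl⟩, Units.ext ?_⟩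
    change algebraMap K E k * ((x : E) / algebraMap K E k) = x
    field_simp

/-- The value group of `K(√Δ)` is the one of `K`, so `Δ` is, up to squares, the discriminant of a
residually irreducible polynomial. -/
theorem IsUnramifiedUnit.exists_disc_eq (h2 : (2 : K) ≠ 0) {Δ : 𝒪[K]} (h : IsUnramifiedUnit Δ) :
    ∃ t n s : K, IsResiduallyIrreducible K t n ∧ t ^ 2 - 4 * n = (Δ : K) * s ^ 2 := by
  classical
  set F := (Polynomial.X ^ 2 - Polynomial.C (Δ : K) : Polynomial K).SplittingField
  obtain ⟨θ, hθ⟩ : ∃ θ : F, θ ^ 2 = algebraMap K F (Δ : K) := by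
    have hs := Polynomial.SplittingField.splits
      (Polynomial.X ^ 2 - Polynomial.C (Δ : K) : Polynomial K)
    have hd : (Polynomial.X ^ 2 - Polynomial.C (Δ : K) : Polynomial K).degree = 2 := by
      compute_degree!
    obtain ⟨θ, hθ⟩ := hs.exists_eval_eq_zero (by rw [Polynomial.degree_map, hd]; decide)
    refine ⟨θ, ?_⟩
    simpa [sub_eq_zero] using hθ
  refine exists_isResiduallyIrreducible_of_unramified h2 h.not_isSquare hθ fun p q => ?_
  rcases eq_or_ne (algebraMap K F p + algebraMap K F q * θ) 0 with h0 | h0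
  · exact ⟨0, by rw [h0, map_zero, map_zero]⟩
  · have hr := h.unramified
    rw [ramificationIndex, ENat.card_eq_one_iff_unique] at hr
    have hmem := (QuotientGroup.eq_one_iff (Units.mk0 _ h0)).1 (@Subsingleton.elim _ hr.some.instSubsingleton
      (QuotientGroup.mk (s := (Units.map (algebraMap K F : K →* F)).range ⊔
        (Units.map ((IntegerRing K F).val : IntegerRing K F →* F)).range) (Units.mk0 _ h0)) 1)
    exact mem_sup_range_iff.1 hmem

end IntegerRings

/-! ### Representations as matrix pairs. -/

section Presentations

variable {K A : Type*} [Field K] [ValuativeRel K] [Ring A] [Algebra K A] {D : Subalgebra 𝒪[K] A}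
  {t n ϖ : 𝒪[K]} (e : ℍ[𝒪[K], -n, t, ϖ] ≃ₐ[𝒪[K]] D) {E : Type*} [Field E] [Algebra K E]

namespace IntegralRep

theorem isQuaternionPair (ρ : IntegralRep D E) :
    IsQuaternionPair t n ϖ (ρ (e (QuaternionAlgebra.Basis.self _).i))
      (ρ (e (QuaternionAlgebra.Basis.self _).j)) := by
  let q := QuaternionAlgebra.Basis.self 𝒪[K] (c₁ := -n) (c₂ := t) (c₃ := ϖ)
  have h : IsQuaternionPair t n ϖ q.i q.j := by
    refine ⟨?_, q.j_mul_j, ?_⟩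
    · rw [q.i_mul_i]; module
    · rw [q.j_mul_i, q.i_mul_j]
  have := h.map (S := 𝒪[K]) (ρ.comp (e : ℍ[𝒪[K], -n, t, ϖ] →ₐ[𝒪[K]] D))
  exact this

theorem exists_of_isQuaternionPair {W J : Matrix (Fin 2) (Fin 2) (IntegerRing K E)}
    (h : IsQuaternionPair t n ϖ W J) : ∃ ρ : IntegralRep D E,
      ρ (e (QuaternionAlgebra.Basis.self _).i) = W ∧
      ρ (e (QuaternionAlgebra.Basis.self _).j) = J := by
  let B : QuaternionAlgebra.Basis (Matrix (Fin 2) (Fin 2) (IntegerRing K E)) (-n) t ϖ :=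
    { i := W
      j := J
      k := W * J
      i_mul_i := by rw [h.left]; module
      j_mul_j := h.right
      i_mul_j := rfl
      j_mul_i := h.mul }
  refine ⟨B.liftHom.comp e.symm, ?_, ?_⟩
  · rw [AlgHom.comp_apply]
    simp [QuaternionAlgebra.Basis.lift, B]
  · rw [AlgHom.comp_apply]
    simp [QuaternionAlgebra.Basis.lift, B]

-- An algebra homomorphism out of the quaternion order is determined by the images of `i` and `j`,
-- so conjugacy is tested there.
include e in
theorem isConjugate_iff {ρ ρ' : IntegralRep D E} : ρ.IsConjugate ρ' ↔
    ∃ g : GL (Fin 2) (IntegerRing K E),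
      (g : Matrix (Fin 2) (Fin 2) (IntegerRing K E)) *
        ρ (e (QuaternionAlgebra.Basis.self _).i) =
        ρ' (e (QuaternionAlgebra.Basis.self _).i) * g ∧
      (g : Matrix (Fin 2) (Fin 2) (IntegerRing K E)) *
        ρ (e (QuaternionAlgebra.Basis.self _).j) =
        ρ' (e (QuaternionAlgebra.Basis.self _).j) * g := by
  refine ⟨fun ⟨g, hg⟩ => ⟨g, ?_, ?_⟩, fun ⟨g, hi, hj⟩ => ⟨g, fun x => ?_⟩⟩
  · rw [hg, mul_assoc, Units.inv_mul, mul_one]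
  · rw [hg, mul_assoc, Units.inv_mul, mul_one]
  · have hi' := (Units.eq_mul_inv_iff_mul_eq g).2 hi.symm
    have hj' := (Units.eq_mul_inv_iff_mul_eq g).2 hj.symm
    let c : Matrix (Fin 2) (Fin 2) (IntegerRing K E) →ₐ[𝒪[K]]
        Matrix (Fin 2) (Fin 2) (IntegerRing K E) :=
      { toFun := fun M => (g : Matrix (Fin 2) (Fin 2) (IntegerRing K E)) * M *
          ((g⁻¹ : GL (Fin 2) (IntegerRing K E)) : Matrix (Fin 2) (Fin 2) (IntegerRing K E))
        map_one' := by rw [mul_one, Units.mul_inv]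
        map_mul' := fun M N => by
          simp only [mul_assoc, Units.inv_mul_cancel_left]
        map_zero' := by simp
        map_add' := fun M N => by rw [mul_add, add_mul]
        commutes' := fun r => by
          rw [← Algebra.commutes, mul_assoc, Units.mul_inv, mul_one] }
    have hc : ρ'.comp (e : ℍ[𝒪[K], -n, t, ϖ] →ₐ[𝒪[K]] D) =
        (c.comp ρ).comp (e : ℍ[𝒪[K], -n, t, ϖ] →ₐ[𝒪[K]] D) :=
      QuaternionAlgebra.hom_ext hi' hj'
    have := DFunLike.congr_fun hc (e.symm x)
    simpa [c] using this

end IntegralRep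

end Presentations

/-! ### Square roots and quadratic extensions. -/

section Squares

theorem IsSquare.of_mul_eq_sq {F : Type*} [Field F] {x y z : F} (hx : x ≠ 0) (h : x * y = z ^ 2)
    (hxs : IsSquare x) : IsSquare y := by
  obtain ⟨w, rfl⟩ := hxs
  have hw : w ≠ 0 := fun h0 => hx (by rw [h0, mul_zero])
  exact ⟨z / w, by field_simp; linear_combination h⟩

theorem exists_root_iff_isSquare_disc {F : Type*} [Field F] (h2 : (2 : F) ≠ 0) {t n : F} :
    (∃ r : F, r ^ 2 - t * r + n = 0) ↔ IsSquare (t ^ 2 - 4 * n) := by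
  refine ⟨fun ⟨r, hr⟩ => ⟨2 * r - t, by linear_combination -4 * hr⟩, fun ⟨s, hs⟩ =>
    ⟨(t + s) / 2, ?_⟩⟩
  field_simp
  linear_combination -hs

theorem exists_sqrt_of_finrank_eq_two {F M : Type*} [Field F] [Field M] [Algebra F M]
    (h2 : (2 : F) ≠ 0) (h : Module.finrank F M = 2) :
    ∃ (m : F) (θ : M), ¬ IsSquare m ∧ θ ^ 2 = algebraMap F M m := by
  have : FiniteDimensional F M := FiniteDimensional.of_finrank_pos (by omega)
  obtain ⟨x, hx⟩ : ∃ x : M, x ∉ (algebraMap F M).range := by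
    by_contra! hall
    have hb : (⊥ : Subalgebra F M) = ⊤ := by
      rw [eq_top_iff]
      intro x _
      exact hall x
    have := Subalgebra.bot_eq_top_iff_finrank_eq_one.1 hb
    omega
  have hint : IsIntegral F x := IsIntegral.of_finite F x
  have hdeg : (minpoly F x).natDegree = 2 := by
    have h1 := minpoly.degree_dvd hint
    rw [h] at h1
    rcases (Nat.dvd_prime Nat.prime_two).1 h1 with h3 | h3
    · exact absurd (minpoly.natDegree_eq_one_iff.1 h3) hx
    · exact h3
  have hp := (minpoly.monic hint).as_sum
  rw [hdeg] at hp
  have hx0 := minpoly.aeval F x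
  rw [hp] at hx0
  set b := (minpoly F x).coeff 1
  set c := (minpoly F x).coeff 0
  simp only [Finset.sum_range_succ, Finset.sum_range_zero, map_add, map_mul, map_pow,
    Polynomial.aeval_X, Polynomial.aeval_C, pow_zero, pow_one, mul_one, zero_add] at hx0
  have h2M : (2 : M) ≠ 0 := by
    rw [← map_ofNat (algebraMap F M) 2]; simpa using h2
  refine ⟨b ^ 2 - 4 * c, 2 * x + algebraMap F M b, fun ⟨s, hs⟩ => hx ?_, ?_⟩
  · have h3 : (2 * x + algebraMap F M b - algebraMap F M s) *
        (2 * x + algebraMap F M b + algebraMap F M s) = 0 := by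
      have := congrArg (algebraMap F M) hs
      simp only [map_sub, map_mul, map_pow, map_ofNat] at this
      linear_combination 4 * hx0 + this
    rcases mul_eq_zero.1 h3 with h4 | h4
    · refine ⟨(s - b) / 2, ?_⟩
      rw [map_div₀, map_sub, map_ofNat, div_eq_iff h2M]
      linear_combination -h4
    · refine ⟨(-s - b) / 2, ?_⟩
      rw [map_div₀, map_sub, map_neg, map_ofNat, div_eq_iff h2M]
      linear_combination -h4
  · simp only [map_sub, map_mul, map_pow, map_ofNat]
    linear_combination 4 * hx0

end Squares

/-! ### Extensions without a root: existence and uniqueness of representations. -/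

section InertCase

variable {K : Type*} [Field K] [ValuativeRel K] [TopologicalSpace K] [IsNonarchimedeanLocalField K]
  {E : Type*} [Field E] [Algebra K E] [Algebra.IsAlgebraic K E]

theorem two_ne_zero_of_algebra {K : Type*} [Field K] (h2 : (2 : K) ≠ 0) (E : Type*) [Field E]
    [Algebra K E] : (2 : E) ≠ 0 := by
  rw [← map_ofNat (algebraMap K E) 2]; simpa using h2

omit [Algebra.IsAlgebraic K E] in
/-- All residually irreducible quadratic polynomials have roots in the same extensions, namely
those containing the square root of an unramified unit. -/
theorem IsResiduallyIrreducible.exists_root_iff_isSquare (h2 : (2 : K) ≠ 0) {t n t' n' c s : K}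
    (h : IsResiduallyIrreducible K t n) (h' : IsResiduallyIrreducible K t' n')
    (hc : t' ^ 2 - 4 * n' = c * s ^ 2) :
    (∃ r : E, r ^ 2 - algebraMap K E t * r + algebraMap K E n = 0) ↔
      IsSquare (algebraMap K E c) := by
  have hd0 : t ^ 2 - 4 * n ≠ 0 := (absVal K K).pos_iff.1 (h.absVal_disc ▸ one_pos)
  have hd0' : t' ^ 2 - 4 * n' ≠ 0 := (absVal K K).pos_iff.1 (h'.absVal_disc ▸ one_pos)
  have hc0 : c ≠ 0 := by
    rintro rfl
    exact hd0' (by rw [hc, zero_mul])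
  have hs0 : s ≠ 0 := by
    rintro rfl
    exact hd0' (by rw [hc]; ring)
  obtain ⟨r, hr⟩ := h.exists_sq_eq_disc_mul h'
  have hcd : algebraMap K E (t ^ 2 - 4 * n) * algebraMap K E c = (algebraMap K E (r / s)) ^ 2 := by
    rw [← map_mul, ← map_pow]
    congr 1
    rw [hc] at hr
    field_simp
    linear_combination hr
  rw [exists_root_iff_isSquare_disc (two_ne_zero_of_algebra h2 E)]
  have e : (algebraMap K E t) ^ 2 - 4 * algebraMap K E n = algebraMap K E (t ^ 2 - 4 * n) := by
    simp only [map_sub, map_mul, map_pow, map_ofNat]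
  rw [e]
  exact ⟨IsSquare.of_mul_eq_sq ((map_ne_zero (algebraMap K E)).2 hd0) hcd,
    IsSquare.of_mul_eq_sq (by simpa using hc0) (by rw [mul_comm]; exact hcd)⟩

/-- A quadratic subextension with the value group of `K` would be generated by a root of a
residually irreducible polynomial, and would contain a root of `X² - tX + n`. Hence it is ramified.
-/
theorem exists_normForm_eq_uniformizer_of_no_root (h2 : (2 : K) ≠ 0) {t n ϖ : K}
    (h : IsResiduallyIrreducible K t n) (hϖ : IsUniformizer ϖ)
    (hE : ∃ F : IntermediateField K E, Module.finrank K F = 2)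
    (hno : ∀ r : E, r ^ 2 - algebraMap K E t * r + algebraMap K E n ≠ 0) :
    ∃ a b : E, a ^ 2 + algebraMap K E t * a * b + algebraMap K E n * b ^ 2 =
      algebraMap K E ϖ := by
  obtain ⟨F, hF⟩ := hE
  obtain ⟨m, θ, hm, hθ⟩ := exists_sqrt_of_finrank_eq_two h2 hF
  have hθE : (θ : E) ^ 2 = algebraMap K E m := congrArg Subtype.val hθ
  by_cases hU : ∀ p q : K, ∃ k : K,
      absVal K E (algebraMap K E p + algebraMap K E q * (θ : E)) = absVal K K k
  · obtain ⟨t', n', s, h', hs⟩ := exists_isResiduallyIrreducible_of_unramified h2 hm hθE hU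
    obtain ⟨r, hr⟩ := (h.exists_root_iff_isSquare (E := E) h2 h' hs).2
      ⟨θ, by rw [← hθE, sq]⟩
    exact absurd hr (hno r)
  · push Not at hU
    obtain ⟨p, q, hpq⟩ := hU
    exact exists_normForm_eq_uniformizer hm hθE hpq hϖ h

variable {A : Type*} [Ring A] [Algebra K A] {D : Subalgebra 𝒪[K] A} {t n ϖ : 𝒪[K]}
  (e : ℍ[𝒪[K], -n, t, ϖ] ≃ₐ[𝒪[K]] D)

namespace IntegralRep

-- The solution of the norm equation is integral because the norm form stays anisotropic over `E`:
-- `max |a| |b|` squared equals `|ϖ|`.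
include e in
theorem nonempty_of_no_root (h2 : (2 : K) ≠ 0) (h : IsResiduallyIrreducible K (t : K) (n : K))
    (hϖ : IsUniformizer (ϖ : K)) (hE : ∃ F : IntermediateField K E, Module.finrank K F = 2)
    (hno : ∀ r : E, r ^ 2 - algebraMap K E (t : K) * r + algebraMap K E (n : K) ≠ 0) :
    Nonempty (IntegralRep D E) := by
  obtain ⟨a, b, hab⟩ := exists_normForm_eq_uniformizer_of_no_root h2 h hϖ hE hno
  have hN := (h.of_no_root hno).absVal_normForm a b
  rw [hab, absVal_algebraMap] at hN
  have hle : max (absVal K E a) (absVal K E b) ≤ 1 := by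
    refine (pow_le_one_iff_of_nonneg (((absVal K E).nonneg _).trans (le_max_left _ _))
      two_ne_zero).1 ?_
    rw [← hN]
    exact hϖ.2.1.le
  let a' : IntegerRing K E := ⟨a, IntegerRing.mem_of_absVal_le_one ((le_max_left _ _).trans hle)⟩
  let b' : IntegerRing K E := ⟨b, IntegerRing.mem_of_absVal_le_one ((le_max_right _ _).trans hle)⟩
  have hab' : a' ^ 2 + algebraMap 𝒪[K] (IntegerRing K E) t * a' * b' +
      algebraMap 𝒪[K] (IntegerRing K E) n * b' ^ 2 = algebraMap 𝒪[K] (IntegerRing K E) ϖ :=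
    Subtype.ext hab
  have hp := IsQuaternionPair.companion hab'
  have hp' : IsQuaternionPair t n ϖ _ _ :=
    { left := by have := hp.left; simp only [algebraMap_smul] at this; exact this
      right := by have := hp.right; simp only [algebraMap_smul] at this; exact this
      mul := by have := hp.mul; simp only [algebraMap_smul] at this; exact this }
  obtain ⟨ρ, -, -⟩ := exists_of_isQuaternionPair e hp'
  exact ⟨ρ⟩

/-- Scaling a nonzero matrix to one with integral entries, not all in the maximal ideal. -/
theorem exists_primitive_scaling (x : Matrix (Fin 2) (Fin 2) E) (hx : x ≠ 0) :
    ∃ (c : E) (y : Matrix (Fin 2) (Fin 2) (IntegerRing K E)), c ≠ 0 ∧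
      y.map (fun z => (z : E)) = c • x ∧ ∃ i j, IsUnit (y i j) := by
  obtain ⟨⟨i, j⟩, -, hij⟩ := Finset.exists_max_image (Finset.univ : Finset (Fin 2 × Fin 2))
    (fun p => absVal K E (x p.1 p.2)) ⟨(0, 0), Finset.mem_univ _⟩
  have hne : x i j ≠ 0 := by
    intro h0
    refine hx (Matrix.ext fun k l => ?_)
    have := hij (k, l) (Finset.mem_univ _)
    rw [h0, map_zero] at this
    exact (absVal K E).eq_zero.1 (this.antisymm ((absVal K E).nonneg _))
  refine ⟨(x i j)⁻¹, fun k l => ⟨(x i j)⁻¹ * x k l, IntegerRing.mem_of_absVal_le_one ?_⟩,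
    inv_ne_zero hne, ?_, i, j, ?_⟩
  · rw [map_mul, map_inv₀, inv_mul_le_one₀ ((absVal K E).pos hne)]
    exact hij (k, l) (Finset.mem_univ _)
  · ext k l
    rfl
  · rw [IntegerRing.isUnit_iff]
    change absVal K E ((x i j)⁻¹ * x i j) = 1
    rw [inv_mul_cancel₀ hne, map_one]

include e in
/-- Over an extension in which `X² - tX + n` is irreducible, all representations are conjugate. -/
theorem isConjugate_of_no_root (h2 : (2 : K) ≠ 0)
    (h : IsResiduallyIrreducible K (t : K) (n : K)) (hϖ : IsUniformizer (ϖ : K))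
    (hno : ∀ r : E, r ^ 2 - algebraMap K E (t : K) * r + algebraMap K E (n : K) ≠ 0)
    (ρ ρ' : IntegralRep D E) : ρ.IsConjugate ρ' := by
  rw [isConjugate_iff e]
  have hq := ρ.isQuaternionPair e
  have hq' := ρ'.isQuaternionPair e
  set W := ρ (e (QuaternionAlgebra.Basis.self _).i)
  set J := ρ (e (QuaternionAlgebra.Basis.self _).j)
  set W' := ρ' (e (QuaternionAlgebra.Basis.self _).i)
  set J' := ρ' (e (QuaternionAlgebra.Basis.self _).j)
  let φ : Matrix (Fin 2) (Fin 2) (IntegerRing K E) →ₐ[𝒪[K]] Matrix (Fin 2) (Fin 2) E :=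
    (IntegerRing K E).val.mapMatrix
  have hφ : Function.Injective φ := fun M N hMN => by
    ext i j
    exact congrFun (congrFun hMN i) j
  have hd : (algebraMap 𝒪[K] E t) ^ 2 - 4 * algebraMap 𝒪[K] E n ≠ 0 := by
    have hd0 : (t : K) ^ 2 - 4 * n ≠ 0 := (absVal K K).pos_iff.1 (h.absVal_disc ▸ one_pos)
    have e : (algebraMap 𝒪[K] E t) ^ 2 - 4 * algebraMap 𝒪[K] E n =
        algebraMap K E ((t : K) ^ 2 - 4 * n) := by
      simp only [map_sub, map_mul, map_pow, map_ofNat]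
      rfl
    rw [e]
    exact (map_ne_zero (algebraMap K E)).2 hd0
  have hϖE : algebraMap 𝒪[K] E ϖ ≠ 0 := by
    change algebraMap K E (ϖ : K) ≠ 0
    simpa using hϖ.ne_zero
  obtain ⟨x, hx0, hxW, hxJ⟩ := IsQuaternionPair.exists_intertwiner (two_ne_zero_of_algebra h2 E)
    hd hϖE (hq.map (S := E) φ) (hq'.map (S := E) φ)
  obtain ⟨c, y, hc, hy, i, j, hij⟩ := exists_primitive_scaling (K := K) x hx0
  have hyφ : φ y = c • x := hy
  have hyW : y * W = W' * y := hφ (by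
    rw [map_mul, map_mul, hyφ, smul_mul_assoc, mul_smul_comm, hxW])
  have hyJ : y * J = J' * y := hφ (by
    rw [map_mul, map_mul, hyφ, smul_mul_assoc, mul_smul_comm, hxJ])
  have hE := h.of_no_root hno
  let π : IntegerRing K E →+* IsLocalRing.ResidueField (IntegerRing K E) := IsLocalRing.residue _
  let tE : IntegerRing K E := algebraMap 𝒪[K] _ t
  let nE : IntegerRing K E := algebraMap 𝒪[K] _ n
  -- Primitivity keeps `y` nonzero in the residue field, where the polynomial still has no root; so
  -- its determinant is a unit.
  have hdet : (π.mapMatrix y).det ≠ 0 := by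
    refine Matrix.det_ne_zero_of_intertwines (t := π tE) (n := π nE) ?_ (W := π.mapMatrix W)
      (W' := π.mapMatrix W') ?_ ?_ ?_
    · intro r
      obtain ⟨a, rfl⟩ := IsLocalRing.residue_surjective r
      rw [← map_pow, ← map_mul, ← map_sub, ← map_add, Ne, IntegerRing.residue_eq_zero_iff]
      exact (hE.absVal_eval a (IntegerRing.absVal_le_one a)).not_lt
    · have hl := hq.left
      rw [← algebraMap_smul (IntegerRing K E) t, ← algebraMap_smul (IntegerRing K E) n] at hl
      have hsmul : ∀ (r : IntegerRing K E) (M : Matrix (Fin 2) (Fin 2) (IntegerRing K E)),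
          π.mapMatrix (r • M) = π r • π.mapMatrix M := fun r M => by
        ext k l
        exact map_mul π r (M k l)
      rw [← map_mul, hl, map_sub, hsmul, hsmul, map_one]
    · rw [← map_mul, hyW, map_mul]
    · intro h0
      have := congrFun (congrFun h0 i) j
      exact (hij.map π).ne_zero this
  have hdetu : IsUnit y.det := by
    rw [← RingHom.map_det] at hdet
    exact (IsLocalRing.residue_ne_zero_iff_isUnit _).1 hdet
  exact ⟨Matrix.GeneralLinearGroup.mk'' y hdetu, hyW, hyJ⟩

end IntegralRep

end InertCase

/-! ### Extensions with a root: diagonal forms. -/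

section SplitCase

variable {K : Type*} [Field K] [ValuativeRel K] [TopologicalSpace K] [IsNonarchimedeanLocalField K]
  {E : Type*} [Field E] [Algebra K E] [Algebra.IsAlgebraic K E]
  {A : Type*} [Ring A] [Algebra K A] {D : Subalgebra 𝒪[K] A} {t n ϖ : 𝒪[K]}
  (e : ℍ[𝒪[K], -n, t, ϖ] ≃ₐ[𝒪[K]] D)

namespace IntegralRep

/-- The representation `ρ` is conjugate to the one sending the generators of `D` to the matrices
`diag(α, t - α)` and `antidiag(a, b)`. -/
def HasDiagonalForm (α : IntegerRing K E) (ρ : IntegralRep D E) (a b : IntegerRing K E) : Prop :=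
  ∃ g : GL (Fin 2) (IntegerRing K E),
    (g : Matrix (Fin 2) (Fin 2) (IntegerRing K E)) * ρ (e (QuaternionAlgebra.Basis.self _).i) =
      !![α, 0; 0, algebraMap 𝒪[K] (IntegerRing K E) t - α] * g ∧
    (g : Matrix (Fin 2) (Fin 2) (IntegerRing K E)) * ρ (e (QuaternionAlgebra.Basis.self _).j) =
      !![0, a; b, 0] * g

variable {α : IntegerRing K E} (h2 : (2 : K) ≠ 0)
  (h : IsResiduallyIrreducible K (t : K) (n : K)) (hϖ : IsUniformizer (ϖ : K))
  (hα : α ^ 2 - algebraMap 𝒪[K] (IntegerRing K E) t * α + algebraMap 𝒪[K] (IntegerRing K E) n = 0)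

include h hα in
theorem isUnit_two_mul_root_sub : IsUnit (2 * α - algebraMap 𝒪[K] (IntegerRing K E) t) := by
  rw [IntegerRing.isUnit_iff]
  apply absVal_eq_one_of_sq
  have e1 : ((2 * α - algebraMap 𝒪[K] (IntegerRing K E) t) ^ 2 : IntegerRing K E) =
      algebraMap 𝒪[K] (IntegerRing K E) (t ^ 2 - 4 * n) := by
    simp only [map_sub, map_mul, map_pow, map_ofNat]
    linear_combination 4 * hα
  have e2 : ((algebraMap 𝒪[K] (IntegerRing K E) (t ^ 2 - 4 * n) : IntegerRing K E) : E) =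
    algebraMap K E ((t : K) ^ 2 - 4 * n) := rfl
  change absVal K E (((2 * α - algebraMap 𝒪[K] (IntegerRing K E) t) ^ 2 : IntegerRing K E) : E) = 1
  rw [e1, e2, absVal_algebraMap, h.absVal_disc]

omit [Algebra.IsAlgebraic K E] in
include hϖ in
theorem algebraMap_uniformizer_ne_zero : algebraMap 𝒪[K] (IntegerRing K E) ϖ ≠ 0 := by
  intro h0
  have : algebraMap K E (ϖ : K) = 0 := congrArg Subtype.val h0
  exact hϖ.ne_zero (by simpa using this)

include h2 h hϖ hα in
theorem exists_hasDiagonalForm (ρ : IntegralRep D E) : ∃ a b : IntegerRing K E,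
    a * b = algebraMap 𝒪[K] (IntegerRing K E) ϖ ∧ ρ.HasDiagonalForm e α a b := by
  have hq := (ρ.isQuaternionPair e).map (S := IntegerRing K E) (AlgHom.id 𝒪[K] _)
  have h2R : (2 : IntegerRing K E) ≠ 0 := fun h0 =>
    two_ne_zero_of_algebra h2 E (congrArg Subtype.val h0)
  obtain ⟨g, a, b, hab, hW, hJ⟩ := hq.exists_conj_diagonal h2R
    (algebraMap_uniformizer_ne_zero hϖ) hα (isUnit_two_mul_root_sub h hα)
  exact ⟨a, b, hab, g, hW, hJ⟩

omit [TopologicalSpace K] [IsNonarchimedeanLocalField K] [Algebra.IsAlgebraic K E] in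
include hα in
theorem exists_of_diagonalForm {a b : IntegerRing K E}
    (hab : a * b = algebraMap 𝒪[K] (IntegerRing K E) ϖ) :
    ∃ ρ : IntegralRep D E, ρ.HasDiagonalForm e α a b := by
  have hp := IsQuaternionPair.diagonal hα hab
  have hp' : IsQuaternionPair t n ϖ _ _ :=
    { left := by have := hp.left; simp only [algebraMap_smul] at this; exact this
      right := by have := hp.right; simp only [algebraMap_smul] at this; exact this
      mul := by have := hp.mul; simp only [algebraMap_smul] at this; exact this }
  obtain ⟨ρ, hi, hj⟩ := exists_of_isQuaternionPair e hp'
  exact ⟨ρ, 1, by rw [hi, Units.val_one, one_mul, mul_one],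
    by rw [hj, Units.val_one, one_mul, mul_one]⟩

variable {e}

include h hϖ hα in
/-- Conjugacy classes correspond to divisors of `ϖ` up to units. -/
theorem HasDiagonalForm.isConjugate_iff {ρ ρ' : IntegralRep D E} {a b a' b' : IntegerRing K E}
    (hab : a * b = algebraMap 𝒪[K] (IntegerRing K E) ϖ)
    (hab' : a' * b' = algebraMap 𝒪[K] (IntegerRing K E) ϖ)
    (hρ : ρ.HasDiagonalForm e α a b) (hρ' : ρ'.HasDiagonalForm e α a' b') :
    ρ.IsConjugate ρ' ↔ Associated a a' := by
  obtain ⟨g, hW, hJ⟩ := hρ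
  obtain ⟨g', hW', hJ'⟩ := hρ'
  have hδ := isUnit_two_mul_root_sub h hα
  have hϖ0 := algebraMap_uniformizer_ne_zero (E := E) hϖ
  rw [IntegralRep.isConjugate_iff e]
  set W := ρ (e (QuaternionAlgebra.Basis.self _).i)
  set J := ρ (e (QuaternionAlgebra.Basis.self _).j)
  set W' := ρ' (e (QuaternionAlgebra.Basis.self _).i)
  set J' := ρ' (e (QuaternionAlgebra.Basis.self _).j)
  set T := algebraMap 𝒪[K] (IntegerRing K E) t
  constructor
  · rintro ⟨k, hkW, hkJ⟩
    have key : ∀ (X X' Y Y' : Matrix (Fin 2) (Fin 2) (IntegerRing K E)),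
        (g : Matrix (Fin 2) (Fin 2) (IntegerRing K E)) * X = Y * g →
        (g' : Matrix (Fin 2) (Fin 2) (IntegerRing K E)) * X' = Y' * g' →
        (k : Matrix (Fin 2) (Fin 2) (IntegerRing K E)) * X = X' * k →
        ((g' * k * g⁻¹ : GL (Fin 2) (IntegerRing K E)) :
          Matrix (Fin 2) (Fin 2) (IntegerRing K E)) * Y =
        Y' * ((g' * k * g⁻¹ : GL (Fin 2) (IntegerRing K E)) :
          Matrix (Fin 2) (Fin 2) (IntegerRing K E)) := by
      intro X X' Y Y' h1 h2 h3
      have h4 := (Units.eq_mul_inv_iff_mul_eq g).2 h1.symm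
      rw [h4, Units.val_mul, Units.val_mul]
      simp only [mul_assoc, Units.inv_mul_cancel_left]
      rw [← mul_assoc _ X, h3, ← mul_assoc Y', ← h2]
      simp only [mul_assoc]
    have hGW := key _ _ _ _ hW hW' hkW
    have hGJ := key _ _ _ _ hJ hJ' hkJ
    set G := g' * k * g⁻¹
    have hdet : IsUnit (G : Matrix (Fin 2) (Fin 2) (IntegerRing K E)).det :=
      (Matrix.isUnit_iff_isUnit_det _).1 G.isUnit
    set X := (G : Matrix (Fin 2) (Fin 2) (IntegerRing K E))
    have h01 := congrFun (congrFun hGW 0) 1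
    have hJ01 := congrFun (congrFun hGJ 0) 1
    simp [Matrix.mul_apply, Fin.sum_univ_two] at h01 hJ01
    -- The intertwiner `G` of the two diagonal forms has zero upper right entry, so its diagonal
    -- entries are units, and comparing the antidiagonals relates `a` and `a'` by them.
    have e01 : X 0 1 * (2 * α - T) = 0 := by linear_combination -h01
    have z01 : X 0 1 = 0 := by simpa [hδ.ne_zero] using e01
    rw [Matrix.det_fin_two, z01, zero_mul, sub_zero] at hdet
    have hx := isUnit_of_mul_isUnit_left hdet
    have hy := isUnit_of_mul_isUnit_right hdet
    rw [IntegerRing.isUnit_iff] at hx hy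
    have hv := congrArg (fun z : IntegerRing K E => absVal K E (z : E)) hJ01
    simpa [IntegerRing.associated_iff, hx, hy] using hv
  · rintro ⟨u, rfl⟩
    have ha0 : a ≠ 0 := by
      rintro rfl
      exact hϖ0 (by rw [← hab, zero_mul])
    have hb : b = u * b' := mul_left_cancel₀ ha0 (by rw [hab, ← hab', mul_assoc])
    -- For `a' = au` one has `b = ub'`, and `diag(u, 1)` carries one diagonal form to the other.
    have hGdet : IsUnit (!![(u : IntegerRing K E), 0; 0, 1]).det := by
      rw [Matrix.det_fin_two_of]; simp
    let G := Matrix.GeneralLinearGroup.mk'' !![(u : IntegerRing K E), 0; 0, 1] hGdet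
    have key : ∀ (X X' Y Y' : Matrix (Fin 2) (Fin 2) (IntegerRing K E)),
        (g : Matrix (Fin 2) (Fin 2) (IntegerRing K E)) * X = Y * g →
        (g' : Matrix (Fin 2) (Fin 2) (IntegerRing K E)) * X' = Y' * g' →
        (G : Matrix (Fin 2) (Fin 2) (IntegerRing K E)) * Y = Y' * G →
        ((g'⁻¹ * G * g : GL (Fin 2) (IntegerRing K E)) :
          Matrix (Fin 2) (Fin 2) (IntegerRing K E)) * X =
        X' * ((g'⁻¹ * G * g : GL (Fin 2) (IntegerRing K E)) :
          Matrix (Fin 2) (Fin 2) (IntegerRing K E)) := by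
      intro X X' Y Y' h1 h2 h3
      have h4 : X' = ((g'⁻¹ : GL (Fin 2) (IntegerRing K E)) :
          Matrix (Fin 2) (Fin 2) (IntegerRing K E)) * (Y' * g') :=
        (Units.eq_inv_mul_iff_mul_eq g').2 h2
      rw [h4, Units.val_mul, Units.val_mul]
      simp only [mul_assoc, Units.mul_inv_cancel_left]
      rw [h1, ← mul_assoc _ Y, h3]
      simp only [mul_assoc]
    refine ⟨g'⁻¹ * G * g, key _ _ _ _ hW hW' ?_, key _ _ _ _ hJ hJ' ?_⟩
    · change !![(u : IntegerRing K E), 0; 0, 1] * _ = _ * !![(u : IntegerRing K E), 0; 0, 1]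
      rw [Matrix.mul_fin_two, Matrix.mul_fin_two]
      simp [mul_comm]
    · change !![(u : IntegerRing K E), 0; 0, 1] * _ = _ * !![(u : IntegerRing K E), 0; 0, 1]
      rw [Matrix.mul_fin_two, Matrix.mul_fin_two, hb]
      simp [mul_comm]

omit [TopologicalSpace K] [IsNonarchimedeanLocalField K] [Algebra.IsAlgebraic K E] in
theorem HasDiagonalForm.extend {ρ : IntegralRep D E} {a b : IntegerRing K E}
    (hρ : ρ.HasDiagonalForm e α a b) (L : Type*) [Field L] [Algebra K L]
    [Algebra E L] [IsScalarTower K E L] :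
    (ρ.extend L).HasDiagonalForm e
      (((IsScalarTower.toAlgHom K E L).restrictScalars 𝒪[K]).mapIntegralClosure α)
      (((IsScalarTower.toAlgHom K E L).restrictScalars 𝒪[K]).mapIntegralClosure a)
      (((IsScalarTower.toAlgHom K E L).restrictScalars 𝒪[K]).mapIntegralClosure b) := by
  obtain ⟨g, hW, hJ⟩ := hρ
  let f : IntegerRing K E →ₐ[𝒪[K]] IntegerRing K L :=
    ((IsScalarTower.toAlgHom K E L).restrictScalars 𝒪[K]).mapIntegralClosure
  refine ⟨Units.map (f.mapMatrix (m := Fin 2) : _ →* _) g, ?_, ?_⟩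
  · change f.mapMatrix (g : Matrix (Fin 2) (Fin 2) (IntegerRing K E)) *
        f.mapMatrix (ρ (e (QuaternionAlgebra.Basis.self _).i)) =
      _ * f.mapMatrix (g : Matrix (Fin 2) (Fin 2) (IntegerRing K E))
    rw [← map_mul, hW, map_mul]
    congr 1
    ext i j
    fin_cases i <;> fin_cases j <;> simp [f]
  · change f.mapMatrix (g : Matrix (Fin 2) (Fin 2) (IntegerRing K E)) *
        f.mapMatrix (ρ (e (QuaternionAlgebra.Basis.self _).j)) =
      _ * f.mapMatrix (g : Matrix (Fin 2) (Fin 2) (IntegerRing K E))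
    rw [← map_mul, hJ, map_mul]
    congr 1
    ext i j
    fin_cases i <;> fin_cases j <;> simp [f]

end IntegralRep

end SplitCase

/-! ### Conjugacy classes and the ramification index. -/

section Counting

variable {K : Type*} [Field K] [ValuativeRel K] [TopologicalSpace K] [IsNonarchimedeanLocalField K]
  {E : Type*} [Field E] [Algebra K E] [Algebra.IsAlgebraic K E]

theorem absVal_inv_mul (x y : Eˣ) :
    absVal K E ((x⁻¹ * y : Eˣ) : E) = (absVal K E (x : E))⁻¹ * absVal K E (y : E) := by
  rw [Units.val_mul, Units.val_inv_eq_inv_val, map_mul, map_inv₀]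

/-- A ratio in the value group of `K` other than `1` is at most `|ϖ|` or at least `|ϖ|⁻¹`, too far
apart for two points of the annulus. -/
theorem IsUniformizer.absVal_eq_of_annulus {ϖ : K} (hϖ : IsUniformizer ϖ) {x y : Eˣ}
    (hx : absVal K K ϖ < absVal K E (x : E)) (hx1 : absVal K E (x : E) ≤ 1)
    (hy : absVal K K ϖ < absVal K E (y : E)) (hy1 : absVal K E (y : E) ≤ 1)
    (hxy : ∃ k : K, absVal K E ((x⁻¹ * y : Eˣ) : E) = absVal K K k) :
    absVal K E (x : E) = absVal K E (y : E) := by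
  obtain ⟨k, hk⟩ := hxy
  rw [absVal_inv_mul] at hk
  have hx0 : 0 < absVal K E (x : E) := hϖ.1.trans hx
  have hy0 : 0 < absVal K E (y : E) := hϖ.1.trans hy
  have hk' : absVal K E (y : E) = absVal K K k * absVal K E (x : E) := by
    rw [← hk]; field_simp
  have hk0 : 0 < absVal K K k := by rw [← hk]; positivity
  rcases lt_trichotomy (absVal K K k) 1 with h | h | h
  · have := hϖ.le_of_lt_one h
    nlinarith
  · rw [hk', h, one_mul]
  · have h1 := hϖ.le_of_lt_one (x := k⁻¹) (by rw [map_inv₀]; exact inv_lt_one_of_one_lt₀ h)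
    rw [map_inv₀] at h1
    have h2 : absVal K E (x : E) = (absVal K K k)⁻¹ * absVal K E (y : E) := by
      rw [hk']; field_simp
    have := inv_pos.2 hk0
    nlinarith

variable {A : Type*} [Ring A] [Algebra K A] {D : Subalgebra 𝒪[K] A} {t n ϖ : 𝒪[K]}
  (e : ℍ[𝒪[K], -n, t, ϖ] ≃ₐ[𝒪[K]] D)

namespace IntegralRep

include e in
/-- Over an extension in which `X² - tX + n` splits, the conjugacy classes of representations are
counted by the ramification index. -/
theorem card_conjClass_of_root (h2 : (2 : K) ≠ 0)
    (h : IsResiduallyIrreducible K (t : K) (n : K)) (hϖ : IsUniformizer (ϖ : K))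
    {α : IntegerRing K E} (hα : α ^ 2 - algebraMap 𝒪[K] (IntegerRing K E) t * α +
      algebraMap 𝒪[K] (IntegerRing K E) n = 0) :
    ENat.card (ConjClass D E) = ramificationIndex K E + 1 := by
  set H := (Units.map (algebraMap K E : K →* E)).range ⊔
    (Units.map ((IntegerRing K E).val : IntegerRing K E →* E)).range with hH
  have hϖE : absVal K E ((algebraMap 𝒪[K] (IntegerRing K E) ϖ : IntegerRing K E) : E) =
    absVal K K (ϖ : K) := absVal_algebraMap (ϖ : K)
  -- `some q` stands for the value of the coset `q` in `(|ϖ|, 1]`, and `none` for the endpoint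
  -- `|ϖ|`. Both ends of the interval lie in the trivial coset, which accounts for the extra class.
  have hrep : ∀ o : Option (Eˣ ⧸ H), ∃ (ρ : IntegralRep D E) (a b : IntegerRing K E),
      a * b = algebraMap 𝒪[K] (IntegerRing K E) ϖ ∧ ρ.HasDiagonalForm e α a b ∧
      (o = none → absVal K E (a : E) = absVal K K (ϖ : K)) ∧
      ∀ q, o = some q → absVal K K (ϖ : K) < absVal K E (a : E) ∧
        ∃ x : Eˣ, (x : E) = a ∧ QuotientGroup.mk x = q := by
    rintro (_ | q)
    · obtain ⟨ρ, hρ⟩ := exists_of_diagonalForm e hα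
        (mul_one (algebraMap 𝒪[K] (IntegerRing K E) ϖ))
      exact ⟨ρ, _, _, mul_one _, hρ, fun _ => hϖE, fun q hq => by simp at hq⟩
    · obtain ⟨x, rfl⟩ := QuotientGroup.mk_surjective q
      obtain ⟨k, hk1, hk2⟩ := hϖ.exists_zpow_mul_mem x.ne_zero
      have hne : (x : E) * algebraMap K E ((ϖ : K) ^ k) ≠ 0 :=
        mul_ne_zero x.ne_zero ((map_ne_zero (algebraMap K E)).2 (zpow_ne_zero k hϖ.ne_zero))
      let a : IntegerRing K E := ⟨_, IntegerRing.mem_of_absVal_le_one hk2⟩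
      obtain ⟨b, hb⟩ : a ∣ algebraMap 𝒪[K] (IntegerRing K E) ϖ :=
        IntegerRing.dvd_of_absVal_le (hϖE.trans_le hk1.le)
      obtain ⟨ρ, hρ⟩ := exists_of_diagonalForm e hα hb.symm
      refine ⟨ρ, a, b, hb.symm, hρ, fun h0 => by simp at h0, fun q hq => ⟨hk1, ?_⟩⟩
      refine ⟨Units.mk0 _ hne, rfl, ?_⟩
      rw [← Option.some_injective _ hq]
      refine (QuotientGroup.eq.2 (mem_sup_range_iff.2 ⟨(ϖ : K) ^ k, ?_⟩)).symm
      rw [absVal_inv_mul, Units.val_mk0, map_mul, absVal_algebraMap, ← mul_assoc,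
        inv_mul_cancel₀ ((absVal K E).pos x.ne_zero).ne', one_mul]
  choose ρ a b hab hρ hnone hsome using hrep
  have hbij : Function.Bijective (fun o => Quotient.mk (conjSetoid D E) (ρ o)) := by
    constructor
    · intro o o' hoo
      have hc : (ρ o).IsConjugate (ρ o') := Quotient.exact hoo
      have hv := IntegerRing.associated_iff.1
        (((hρ o).isConjugate_iff h hϖ hα (hab o) (hab o') (hρ o')).1 hc)
      rcases o with _ | q <;> rcases o' with _ | q'
      · rfl
      · rw [hnone none rfl] at hv
        exact absurd hv (hsome _ q' rfl).1.ne
      · rw [hnone none rfl] at hv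
        exact absurd hv (hsome _ q rfl).1.ne'
      · obtain ⟨-, x, hx, rfl⟩ := hsome _ q rfl
        obtain ⟨-, y, hy, rfl⟩ := hsome _ q' rfl
        congr 1
        refine QuotientGroup.eq.2 (mem_sup_range_iff.2 ⟨1, ?_⟩)
        rw [absVal_inv_mul, hx, hy, ← hv, map_one, inv_mul_cancel₀]
        rw [← hx]
        exact ((absVal K E).pos x.ne_zero).ne'
    · rintro ⟨σ⟩
      obtain ⟨c, d, hcd, hσ⟩ := exists_hasDiagonalForm e h2 h hϖ hα σ
      have hcle : absVal K K (ϖ : K) ≤ absVal K E (c : E) := by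
        rw [← hϖE, ← hcd]
        push_cast
        rw [map_mul]
        exact mul_le_of_le_one_right ((absVal K E).nonneg _) (IntegerRing.absVal_le_one d)
      have main : ∀ o, absVal K E (a o : E) = absVal K E (c : E) →
          Quotient.mk (conjSetoid D E) (ρ o) = Quotient.mk _ σ := fun o ho =>
        Quotient.sound (((hρ o).isConjugate_iff h hϖ hα (hab o) hcd hσ).2
          (IntegerRing.associated_iff.2 ho))
      rcases hcle.eq_or_lt with heq | hlt
      · exact ⟨none, main _ ((hnone none rfl).trans heq)⟩
      · have hc0 : (c : E) ≠ 0 := (absVal K E).pos_iff.1 (hϖ.1.trans hlt)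
        obtain ⟨hl, x, hx, hxq⟩ := hsome (some (QuotientGroup.mk (Units.mk0 _ hc0))) _ rfl
        refine ⟨some (QuotientGroup.mk (Units.mk0 _ hc0)), main _ ?_⟩
        rw [← hx] at hl ⊢
        refine hϖ.absVal_eq_of_annulus (y := Units.mk0 _ hc0) hl ?_ hlt
          (IntegerRing.absVal_le_one c) (mem_sup_range_iff.1 (QuotientGroup.eq.1 hxq))
        rw [hx]
        exact IntegerRing.absVal_le_one _
  rw [ramificationIndex, ← hH]
  refine (ENat.card_congr (Equiv.ofBijective _ hbij)).symm.trans ?_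
  cases finite_or_infinite (Eˣ ⧸ H)
  · rw [ENat.card_eq_coe_natCard, ENat.card_eq_coe_natCard, Finite.card_option]
    push_cast
    rfl
  · simp

end IntegralRep

/-- The ramification index is even exactly when the uniformizer of `K` has half-integral
valuation in `E`. -/
theorem even_ramificationIndex_iff {ϖ : K} (hϖ : IsUniformizer ϖ) {r : ℕ}
    (hr : ramificationIndex K E = r) :
    Even r ↔ ∃ a : E, absVal K E a ^ 2 = absVal K K ϖ := by
  rw [ramificationIndex] at hr
  set H := (Units.map (algebraMap K E : K →* E)).range ⊔
    (Units.map ((IntegerRing K E).val : IntegerRing K E →* E)).range with hH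
  have hfin : Finite (Eˣ ⧸ H) := by
    by_contra hinf
    rw [not_finite_iff_infinite] at hinf
    rw [ENat.card_eq_top_of_infinite] at hr
    exact ENat.top_ne_natCast _ hr
  have hcard : Nat.card (Eˣ ⧸ H) = r := by
    rw [ENat.card_eq_coe_natCard] at hr
    exact_mod_cast hr
  constructor
  · intro hev
    have : Fact (Nat.Prime 2) := ⟨Nat.prime_two⟩
    -- Cauchy's theorem gives `x` of order two. Then `|x|²` is an odd power of `|ϖ|`, as an even one
    -- would put `|x|` in the value group of `K`; rescaling leaves `|ϖ|`.
    obtain ⟨q, hq⟩ := exists_prime_orderOf_dvd_card' (G := Eˣ ⧸ H) 2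
      (by rw [hcard]; exact hev.two_dvd)
    obtain ⟨x, rfl⟩ := QuotientGroup.mk_surjective q
    have hx2 : x ^ 2 ∈ H := by
      rw [← QuotientGroup.eq_one_iff, QuotientGroup.mk_pow, ← hq, pow_orderOf_eq_one]
    have hx1 : x ∉ H := by
      rw [← QuotientGroup.eq_one_iff]
      intro h1
      rw [h1, orderOf_one] at hq
      omega
    rw [mem_sup_range_iff] at hx1 hx2
    obtain ⟨k, hk⟩ := hx2
    rw [Units.val_pow_eq_pow_val, map_pow] at hk
    have hk0 : k ≠ 0 := by
      rintro rfl
      rw [map_zero, sq_eq_zero_iff] at hk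
      exact ((absVal K E).pos x.ne_zero).ne' hk
    obtain ⟨m, hm⟩ := hϖ.2.2 k hk0
    obtain ⟨l, rfl | rfl⟩ := Int.even_or_odd' m
    · refine absurd ⟨ϖ ^ l, ?_⟩ hx1
      rw [map_zpow₀]
      refine (pow_left_inj₀ ((absVal K E).nonneg _) (zpow_nonneg hϖ.1.le _) two_ne_zero).1 ?_
      rw [hk, hm, ← zpow_natCast, ← zpow_mul, mul_comm]
      rfl
    · refine ⟨x * algebraMap K E (ϖ ^ (-l)), ?_⟩
      rw [map_mul, mul_pow, hk, hm, absVal_algebraMap, map_zpow₀, ← zpow_natCast, ← zpow_mul,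
        ← zpow_add₀ hϖ.1.ne']
      convert zpow_one _ using 2
      push_cast; ring
  · rintro ⟨a, ha⟩
    have ha0 : a ≠ 0 := by
      rintro rfl
      rw [map_zero, zero_pow two_ne_zero] at ha
      exact hϖ.1.ne ha
    have : orderOf (QuotientGroup.mk (Units.mk0 a ha0) : Eˣ ⧸ H) = 2 := by
      refine orderOf_eq_prime ?_ ?_
      · rw [← QuotientGroup.mk_pow, QuotientGroup.eq_one_iff, mem_sup_range_iff]
        exact ⟨ϖ, by rw [Units.val_pow_eq_pow_val, Units.val_mk0, map_pow, ha]⟩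
      · rw [Ne, QuotientGroup.eq_one_iff, mem_sup_range_iff]
        rintro ⟨k, hk⟩
        refine hϖ.sq_mul_ne (a := 1) (b := k) one_ne_zero ?_
        rw [map_one, one_pow, one_mul, ← hk, Units.val_mk0, ha]
    rw [← hcard, even_iff_two_dvd, ← this]
    exact orderOf_dvd_natCard _

end Counting

/-! ### Balanced diagonal forms of representations coming from the inert case. -/

section Descent

variable {K : Type*} [Field K] [ValuativeRel K] [TopologicalSpace K] [IsNonarchimedeanLocalField K]
  {E L : Type*} [Field E] [Algebra K E] [Algebra.IsAlgebraic K E]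
  [Field L] [Algebra K L] [Algebra.IsAlgebraic K L] [Algebra E L] [IsScalarTower K E L]

theorem absVal_matrix_mul_le {X Y : Matrix (Fin 2) (Fin 2) (IntegerRing K E)} {r s : ℝ}
    (hr : 0 ≤ r) (hX : ∀ i j, absVal K E (X i j : E) ≤ r)
    (hY : ∀ i j, absVal K E (Y i j : E) ≤ s) (i j : Fin 2) :
    absVal K E ((X * Y) i j : E) ≤ r * s := by
  have hm : ∀ k, absVal K E ((X i k : E) * (Y k j : E)) ≤ r * s := fun k => by
    rw [map_mul]
    exact mul_le_mul (hX i k) (hY k j) ((absVal K E).nonneg _) hr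
  rw [Matrix.mul_apply, Fin.sum_univ_two]
  push_cast
  exact absVal_add_le_of_le (hm 0) (hm 1)

theorem absVal_matrix_conj_le {X P Q : Matrix (Fin 2) (Fin 2) (IntegerRing K E)} {r : ℝ}
    (hr : 0 ≤ r) (hX : ∀ i j, absVal K E (X i j : E) ≤ r) (i j : Fin 2) :
    absVal K E ((P * X * Q) i j : E) ≤ r := by
  have h1 := absVal_matrix_mul_le zero_le_one (fun i j => IntegerRing.absVal_le_one (P i j)) hX
  rw [one_mul] at h1
  have h2 := absVal_matrix_mul_le hr h1 (fun i j => IntegerRing.absVal_le_one (Q i j)) i j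
  rwa [mul_one] at h2

omit [Algebra.IsAlgebraic K E] in
/-- Conjugate linear combinations over a field where the polynomial stays irreducible have the
same absolute value. -/
theorem absVal_sub_mul_conj {t n : E} (hno : ∀ r : E, r ^ 2 - t * r + n ≠ 0) {α : L}
    (hα : α ^ 2 - algebraMap E L t * α + algebraMap E L n = 0) (p q : E) :
    absVal K L (algebraMap E L p - α * algebraMap E L q) =
      absVal K L (algebraMap E L p - (algebraMap E L t - α) * algebraMap E L q) := by
  rcases eq_or_ne q 0 with rfl | hq
  · simp
  refine absVal_eq_of_conjugate (K := K) (T := 2 * p - t * q)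
    (N := p ^ 2 - t * p * q + n * q ^ 2) (fun r hr => hno ((p - r) / q) ?_) ?_ ?_
  · field_simp
    linear_combination hr
  · simp only [map_sub, map_mul, map_ofNat]; ring
  · simp only [map_sub, map_mul, map_add, map_pow]
    linear_combination -(algebraMap E L q) ^ 2 * hα

variable {A : Type*} [Ring A] [Algebra K A] {D : Subalgebra 𝒪[K] A} {t n ϖ : 𝒪[K]}
  {e : ℍ[𝒪[K], -n, t, ϖ] ≃ₐ[𝒪[K]] D}

namespace IntegralRep

omit [Algebra.IsAlgebraic K E] in
/-- A representation coming from an extension where `X² - tX + n` is irreducible has a balanced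
diagonal form. -/
theorem HasDiagonalForm.absVal_sq_eq (h : IsResiduallyIrreducible K (t : K) (n : K))
    (hno : ∀ r : E, r ^ 2 - algebraMap K E (t : K) * r + algebraMap K E (n : K) ≠ 0)
    {ρ : IntegralRep D E} {α a b : IntegerRing K L}
    (hα : α ^ 2 - algebraMap 𝒪[K] (IntegerRing K L) t * α +
      algebraMap 𝒪[K] (IntegerRing K L) n = 0)
    (hab : a * b = algebraMap 𝒪[K] (IntegerRing K L) ϖ)
    (hρ : (ρ.extend L).HasDiagonalForm e α a b) :
    absVal K L (a : L) ^ 2 = absVal K K (ϖ : K) := by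
  obtain ⟨g, hW, hJ⟩ := hρ
  set T := algebraMap 𝒪[K] (IntegerRing K L) t with hT
  set W := ρ.extend L (e (QuaternionAlgebra.Basis.self _).i) with hWdef
  set J := ρ.extend L (e (QuaternionAlgebra.Basis.self _).j) with hJdef
  have hδ := isUnit_two_mul_root_sub h hα
  rw [IntegerRing.isUnit_iff] at hδ
  have hδ' : absVal K L ((T - 2 * α : IntegerRing K L) : L) = 1 := by
    rw [← neg_sub, NegMemClass.coe_neg, (absVal K L).map_neg]
    exact hδ
  -- Entries of `W` and `J` come from `E`, so `(W - α)J` and `(W - (T - α))J` are conjugate entry by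
  -- entry. In diagonal form they retain only `b` and only `a`, up to units; as integral conjugation
  -- preserves the largest entry, `|a| = |b|`.
  have hconj : ∀ i j, absVal K L (((W - α • (1 : Matrix (Fin 2) (Fin 2) (IntegerRing K L))) * J) i j : L) =
      absVal K L (((W - (T - α) • (1 : Matrix (Fin 2) (Fin 2) (IntegerRing K L))) * J) i j : L) := by
    intro i j
    have hentry : ∀ c : IntegerRing K L, (((W - c • (1 : Matrix (Fin 2) (Fin 2) (IntegerRing K L))) * J) i j : L) =
        algebraMap E L (((ρ (e (QuaternionAlgebra.Basis.self _).i) *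
          ρ (e (QuaternionAlgebra.Basis.self _).j)) i j : IntegerRing K E) : E) -
        (c : L) * algebraMap E L ((ρ (e (QuaternionAlgebra.Basis.self _).j) i j :
          IntegerRing K E) : E) := by
      intro c
      have hWJ : W * J = (ρ.extend L) (e (QuaternionAlgebra.Basis.self _).i *
        e (QuaternionAlgebra.Basis.self _).j) := (map_mul (ρ.extend L) _ _).symm
      rw [sub_mul, smul_mul_assoc, one_mul, hWJ, Matrix.sub_apply, Matrix.smul_apply,
        ← map_mul ρ]
      rfl
    rw [hentry, hentry]
    have hTα : ((T - α : IntegerRing K L) : L) =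
        algebraMap E L (algebraMap K E (t : K)) - α := by
      rw [← IsScalarTower.algebraMap_apply K E L]
      rfl
    rw [hTα]
    refine absVal_sub_mul_conj (K := K) (L := L) hno (α := α) ?_ _ _
    have := congrArg (Subtype.val) hα
    rw [← IsScalarTower.algebraMap_apply K E L, ← IsScalarTower.algebraMap_apply K E L]
    exact this
  have hform : ∀ c : IntegerRing K L, (g : Matrix (Fin 2) (Fin 2) (IntegerRing K L)) *
      ((W - c • (1 : Matrix (Fin 2) (Fin 2) (IntegerRing K L))) * J) = !![0, (α - c) * a; (T - α - c) * b, 0] * g := by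
    intro c
    have e1 : (g : Matrix (Fin 2) (Fin 2) (IntegerRing K L)) * (W - c • (1 : Matrix (Fin 2) (Fin 2) (IntegerRing K L))) =
        !![α - c, 0; 0, T - α - c] * g := by
      rw [mul_sub, hW, mul_smul_comm, mul_one]
      have : (!![α - c, 0; 0, T - α - c] : Matrix (Fin 2) (Fin 2) (IntegerRing K L)) =
          !![α, 0; 0, T - α] - c • (1 : Matrix (Fin 2) (Fin 2) (IntegerRing K L)) := by
        rw [Matrix.one_fin_two]
        ext i j
        fin_cases i <;> fin_cases j <;> simp
      rw [this, sub_mul, smul_mul_assoc, one_mul]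
    rw [← mul_assoc, e1, mul_assoc, hJ, ← mul_assoc, Matrix.mul_fin_two]
    simp
  have hbound : ∀ (c c' : IntegerRing K L) (r : ℝ), 0 ≤ r →
      (∀ i j, absVal K L (((W - c • (1 : Matrix (Fin 2) (Fin 2) (IntegerRing K L))) * J) i j : L) =
        absVal K L (((W - c' • (1 : Matrix (Fin 2) (Fin 2) (IntegerRing K L))) * J) i j : L)) →
      (∀ i j, absVal K L ((!![0, (α - c) * a; (T - α - c) * b, 0] :
        Matrix (Fin 2) (Fin 2) (IntegerRing K L)) i j : L) ≤ r) →
      ∀ i j, absVal K L ((!![0, (α - c') * a; (T - α - c') * b, 0] :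
        Matrix (Fin 2) (Fin 2) (IntegerRing K L)) i j : L) ≤ r := by
    intro c c' r hr hcc hle
    have e1 : (W - c • (1 : Matrix (Fin 2) (Fin 2) (IntegerRing K L))) * J =
        ((g⁻¹ : GL (Fin 2) (IntegerRing K L)) : Matrix (Fin 2) (Fin 2) (IntegerRing K L)) *
          !![0, (α - c) * a; (T - α - c) * b, 0] * g := by
      rw [mul_assoc, ← hform, Units.inv_mul_cancel_left]
    have e2 : !![0, (α - c') * a; (T - α - c') * b, 0] =
        (g : Matrix (Fin 2) (Fin 2) (IntegerRing K L)) *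
        ((W - c' • (1 : Matrix (Fin 2) (Fin 2) (IntegerRing K L))) * J) *
        ((g⁻¹ : GL (Fin 2) (IntegerRing K L)) : Matrix (Fin 2) (Fin 2) (IntegerRing K L)) := by
      rw [hform, mul_assoc, Units.mul_inv, mul_one]
    rw [e2]
    refine absVal_matrix_conj_le hr fun i j => ?_
    rw [← hcc, e1]
    exact absVal_matrix_conj_le hr hle i j
  have hba : absVal K L (b : L) ≤ absVal K L (a : L) := by
    have := hbound (T - α) α (absVal K L (a : L)) ((absVal K L).nonneg _)
      (fun i j => (hconj i j).symm) (fun i j => ?_) 1 0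
    · simp only [Matrix.of_apply, Matrix.cons_val', Matrix.cons_val_zero, Matrix.cons_val_one,
        Matrix.cons_val_fin_one] at this
      rw [show T - α - α = T - 2 * α by ring, MulMemClass.coe_mul, map_mul, hδ', one_mul] at this
      exact this
    · rw [show α - (T - α) = 2 * α - T by ring, sub_self, zero_mul]
      fin_cases i <;> fin_cases j
      · simp
      · change absVal K L (((2 * α - T : IntegerRing K L) : L) * (a : L)) ≤ _
        rw [map_mul, hδ, one_mul]
      · simp
      · simp
  have hab' : absVal K L (a : L) ≤ absVal K L (b : L) := by
    have := hbound α (T - α) (absVal K L (b : L)) ((absVal K L).nonneg _)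
      hconj (fun i j => ?_) 0 1
    · simp only [Matrix.of_apply, Matrix.cons_val', Matrix.cons_val_zero, Matrix.cons_val_one,
        Matrix.cons_val_fin_one] at this
      rw [show α - (T - α) = 2 * α - T by ring, MulMemClass.coe_mul, map_mul, hδ, one_mul] at this
      exact this
    · rw [show T - α - α = T - 2 * α by ring, sub_self, zero_mul]
      fin_cases i <;> fin_cases j
      · simp
      · simp
      · change absVal K L (((T - 2 * α : IntegerRing K L) : L) * (b : L)) ≤ _
        rw [map_mul, hδ', one_mul]
      · simp
  have hprod := congrArg (fun z : IntegerRing K L => absVal K L (z : L)) hab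
  simp only [MulMemClass.coe_mul, map_mul] at hprod
  rw [← hab'.antisymm hba, ← sq] at hprod
  rw [hprod]
  exact absVal_algebraMap (ϖ : K)

end IntegralRep

end Descent

theorem IntegerRing.exists_root {K E : Type*} [Field K] [ValuativeRel K] [Field E] [Algebra K E]
    {t n : 𝒪[K]} {r : E}
    (hr : r ^ 2 - algebraMap K E (t : K) * r + algebraMap K E (n : K) = 0) :
    ∃ α : IntegerRing K E, α ^ 2 - algebraMap 𝒪[K] (IntegerRing K E) t * α +
      algebraMap 𝒪[K] (IntegerRing K E) n = 0 := by
  refine ⟨⟨r, Polynomial.X ^ 2 - Polynomial.C t * Polynomial.X + Polynomial.C n, ?_, ?_⟩,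
    Subtype.ext hr⟩
  · monicity!
  · simp only [Polynomial.eval₂_add, Polynomial.eval₂_sub, Polynomial.eval₂_mul,
      Polynomial.eval₂_pow, Polynomial.eval₂_X, Polynomial.eval₂_C]
    exact hr

/-! ### The criterion for being defined over a split extension. -/

section Definability

variable {K : Type*} [Field K] [ValuativeRel K] [TopologicalSpace K] [IsNonarchimedeanLocalField K]
  {E F L : Type*} [Field E] [Algebra K E] [Algebra.IsAlgebraic K E]
  [Field F] [Algebra K F] [Algebra.IsAlgebraic K F]
  [Field L] [Algebra K L] [Algebra.IsAlgebraic K L]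
  [Algebra E L] [IsScalarTower K E L] [Algebra F L] [IsScalarTower K F L]

variable {A : Type*} [Ring A] [Algebra K A] {D : Subalgebra 𝒪[K] A} {t n ϖ : 𝒪[K]}
  (e : ℍ[𝒪[K], -n, t, ϖ] ≃ₐ[𝒪[K]] D)

namespace IntegralRep

omit [Algebra.IsAlgebraic K E] in
include e in
/-- A representation over an extension without roots descends to an extension with a root exactly
when the uniformizer of `K` has half-integral valuation there. -/
theorem isDefinedOver_iff (h2 : (2 : K) ≠ 0) (h : IsResiduallyIrreducible K (t : K) (n : K))
    (hϖ : IsUniformizer (ϖ : K))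
    (hno : ∀ r : E, r ^ 2 - algebraMap K E (t : K) * r + algebraMap K E (n : K) ≠ 0)
    {α : IntegerRing K F} (hα : α ^ 2 - algebraMap 𝒪[K] (IntegerRing K F) t * α +
      algebraMap 𝒪[K] (IntegerRing K F) n = 0) (ρ : IntegralRep D E) :
    ρ.IsDefinedOver F L ↔ ∃ a : F, absVal K F a ^ 2 = absVal K K (ϖ : K) := by
  let f : IntegerRing K F →ₐ[𝒪[K]] IntegerRing K L :=
    ((IsScalarTower.toAlgHom K F L).restrictScalars 𝒪[K]).mapIntegralClosure
  have hf : ∀ x : IntegerRing K F, absVal K L (f x : L) = absVal K F (x : F) := fun x =>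
    absVal_algebraMap (x : F)
  have hαL : f α ^ 2 - algebraMap 𝒪[K] (IntegerRing K L) t * f α +
      algebraMap 𝒪[K] (IntegerRing K L) n = 0 := by
    simpa only [map_add, map_sub, map_mul, map_pow, AlgHom.commutes, map_zero] using
      congrArg f hα
  have hfmul : ∀ {x y : IntegerRing K F}, x * y = algebraMap 𝒪[K] (IntegerRing K F) ϖ →
      f x * f y = algebraMap 𝒪[K] (IntegerRing K L) ϖ := fun hxy => by
    rw [← map_mul, hxy, AlgHom.commutes]
  obtain ⟨a, b, hab, hρ⟩ := exists_hasDiagonalForm e h2 h hϖ hαL (ρ.extend L)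
  have ha := hρ.absVal_sq_eq h hno hαL hab
  constructor
  · rintro ⟨ψ, hψρ⟩
    obtain ⟨c, d, hcd, hψ⟩ := exists_hasDiagonalForm e h2 h hϖ hα ψ
    have hass := ((hψ.extend L).isConjugate_iff h hϖ hαL (hfmul hcd) hab hρ).1 hψρ
    refine ⟨c, ?_⟩
    rw [← hf, ← ha]
    exact congrArg (· ^ 2) (IntegerRing.associated_iff.1 hass)
  · rintro ⟨c, hc⟩
    have hc1 : absVal K F c ≤ 1 := by
      rw [← sq_le_one_iff₀ ((absVal K F).nonneg _), hc]
      exact hϖ.2.1.le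
    -- The descended form is antidiagonal with entries `c` and `ϖ / c`, integral since `|ϖ| = |c|² ≤
    -- |c|`.
    obtain ⟨d, hd⟩ : (⟨c, IntegerRing.mem_of_absVal_le_one hc1⟩ : IntegerRing K F) ∣
        algebraMap 𝒪[K] (IntegerRing K F) ϖ := by
      refine IntegerRing.dvd_of_absVal_le ?_
      change absVal K F (algebraMap K F (ϖ : K)) ≤ absVal K F c
      rw [absVal_algebraMap, ← hc]
      exact pow_le_of_le_one ((absVal K F).nonneg _) hc1 two_ne_zero
    obtain ⟨ψ, hψ⟩ := exists_of_diagonalForm e hα hd.symm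
    refine ⟨ψ, ((hψ.extend L).isConjugate_iff h hϖ hαL (hfmul hd.symm) hab hρ).2
      (IntegerRing.associated_iff.2 ?_)⟩
    rw [← pow_left_inj₀ ((absVal K L).nonneg _) ((absVal K L).nonneg _) two_ne_zero, ha, ← hc]
    exact congrArg (· ^ 2) (hf _)

end IntegralRep

end Definability

end

theorem corollary1
    {K : Type*} [Field K] [ValuativeRel K] [TopologicalSpace K] [IsNonarchimedeanLocalField K]
    (hchar : (2 : K) ≠ 0)
    -- the quaternion division algebra and its maximal order
    {A : Type*} [DivisionRing A] [Algebra K A] (hA : IsQuaternionAlgebra K A)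
    (D : Subalgebra 𝒪[K] A) (hD : IsMaximalOrder D)
    (Δ : 𝒪[K]) (hΔ : IsUnramifiedUnit Δ)
    -- the algebraic extensions `E₁` and `E₂`, inside an algebraic extension `L`
    {E₁ E₂ L : Type*} [Field E₁] [Field E₂] [Field L]
    [Algebra K E₁] [Algebra K E₂] [Algebra K L]
    [Algebra.IsAlgebraic K E₁] [Algebra.IsAlgebraic K E₂] [Algebra.IsAlgebraic K L]
    [Algebra E₁ L] [IsScalarTower K E₁ L] [Algebra E₂ L] [IsScalarTower K E₂ L]
    (hE₁ : IsSquare (algebraMap K E₁ (Δ : K)))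
    (hE₂ : ∃ F : IntermediateField K E₂, Module.finrank K F = 2)
    (hE₂' : ¬ IsSquare (algebraMap K E₂ (Δ : K))) :
    -- (1)
    (Nonempty (IntegralRep D E₂) ∧ ∀ ρ ρ' : IntegralRep D E₂, ρ.IsConjugate ρ') ∧
    -- (2)
    ENat.card (IntegralRep.ConjClass D E₁) = ramificationIndex K E₁ + 1 ∧
    -- (3)
    (∀ e₁ : ℕ, ramificationIndex K E₁ = e₁ →
      ∀ ρ : IntegralRep D E₂, ρ.IsDefinedOver E₁ L ↔ Even e₁) := by
  obtain ⟨t, n, ϖ, h, hϖ, ⟨e⟩⟩ := hD.exists_quaternion_presentation hchar hA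
  obtain ⟨t₀, n₀, s₀, h₀, hs₀⟩ := hΔ.exists_disc_eq hchar
  have hno : ∀ r : E₂, r ^ 2 - algebraMap K E₂ (t : K) * r + algebraMap K E₂ (n : K) ≠ 0 :=
    fun r hr => hE₂' ((h.exists_root_iff_isSquare hchar h₀ hs₀).1 ⟨r, hr⟩)
  obtain ⟨r, hr⟩ := (h.exists_root_iff_isSquare (E := E₁) hchar h₀ hs₀).2 hE₁
  obtain ⟨α, hα⟩ := IntegerRing.exists_root hr
  refine ⟨⟨IntegralRep.nonempty_of_no_root e hchar h hϖ hE₂ hno, fun ρ ρ' =>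
    IntegralRep.isConjugate_of_no_root e hchar h hϖ hno ρ ρ'⟩,
    IntegralRep.card_conjClass_of_root e hchar h hϖ hα, fun e₁ he₁ ρ => ?_⟩
  rw [even_ramificationIndex_iff hϖ he₁]
  exact ρ.isDefinedOver_iff e hchar h hϖ hno hα
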